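/- For a reproducing kernel $K$ on a set, let $\mathcal H(K)$ be its reproducing kernel Hilbert space (RKHS) of real functions. Write $\mathcal H(K_1)\hookrightarrow \mathcal H(K_2)$ if $\mathcal H(K_1)\subseteq \mathcal H(K_2)$ and $\|f\|_{K_2}\le C\|f\|_{K_1}$ for all $f\in\mathcal H(K_1)$ with some constant $C>0$; write $\mathcal H(K_1)\rightleftharpoons \mathcal H(K_2)$ if both $\mathcal H(K_1)\hookrightarrow \mathcal H(K_2)$ and $\mathcal H(K_2)\hookrightarrow \mathcal H(K_1)$; and $\mathcal H(K_1)=\mathcal H(K_2)$ means the same functions with the same norms. Let $\alpha\ge 1$ be an integer. For $x,y\in[0,1]$ put $$K^{\mathrm{kor}}_{\alpha}(x,y)=1+\sum_{h\in\mathbb Z\setminus\{0\}}\frac{e^{2\pi \mathrm i h(x-y)}}{|h|^{2\alpha}},\qquad K^{\cos}_{\alpha}(x,y)=1+\sum_{k=1}^{\infty}\frac{2\cos(\pi kx)\cos(\pi ky)}{k^{2\alpha}},\qquad K^{\mathrm{kor}+\cos}_{\alpha}=\tfrac12\bigl(K^{\mathrm{kor}}_{\alpha}+K^{\cos}_{\alpha}\bigr),$$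 $$K^{\mathrm{sob}}_{\alpha}(x,y)=1+\sum_{\tau=1}^{\alpha}\frac{B_\tau(x)B_\tau(y)}{(\tau!)^2}+(-1)^{\alpha+1}\frac{B_{2\alpha}(|x-y|)}{(2\alpha)!},$$ where $B_\tau$ is the Bernoulli polynomial of degree $\tau$. Let $K^{\mathrm{sob\text{-}odd}}_{\alpha}$, $K^{\mathrm{sob\text{-}odd}+\alpha}_{\alpha}$ and $K^{\mathrm{sob\text{-}odd\text{-}bdry}0}_{\alpha}$ be the reproducing kernels of the subspaces of $\mathcal H(K^{\mathrm{sob}}_{\alpha})$ (with the inherited norm) consisting of the $f$ with, respectively, * (odd) $f^{(\tau)}(0)=f^{(\tau)}(1)$ for all odd $\tau\le\alpha-1$; * (odd+$\alpha$) $f^{(\tau)}(0)=f^{(\tau)}(1)$ for all odd $\tau\le\alpha-2$; * (odd-bdry0) $f^{(\tau)}(0)=f^{(\tau)}(1)=0$ for all odd $\tau\le\alpha-1$. These three subspaces are indeed RKHSs. For a dimension $s$ and weights $\gamma=(\gamma_u)_{u\subseteq\{1,\dots,s\}}$, $\gamma_u\ge0$, define kernels on $[0,1]^s$ by $$K^{\bullet}_{\alpha,\gamma,s}(\mathbf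 x,\mathbf y)=1+\sum_{\emptyset\ne u\subseteq\{1,\dots,s\}}\gamma_u\prod_{j\in u}\bigl[-1+K^{\bullet}_{\alpha}(x_j,y_j)\bigr]$$ for $\bullet\in\{\mathrm{kor}+\cos,\ \mathrm{sob},\ \mathrm{sob\text{-}odd},\ \mathrm{sob\text{-}odd}+\alpha,\ \mathrm{sob\text{-}odd\text{-}bdry}0\}$, and $$K^{\cos}_{\alpha,\gamma,s}(\mathbf x,\mathbf y)=1+\sum_{\emptyset\ne u\subseteq\{1,\dots,s\}}\ \sum_{\mathbf k_u\in\mathbb N^{|u|}}\gamma_u\prod_{j\in u}k_j^{-2\alpha}\prod_{j\in u}2\cos(\pi k_jx_j)\cos(\pi k_jy_j).$$ Abbreviate $\mathcal H^{\bullet}=\mathcal H(K^{\bullet}_{\alpha,\gamma,s})$. Then all six $K^\bullet_{\alpha,\gamma,s}$ are reproducing kernels, and the following holds. 1. For $\alpha=1$: $\ \mathcal H^{\cos}\rightleftharpoons\mathcal H^{\mathrm{kor}+\cos}\rightleftharpoons\mathcal H^{\mathrm{sob}}=\mathcal H^{\mathrm{sob\text{-}odd}}=\mathcal H^{\mathrm{sob\text{-}odd}+\alpha}=\mathcal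 H^{\mathrm{sob\text{-}odd\text{-}bdry}0}$. 2. For odd $\alpha>1$: $\ \mathcal H^{\cos}\rightleftharpoons\mathcal H^{\mathrm{sob\text{-}odd\text{-}bdry}0}\hookrightarrow\mathcal H^{\mathrm{kor}+\cos}\rightleftharpoons\mathcal H^{\mathrm{sob\text{-}odd}}=\mathcal H^{\mathrm{sob\text{-}odd}+\alpha}\hookrightarrow\mathcal H^{\mathrm{sob}}$. 3. For even $\alpha$: $\ \mathcal H^{\cos}\rightleftharpoons\mathcal H^{\mathrm{sob\text{-}odd\text{-}bdry}0}\hookrightarrow\mathcal H^{\mathrm{kor}+\cos}\rightleftharpoons\mathcal H^{\mathrm{sob\text{-}odd}}\hookrightarrow\mathcal H^{\mathrm{sob\text{-}odd}+\alpha}\hookrightarrow\mathcal H^{\mathrm{sob}}$, where $\mathcal H^{\mathrm{sob\text{-}odd}+\alpha}=\mathcal H^{\mathrm{sob}}$ if $\alpha=2$. 4. If $\alpha\ge2$ and $\gamma_u>0$ for some non-empty $u$, then $\mathcal H^{\mathrm{kor}+\cos}\subsetneq\mathcal H^{\mathrm{sob}}$ as sets. (This answers an open question of Dick, Nuyens and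 Pillichshammer.) 5. For $s=1$ and a weight $\gamma_{\{1\}}>0$, the spaces $\mathcal H^{\mathrm{sob\text{-}odd}}$, $\mathcal H^{\mathrm{sob\text{-}odd}+\alpha}$, $\mathcal H^{\mathrm{sob\text{-}odd\text{-}bdry}0}$ are exactly the subspaces of the weighted space $\mathcal H^{\mathrm{sob}}$, with the inherited norm, given by the conditions (odd), (odd+$\alpha$), (odd-bdry0). So, for $s=1$, $\mathcal H^{\cos}$ is norm-equivalent to the subspace of $\mathcal H^{\mathrm{sob}}$ on which the odd derivatives of order $\le\alpha-1$ vanish at $0$ and $1$, and $\mathcal H^{\mathrm{kor}+\cos}$ to the one on which these derivatives take equal values at $0$ and $1$. -/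

import Mathlib

open scoped unitInterval

noncomputable section

/-! ### Reproducing kernel Hilbert spaces of real functions, their embeddings and subspaces -/

/-- `InRKHS K f r`: the function `f` belongs to the reproducing kernel Hilbert space `H(K)`
(the Hilbert space of real functions on `X` whose reproducing kernel is `K`)
and its norm in `H(K)` is `r`. -/
def InRKHS {X : Type} (K : X → X → ℝ) (f : X → ℝ) (r : ℝ) : Prop :=
  ∃ (H : Type) (_ : NormedAddCommGroup H) (_ : InnerProductSpace ℝ H) (_ : CompleteSpace H)
    (_ : RKHS ℝ H X ℝ),
    (∀ x y, RKHS.kernel H x y (1 : ℝ) = K x y) ∧ ∃ g : H, (⇑g : X → ℝ) = f ∧ ‖g‖ = r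

/-- `K` is a reproducing kernel: the space `H(K)` exists. -/
def IsReproducingKernel {X : Type} (K : X → X → ℝ) : Prop :=
  ∃ (H : Type) (_ : NormedAddCommGroup H) (_ : InnerProductSpace ℝ H) (_ : CompleteSpace H)
    (_ : RKHS ℝ H X ℝ), ∀ x y, RKHS.kernel H x y (1 : ℝ) = K x y

/-- `f ∈ H(K)`. -/
def MemRKHS {X : Type} (K : X → X → ℝ) (f : X → ℝ) : Prop :=
  ∃ r, InRKHS K f r

/-- Continuous embedding `H(K₁) ↪ H(K₂)`: `H(K₁) ⊆ H(K₂)` and there is `C > 0` with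
`‖f‖_{K₂} ≤ C ‖f‖_{K₁}` for all `f ∈ H(K₁)`. -/
def Embeds {X : Type} (K₁ K₂ : X → X → ℝ) : Prop :=
  ∃ C : ℝ, 0 < C ∧ ∀ f r₁, InRKHS K₁ f r₁ → ∃ r₂, InRKHS K₂ f r₂ ∧ r₂ ≤ C * r₁

/-- Norm equivalence `H(K₁) ⇌ H(K₂)`. -/
def NormEquivalent {X : Type} (K₁ K₂ : X → X → ℝ) : Prop :=
  Embeds K₁ K₂ ∧ Embeds K₂ K₁

/-- Equality `H(K₁) = H(K₂)`: the same functions with the same norms. -/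
def SameRKHS {X : Type} (K₁ K₂ : X → X → ℝ) : Prop :=
  ∀ f r, InRKHS K₁ f r ↔ InRKHS K₂ f r

/-- `k` is the reproducing kernel of `{f ∈ H(K) | P f}` with the norm inherited from `H(K)`:
the space `H(k)` exists, it consists of exactly these functions, and it carries this norm. -/
def IsKernelOfSubspace {X : Type} (K : X → X → ℝ) (P : (X → ℝ) → Prop) (k : X → X → ℝ) : Prop :=
  IsReproducingKernel k ∧ ∀ f r, InRKHS k f r ↔ InRKHS K f r ∧ P f

/-- The reproducing kernel of the subspace `{f ∈ H(K) | P f}` of `H(K)`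
(an unspecified function if that subspace is not a reproducing kernel Hilbert space). -/
def subspaceKernel {X : Type} (K : X → X → ℝ) (P : (X → ℝ) → Prop) : X → X → ℝ :=
  Classical.epsilon (IsKernelOfSubspace K P)

/-! ### Univariate kernels with unit weight -/

/-- The Korobov kernel `∑_{h ∈ ℤ} r(h) e^{2πih(x-y)}` with `r(0) = 1`, `r(h) = |h|^{-2α}`
(the terms for `h` and `-h` are conjugate, so that only the cosines remain). -/
def korKernel₁ (α : ℕ) (x y : I) : ℝ :=
  ∑' h : ℤ, (if h = 0 then 1 else 1 / |(h : ℝ)| ^ (2 * α)) *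
    Real.cos (2 * Real.pi * h * ((x : ℝ) - y))

/-- The half-period cosine kernel. -/
def cosKernel₁ (α : ℕ) (x y : I) : ℝ :=
  1 + ∑' k : ℕ+, 1 / (k : ℝ) ^ (2 * α) *
    (2 * Real.cos (Real.pi * k * x) * Real.cos (Real.pi * k * y))

/-- The kernel of the sum of the Korobov and the half-period cosine space. -/
def korCosKernel₁ (α : ℕ) (x y : I) : ℝ :=
  (korKernel₁ α x y + cosKernel₁ α x y) / 2

/-- The kernel of the non-periodic Sobolev space of order `α`. -/
def sobKernel₁ (α : ℕ) (x y : I) : ℝ :=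
  1 + ∑ τ ∈ Finset.Icc 1 α, bernoulliFun τ x * bernoulliFun τ y / (τ.factorial : ℝ) ^ 2
    + (-1) ^ (α + 1) * bernoulliFun (2 * α) |(x : ℝ) - y| / ((2 * α).factorial : ℝ)

/-- The derivative `f^{(τ)}(t)` of a function on `[0,1]`, one-sided at the end points. -/
def derivI (τ : ℕ) (f : I → ℝ) (t : I) : ℝ :=
  iteratedDerivWithin τ (Set.IccExtend (zero_le_one' ℝ) f) (Set.Icc 0 1) (t : ℝ)

/-- `f^{(τ)}(0) = f^{(τ)}(1)` for all odd `τ ≤ α - 1`. -/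
def OddPeriodic (α : ℕ) (f : I → ℝ) : Prop :=
  ∀ τ : ℕ, Odd τ → τ + 1 ≤ α → derivI τ f 0 = derivI τ f 1

/-- `f^{(τ)}(0) = f^{(τ)}(1)` for all odd `τ ≤ α - 2`. -/
def OddPeriodicLower (α : ℕ) (f : I → ℝ) : Prop :=
  ∀ τ : ℕ, Odd τ → τ + 2 ≤ α → derivI τ f 0 = derivI τ f 1

/-- `f^{(τ)}(0) = f^{(τ)}(1) = 0` for all odd `τ ≤ α - 1`. -/
def OddVanishing (α : ℕ) (f : I → ℝ) : Prop :=
  ∀ τ : ℕ, Odd τ → τ + 1 ≤ α → derivI τ f 0 = 0 ∧ derivI τ f 1 = 0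

/-- The kernel of the univariate space `sob-odd`. -/
def sobOddKernel₁ (α : ℕ) : I → I → ℝ := subspaceKernel (sobKernel₁ α) (OddPeriodic α)

/-- The kernel of the univariate space `sob-odd+α`. -/
def sobOddAlphaKernel₁ (α : ℕ) : I → I → ℝ := subspaceKernel (sobKernel₁ α) (OddPeriodicLower α)

/-- The kernel of the univariate space `sob-odd-bdry0`. -/
def sobOddBdryKernel₁ (α : ℕ) : I → I → ℝ := subspaceKernel (sobKernel₁ α) (OddVanishing α)

/-! ### Weighted kernels on `[0,1]^s` -/

/-- `1 + ∑_{∅ ≠ u ⊆ 1:s} γ_u ∏_{j ∈ u} (-1 + k(x_j, y_j))`. -/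
def weightedKernel {s : ℕ} (γ : Finset (Fin s) → ℝ) (k : I → I → ℝ) (x y : Fin s → I) : ℝ :=
  1 + ∑ u : Finset (Fin s) with u.Nonempty, γ u * ∏ j ∈ u, (-1 + k (x j) (y j))

/-- The weighted half-period cosine kernel:
`1 + ∑_{∅ ≠ u} ∑_{k ∈ ℕ^u} γ_u ∏_{j ∈ u} k_j^{-2α} ∏_{j ∈ u} 2 cos(π k_j x_j) cos(π k_j y_j)`. -/
def cosKernel (α : ℕ) {s : ℕ} (γ : Finset (Fin s) → ℝ) (x y : Fin s → I) : ℝ :=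
  1 + ∑ u : Finset (Fin s) with u.Nonempty, ∑' k : u → ℕ+,
    (γ u * ∏ j : u, 1 / (k j : ℝ) ^ (2 * α)) *
      ∏ j : u, (2 * Real.cos (Real.pi * k j * x j) * Real.cos (Real.pi * k j * y j))

/-- The weighted kernel `kor+cos`. -/
def korCosKernel (α : ℕ) {s : ℕ} (γ : Finset (Fin s) → ℝ) : (Fin s → I) → (Fin s → I) → ℝ :=
  weightedKernel γ (korCosKernel₁ α)

/-- The weighted kernel `sob`. -/
def sobKernel (α : ℕ) {s : ℕ} (γ : Finset (Fin s) → ℝ) : (Fin s → I) → (Fin s → I) → ℝ :=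
  weightedKernel γ (sobKernel₁ α)

/-- The weighted kernel `sob-odd`. -/
def sobOddKernel (α : ℕ) {s : ℕ} (γ : Finset (Fin s) → ℝ) : (Fin s → I) → (Fin s → I) → ℝ :=
  weightedKernel γ (sobOddKernel₁ α)

/-- The weighted kernel `sob-odd+α`. -/
def sobOddAlphaKernel (α : ℕ) {s : ℕ} (γ : Finset (Fin s) → ℝ) :
    (Fin s → I) → (Fin s → I) → ℝ :=
  weightedKernel γ (sobOddAlphaKernel₁ α)

/-- The weighted kernel `sob-odd-bdry0`. -/
def sobOddBdryKernel (α : ℕ) {s : ℕ} (γ : Finset (Fin s) → ℝ) : (Fin s → I) → (Fin s → I) → ℝ :=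
  weightedKernel γ (sobOddBdryKernel₁ α)

/-- The univariate function on `[0,1]` given by a function on `[0,1]^1`. -/
def toUnivariate (f : (Fin 1 → I) → ℝ) (t : I) : ℝ := f fun _ => t

end

/-! ### Positive semidefinite kernels -/

section Kernels

variable {X Y : Type}

/-! The weighted, multivariate statements all reduce to set inclusions between univariate spaces
with the constants split off, that is, with kernels `-1 + k`.

The reduction rests on positive semidefinite kernels. Whenever `C * L - K` is positive semidefinite,
`H(K)` embeds in `H(L)` (`embeds_of_le`). By the closed graph theorem a mere inclusion of sets
already yields such a `C` (`exists_le_of_memRKHS`). The inequality passes to products by Schur's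
theorem (`IsPSD.prod_sub_prod`), hence to sums over `u` with arbitrary nonnegative weights
(`exists_weightedKernel_le`).

In one variable, `-1 + sobKernel₁ α` is the space of Sobolev functions of order `α` with mean zero
(`memRKHS_sob_iff_tower`): the Bernoulli polynomials carry the jumps `f^{(τ)}(1) - f^{(τ)}(0)`, and
what remains is periodic and has a Fourier series with weighted `ℓ²` coefficients. Repeated
integration by parts against `cos (π k x)` meets boundary terms only from odd derivatives, so the
cosine space is the part of the Sobolev space where these vanish at both ends
(`memRKHS_cos_iff_oddVanishing`). If they are merely periodic, a 1-periodic sine polynomial, which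
is a Korobov function, can be subtracted to make them vanish; hence the sum of the Korobov and
cosine spaces is the part with periodic odd derivatives (`memRKHS_korCos_iff_oddPeriodic`).

The three conditions on derivatives define closed subspaces, because point evaluations of
derivatives of order below `α` are continuous (`exists_clm_derivI`). The kernel of such a subspace
comes from projecting the feature map (`IsOddCondition.subspaceKernel_spec`), and the conditions do
not see constants since only odd orders occur.

Strictness for `α ≥ 2` is witnessed by `∏ j ∈ u, B₂(x_j) / 2`: freezing all variables but one leaves
a function whose first derivative takes different values at `0` and `1`. -/

/-- `K` is a symmetric positive semidefinite kernel. -/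
def IsPSD (K : X → X → ℝ) : Prop := (Matrix.of K).PosSemidef

/-- The quadratic form of a kernel. -/
def quad (K : X → X → ℝ) (c : X →₀ ℝ) : ℝ := c.sum fun x a => c.sum fun y b => a * K x y * b

lemma IsPSD.symm {K : X → X → ℝ} (h : IsPSD K) (x y : X) : K x y = K y x := by
  have := h.1.apply y x
  simpa using this

lemma IsPSD.quad_nonneg {K : X → X → ℝ} (h : IsPSD K) (c : X →₀ ℝ) : 0 ≤ quad K c := by
  simpa [quad] using h.2 c

lemma isPSD_of_quad {K : X → X → ℝ} (hs : ∀ x y, K x y = K y x) (hq : ∀ c, 0 ≤ quad K c) :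
    IsPSD K := by
  refine ⟨?_, fun c => by simpa [quad] using hq c⟩
  ext x y
  simpa using hs y x

lemma quad_const_mul (C : ℝ) (K : X → X → ℝ) (c : X →₀ ℝ) :
    quad (fun x y => C * K x y) c = C * quad K c := by
  simp only [quad, Finsupp.sum, Finset.mul_sum]
  refine Finset.sum_congr rfl fun x _ => Finset.sum_congr rfl fun y _ => by ring

lemma quad_sub (K L : X → X → ℝ) (c : X →₀ ℝ) :
    quad (fun x y => K x y - L x y) c = quad K c - quad L c := by
  simp [quad, Finsupp.sum, mul_sub, sub_mul, Finset.sum_sub_distrib]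

lemma IsPSD.add {K L : X → X → ℝ} (hK : IsPSD K) (hL : IsPSD L) :
    IsPSD fun x y => K x y + L x y :=
  Matrix.PosSemidef.add hK hL

lemma IsPSD.const_mul {K : X → X → ℝ} (hK : IsPSD K) {C : ℝ} (hC : 0 ≤ C) :
    IsPSD fun x y => C * K x y :=
  Matrix.PosSemidef.smul hK hC

lemma IsPSD.mul {K L : X → X → ℝ} (hK : IsPSD K) (hL : IsPSD L) :
    IsPSD fun x y => K x y * L x y :=
  Matrix.PosSemidef.hadamard hK hL

lemma IsPSD.comp {K : X → X → ℝ} (hK : IsPSD K) (p : Y → X) :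
    IsPSD fun x y => K (p x) (p y) :=
  Matrix.PosSemidef.submatrix hK p

section Features

variable {H : Type*} [NormedAddCommGroup H] [InnerProductSpace ℝ H]

open scoped InnerProductSpace

lemma quad_inner (Φ : X → H) (c : X →₀ ℝ) :
    quad (fun x y => ⟪Φ x, Φ y⟫_ℝ) c = ‖c.sum fun x a => a • Φ x‖ ^ 2 := by
  rw [← real_inner_self_eq_norm_sq]
  simp only [quad, Finsupp.sum, sum_inner, inner_sum, real_inner_smul_left, real_inner_smul_right]
  rw [Finset.sum_comm]
  refine Finset.sum_congr rfl fun x _ => Finset.sum_congr rfl fun y _ => ?_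
  rw [real_inner_comm]
  ring

lemma isPSD_inner (Φ : X → H) : IsPSD fun x y => ⟪Φ x, Φ y⟫_ℝ :=
  isPSD_of_quad (fun x y => real_inner_comm _ _) fun c => by rw [quad_inner]; positivity

end Features

lemma isPSD_one : IsPSD fun _ _ : X => (1 : ℝ) := by
  simpa using isPSD_inner fun _ : X => (1 : ℝ)

lemma isPSD_zero : IsPSD fun _ _ : X => (0 : ℝ) := by
  simpa using isPSD_inner fun _ : X => (0 : ℝ)

lemma IsPSD.sum {ι : Type*} (s : Finset ι) {K : ι → X → X → ℝ} (h : ∀ i ∈ s, IsPSD (K i)) :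
    IsPSD fun x y => ∑ i ∈ s, K i x y := by
  classical
  induction s using Finset.induction_on with
  | empty => simpa using isPSD_zero
  | insert i s hi ih =>
    simp only [Finset.sum_insert hi]
    exact (h i (by simp)).add (ih fun j hj => h j (by simp [hj]))

lemma IsPSD.prod {ι : Type*} (s : Finset ι) {K : ι → X → X → ℝ} (h : ∀ i ∈ s, IsPSD (K i)) :
    IsPSD fun x y => ∏ i ∈ s, K i x y := by
  classical
  induction s using Finset.induction_on with
  | empty => simpa using isPSD_one
  | insert i s hi ih =>
    simp only [Finset.prod_insert hi]
    exact (h i (by simp)).mul (ih fun j hj => h j (by simp [hj]))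

/-- Telescoping: `L_i ∏ L - K_i ∏ K = (L_i - K_i) ∏ L + K_i (∏ L - ∏ K)`, where each product is
positive semidefinite by Schur's theorem. This is how a univariate kernel inequality is tensorized.
-/
lemma IsPSD.prod_sub_prod {ι : Type*} (s : Finset ι) {K L : ι → X → X → ℝ}
    (hK : ∀ i ∈ s, IsPSD (K i)) (h : ∀ i ∈ s, IsPSD fun x y => L i x y - K i x y) :
    IsPSD fun x y => ∏ i ∈ s, L i x y - ∏ i ∈ s, K i x y := by
  classical
  induction s using Finset.induction_on with
  | empty => simpa using isPSD_zero
  | insert i s hi ih =>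
    have hL : ∀ j ∈ insert i s, IsPSD (L j) := fun j hj => by
      simpa using (h j hj).add (hK j hj)
    have h1 := (h i (by simp)).mul (IsPSD.prod s fun j hj => hL j (by simp [hj]))
    have h2 := (hK i (by simp)).mul (ih (fun j hj => hK j (by simp [hj]))
      fun j hj => h j (by simp [hj]))
    have h3 := h1.add h2
    simp only [Finset.prod_insert hi]
    convert h3 using 3
    ring

/-! ### The Hilbert space of a kernel -/

open scoped InnerProductSpace

/-- `f` has norm at most `M` in the space with kernel `K`. -/
def BoundedBy (K : X → X → ℝ) (f : X → ℝ) (M : ℝ) : Prop :=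
  ∀ c : X →₀ ℝ, (c.sum fun x a => a * f x) ^ 2 ≤ M ^ 2 * quad K c

section Features

variable {H : Type*} [NormedAddCommGroup H] [InnerProductSpace ℝ H]

/-- The bound says that the functional `c ↦ ∑ c_x f x` is dominated by `M ‖∑ c_x Φ x‖`, so it
descends to the span of the features. Hahn–Banach extends it to `H` without increasing the norm, and
Riesz represents it. -/
lemma boundedBy_inner [CompleteSpace H] (Φ : X → H) {f : X → ℝ} {M : ℝ} (hM : 0 ≤ M) :
    BoundedBy (fun x y => ⟪Φ x, Φ y⟫_ℝ) f M ↔ ∃ v : H, ‖v‖ ≤ M ∧ ∀ x, f x = ⟪v, Φ x⟫_ℝ := by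
  constructor
  · intro h
    set T : (X →₀ ℝ) →ₗ[ℝ] H := Finsupp.linearCombination ℝ Φ with hT
    set ℓ : (X →₀ ℝ) →ₗ[ℝ] ℝ := Finsupp.linearCombination ℝ f with hℓ
    have hb : ∀ c, |ℓ c| ≤ M * ‖T c‖ := by
      intro c
      have h1 := h c
      rw [quad_inner, ← mul_pow] at h1
      have h2 := abs_le_of_sq_le_sq h1 (by positivity)
      simpa [hℓ, hT, Finsupp.linearCombination_apply] using h2
    -- A linear section of `T`. The choice is immaterial: by `hb`, `ℓ` vanishes on the kernel of
    -- `T`.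
    obtain ⟨g, hg⟩ := T.rangeRestrict.exists_rightInverse_of_surjective
      (LinearMap.range_rangeRestrict T)
    have hg' : ∀ w, T (g w) = (w : H) := fun w => by
      have := congrArg (fun φ => ((φ w : LinearMap.range T) : H)) hg
      simpa using this
    let φ : StrongDual ℝ (LinearMap.range T) :=
      (ℓ ∘ₗ g).mkContinuous M fun w => by
        have := hb (g w)
        rw [hg'] at this
        simpa using this
    obtain ⟨ψ, hψ, hψn⟩ := exists_extension_norm_eq (LinearMap.range T) φ
    refine ⟨(InnerProductSpace.toDual ℝ H).symm ψ, ?_, fun x => ?_⟩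
    · rw [LinearIsometryEquiv.norm_map, hψn]
      exact LinearMap.mkContinuous_norm_le _ hM _
    · rw [InnerProductSpace.toDual_symm_apply]
      have hx : T (Finsupp.single x 1) = Φ x := by simp [hT]
      let w : LinearMap.range T := ⟨Φ x, ⟨_, hx⟩⟩
      have h1 : ψ (Φ x) = ℓ (g w) := hψ w
      rw [h1]
      have h2 := hb (Finsupp.single x 1 - g w)
      rw [map_sub T, hx, hg'] at h2
      simp only [w, sub_self, norm_zero, mul_zero, map_sub] at h2
      have h3 := abs_nonpos_iff.mp h2
      have h4 : ℓ (Finsupp.single x 1) = f x := by simp [hℓ]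
      rw [h4] at h3
      linarith
  · rintro ⟨v, hv, hf⟩ c
    rw [quad_inner, ← mul_pow]
    have : (c.sum fun x a => a * f x) = ⟪v, c.sum fun x a => a • Φ x⟫_ℝ := by
      simp [Finsupp.inner_sum, hf, real_inner_smul_right]
    rw [this, ← sq_abs]
    gcongr
    exact (abs_real_inner_le_norm _ _).trans (by gcongr)

end Features

lemma rkhs_kernel_eq_inner (H : Type) [NormedAddCommGroup H] [InnerProductSpace ℝ H]
    [CompleteSpace H] [RKHS ℝ H X ℝ] (x y : X) :
    RKHS.kernel H x y (1 : ℝ) = ⟪RKHS.kerFun H x (1 : ℝ), RKHS.kerFun H y (1 : ℝ)⟫_ℝ := by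
  rw [RKHS.kerFun_inner, RKHS.kerFun_apply]
  simp

lemma rkhs_apply_eq_inner {H : Type} [NormedAddCommGroup H] [InnerProductSpace ℝ H]
    [CompleteSpace H] [RKHS ℝ H X ℝ] (g : H) (x : X) :
    g x = ⟪g, RKHS.kerFun H x (1 : ℝ)⟫_ℝ := by
  rw [RKHS.inner_kerFun]
  simp

/-- Moore–Aronszajn. For existence, the scalar kernel is turned into the operator-valued kernel `K x
y • id` on `ℝ`, to which `RKHS.OfKernel` applies. -/
lemma isReproducingKernel_iff {K : X → X → ℝ} : IsReproducingKernel K ↔ IsPSD K := by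
  constructor
  · rintro ⟨H, _, _, _, _, hK⟩
    have : K = fun x y => ⟪RKHS.kerFun H x (1 : ℝ), RKHS.kerFun H y (1 : ℝ)⟫_ℝ := by
      funext x y
      rw [← hK, rkhs_kernel_eq_inner]
    rw [this]
    exact isPSD_inner _
  · intro h
    let K' : Matrix X X (ℝ →L[ℝ] ℝ) := Matrix.of fun x y => K x y • ContinuousLinearMap.id ℝ ℝ
    have hK' : K'.PosSemidef := by
      have htfae : K'.PosSemidef ↔ K'.IsHermitian ∧ ∀ c : X →₀ ℝ,
          0 ≤ RCLike.re (c.sum fun x w => c.sum fun x' w' => ⟪K' x' x w, w'⟫_ℝ) :=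
        RKHS.posSemidef_tfae.out 0 2
      refine htfae.mpr ⟨?_, fun c => ?_⟩
      · ext x y
        simp [K', h.symm x y, ContinuousLinearMap.star_eq_adjoint,
          ContinuousLinearMap.adjoint_id]
      · have h1 := h.quad_nonneg c
        have h2 : (c.sum fun x w => c.sum fun x' w' => ⟪(K' x' x) w, w'⟫_ℝ) = quad K c := by
          unfold quad
          refine Finset.sum_congr rfl fun x _ => Finset.sum_congr rfl fun y _ => ?_
          simp [K', h.symm x y]
          ring
        rw [h2]
        simpa using h1
    have : Fact K'.PosSemidef := ⟨hK'⟩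
    refine ⟨RKHS.OfKernel K', inferInstance, inferInstance, inferInstance, inferInstance, ?_⟩
    intro x y
    rw [RKHS.OfKernel.kernel_ofKernel]
    simp [K']

/-- Describes the norm by the kernel alone, as the least admissible bound, so that the choice of the
Hilbert space in `InRKHS` no longer matters. -/
lemma inRKHS_iff {K : X → X → ℝ} (hK : IsPSD K) {f : X → ℝ} {r : ℝ} :
    InRKHS K f r ↔ 0 ≤ r ∧ BoundedBy K f r ∧ ∀ M, 0 ≤ M → BoundedBy K f M → r ≤ M := by
  constructor
  · rintro ⟨H, _, _, _, _, hKH, g, rfl, rfl⟩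
    have : K = fun x y => ⟪RKHS.kerFun H x (1 : ℝ), RKHS.kerFun H y (1 : ℝ)⟫_ℝ := by
      funext x y
      rw [← hKH, rkhs_kernel_eq_inner]
    rw [this]
    refine ⟨norm_nonneg _, ?_, fun M hM hb => ?_⟩
    · exact (boundedBy_inner _ (norm_nonneg _)).2 ⟨g, le_rfl, rkhs_apply_eq_inner g⟩
    · obtain ⟨v, hv, hgv⟩ := (boundedBy_inner _ hM).1 hb
      have : g = v := RKHS.ext fun x => by rw [hgv, ← rkhs_apply_eq_inner]
      rwa [this]
  · rintro ⟨hr, hb, hmin⟩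
    obtain ⟨H, _, _, _, _, hKH⟩ := isReproducingKernel_iff.2 hK
    have hK' : K = fun x y => ⟪RKHS.kerFun H x (1 : ℝ), RKHS.kerFun H y (1 : ℝ)⟫_ℝ := by
      funext x y
      rw [← hKH, rkhs_kernel_eq_inner]
    rw [hK'] at hb
    obtain ⟨v, hv, hfv⟩ := (boundedBy_inner _ hr).1 hb
    refine ⟨H, _, _, _, _, hKH, v, ?_, le_antisymm hv (hmin _ (norm_nonneg _) ?_)⟩
    · funext x
      rw [hfv, ← rkhs_apply_eq_inner]
    · rw [hK']
      exact (boundedBy_inner _ (norm_nonneg _)).2 ⟨v, le_rfl, hfv⟩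

lemma exists_inRKHS_of_boundedBy {K : X → X → ℝ} (hK : IsPSD K) {f : X → ℝ} {M : ℝ}
    (hM : 0 ≤ M) (h : BoundedBy K f M) : ∃ r, InRKHS K f r ∧ r ≤ M := by
  obtain ⟨H, i1, i2, i3, i4, hKH⟩ := isReproducingKernel_iff.2 hK
  have hK' : K = fun x y => ⟪RKHS.kerFun H x (1 : ℝ), RKHS.kerFun H y (1 : ℝ)⟫_ℝ := by
    funext x y
    rw [← hKH, rkhs_kernel_eq_inner]
  rw [hK'] at h
  obtain ⟨v, hv, hfv⟩ := (boundedBy_inner _ hM).1 h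
  exact ⟨‖v‖, ⟨H, _, _, _, _, hKH, v, funext fun x => by rw [hfv, ← rkhs_apply_eq_inner], rfl⟩, hv⟩

lemma memRKHS_iff {K : X → X → ℝ} (hK : IsPSD K) {f : X → ℝ} :
    MemRKHS K f ↔ ∃ M, 0 ≤ M ∧ BoundedBy K f M := by
  constructor
  · rintro ⟨r, hr⟩
    have := (inRKHS_iff hK).1 hr
    exact ⟨r, this.1, this.2.1⟩
  · rintro ⟨M, hM, hb⟩
    obtain ⟨r, hr, -⟩ := exists_inRKHS_of_boundedBy hK hM hb
    exact ⟨r, hr⟩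

lemma memRKHS_inner {H : Type*} [NormedAddCommGroup H] [InnerProductSpace ℝ H] [CompleteSpace H]
    (Φ : X → H) {f : X → ℝ} :
    MemRKHS (fun x y => ⟪Φ x, Φ y⟫_ℝ) f ↔ ∃ v : H, ∀ x, f x = ⟪v, Φ x⟫_ℝ := by
  rw [memRKHS_iff (isPSD_inner Φ)]
  constructor
  · rintro ⟨M, hM, hb⟩
    obtain ⟨v, -, hv⟩ := (boundedBy_inner _ hM).1 hb
    exact ⟨v, hv⟩
  · rintro ⟨v, hv⟩
    exact ⟨‖v‖, norm_nonneg _, (boundedBy_inner _ (norm_nonneg _)).2 ⟨v, le_rfl, hv⟩⟩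

lemma exists_inner_eq {K : X → X → ℝ} (hK : IsPSD K) :
    ∃ (H : Type) (_ : NormedAddCommGroup H) (_ : InnerProductSpace ℝ H) (_ : CompleteSpace H)
      (Φ : X → H), K = fun x y => ⟪Φ x, Φ y⟫_ℝ := by
  obtain ⟨H, i1, i2, i3, i4, hKH⟩ := isReproducingKernel_iff.2 hK
  refine ⟨H, i1, i2, i3, fun x => RKHS.kerFun H x (1 : ℝ), ?_⟩
  funext x y
  rw [← hKH, rkhs_kernel_eq_inner]

lemma BoundedBy.of_le {K L : X → X → ℝ} {C : ℝ} (h : IsPSD fun x y => C ^ 2 * L x y - K x y)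
    {f : X → ℝ} {M : ℝ} (hf : BoundedBy K f M) : BoundedBy L f (C * M) := by
  intro c
  have h1 := h.quad_nonneg c
  rw [quad_sub, quad_const_mul] at h1
  calc _ ≤ M ^ 2 * quad K c := hf c
    _ ≤ M ^ 2 * (C ^ 2 * quad L c) := by gcongr; linarith
    _ = _ := by ring

lemma embeds_of_le {K L : X → X → ℝ} (hK : IsPSD K) (hL : IsPSD L) {C : ℝ} (hC : 0 < C)
    (h : IsPSD fun x y => C * L x y - K x y) : Embeds K L := by
  refine ⟨√C, by positivity, fun f r hr => ?_⟩
  rw [inRKHS_iff hK] at hr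
  refine exists_inRKHS_of_boundedBy hL (by have := hr.1; positivity) (BoundedBy.of_le ?_ hr.2.1)
  rwa [Real.sq_sqrt hC.le]

/-- Converse of `embeds_of_le`. Test with `g = ∑ c_x K(x, ·)`: its pairing with `c` is `‖g‖² = quad
K c`, so boundedness in `H(L)` gives `‖g‖⁴ ≤ C² ‖g‖² quad L c`, and `‖g‖²` cancels. -/
lemma le_of_norm_le {K L : X → X → ℝ} (hK : IsPSD K) (hL : IsPSD L) {C : ℝ}
    (h : ∀ f r, InRKHS K f r → ∃ r', InRKHS L f r' ∧ r' ≤ C * r) :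
    IsPSD fun x y => C ^ 2 * L x y - K x y := by
  refine isPSD_of_quad (fun x y => by rw [hL.symm, hK.symm]) fun c => ?_
  rw [quad_sub, quad_const_mul]
  obtain ⟨H, i1, i2, i3, i4, hKH⟩ := isReproducingKernel_iff.2 hK
  have hK' : K = fun x y => ⟪RKHS.kerFun H x (1 : ℝ), RKHS.kerFun H y (1 : ℝ)⟫_ℝ := by
    funext x y
    rw [← hKH, rkhs_kernel_eq_inner]
  set g : H := c.sum fun x a => a • RKHS.kerFun H x (1 : ℝ) with hg
  have hq : quad K c = ‖g‖ ^ 2 := by rw [hK', quad_inner]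
  obtain ⟨r', hr', hle⟩ := h (⇑g) ‖g‖ ⟨H, _, _, _, _, hKH, g, rfl, rfl⟩
  rw [inRKHS_iff hL] at hr'
  have hb := hr'.2.1 c
  have hsum : (c.sum fun x a => a * g x) = ‖g‖ ^ 2 := by
    have : (c.sum fun x a => a * g x) = ⟪g, c.sum fun x a => a • RKHS.kerFun H x (1 : ℝ)⟫_ℝ := by
      rw [Finsupp.inner_sum]
      refine Finset.sum_congr rfl fun x _ => ?_
      dsimp only
      rw [real_inner_smul_right, ← rkhs_apply_eq_inner]
    rw [this, ← hg, real_inner_self_eq_norm_sq]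
  rw [hsum] at hb
  have hL0 := hL.quad_nonneg c
  rw [hq]
  have h1 : r' ^ 2 ≤ (C * ‖g‖) ^ 2 := pow_le_pow_left₀ hr'.1 hle 2
  have h2 : (‖g‖ ^ 2) ^ 2 ≤ (C * ‖g‖) ^ 2 * quad L c :=
    hb.trans (mul_le_mul_of_nonneg_right h1 hL0)
  rcases eq_or_lt_of_le (norm_nonneg g) with h0 | h0
  · rw [← h0]
    have : 0 ≤ C ^ 2 * quad L c := by positivity
    simpa using this
  · have h3 : ‖g‖ ^ 2 * ‖g‖ ^ 2 ≤ ‖g‖ ^ 2 * (C ^ 2 * quad L c) := by nlinarith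
    have := le_of_mul_le_mul_left h3 (by positivity)
    linarith

/-- Closed graph theorem: an inclusion of spaces is an inequality of kernels. -/
lemma exists_le_of_memRKHS {K L : X → X → ℝ} (hK : IsPSD K) (hL : IsPSD L)
    (h : ∀ f, MemRKHS K f → MemRKHS L f) :
    ∃ C, 0 < C ∧ IsPSD fun x y => C * L x y - K x y := by
  obtain ⟨H, i1, i2, i3, i4, hKH⟩ := isReproducingKernel_iff.2 hK
  obtain ⟨H', j1, j2, j3, j4, hLH⟩ := isReproducingKernel_iff.2 hL
  have hK' : K = fun x y => ⟪RKHS.kerFun H x (1 : ℝ), RKHS.kerFun H y (1 : ℝ)⟫_ℝ := by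
    funext x y
    rw [← hKH, rkhs_kernel_eq_inner]
  have hL' : L = fun x y => ⟪RKHS.kerFun H' x (1 : ℝ), RKHS.kerFun H' y (1 : ℝ)⟫_ℝ := by
    funext x y
    rw [← hLH, rkhs_kernel_eq_inner]
  have hex : ∀ g : H, ∃ g' : H', ∀ x, g' x = g x := by
    intro g
    have h1 : MemRKHS L (⇑g) := h _ ⟨‖g‖, H, _, _, _, _, hKH, g, rfl, rfl⟩
    rw [hL', memRKHS_inner] at h1
    obtain ⟨v, hv⟩ := h1
    exact ⟨v, fun x => by rw [hv, ← rkhs_apply_eq_inner]⟩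
  choose T hT using hex
  let T' : H →ₗ[ℝ] H' :=
    { toFun := T
      map_add' := fun a b => RKHS.ext fun x => by simp [hT]
      map_smul' := fun a b => RKHS.ext fun x => by simp [hT] }
  -- The graph is closed because convergence in either space implies pointwise convergence, and `T'`
  -- does not change the values of a function.
  have hcont : Continuous T' := by
    refine LinearMap.continuous_of_seq_closed_graph T' fun u x y hu hy => ?_
    refine RKHS.ext fun t => ?_
    have h1 := ((RKHS.continuous_eval (H := H) t).tendsto x).comp hu
    have h2 := ((RKHS.continuous_eval (H := H') t).tendsto y).comp hy
    refine tendsto_nhds_unique h2 ?_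
    have : (T' x) t = x t := hT x t
    rw [this]
    refine h1.congr fun n => ?_
    exact (hT (u n) t).symm
  let S : H →L[ℝ] H' := ⟨T', hcont⟩
  have hS : ∀ g, ‖T g‖ ≤ (‖S‖ + 1) * ‖g‖ := fun g =>
    (S.le_opNorm g).trans (by gcongr; linarith)
  refine ⟨(‖S‖ + 1) ^ 2, by positivity, le_of_norm_le hK hL ?_⟩
  intro f r hr
  have hr2 := (inRKHS_iff hK).1 hr
  rw [hK'] at hr2
  obtain ⟨v, hv, hfv⟩ := (boundedBy_inner _ hr2.1).1 hr2.2.1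
  refine ⟨‖T v‖, ⟨H', _, _, _, _, hLH, T v, ?_, rfl⟩, (hS v).trans (by gcongr)⟩
  funext x
  rw [hT, hfv, ← rkhs_apply_eq_inner]

lemma memRKHS_of_le {K L : X → X → ℝ} (hK : IsPSD K) (hL : IsPSD L) {C : ℝ} (hC : 0 < C)
    (h : IsPSD fun x y => C * L x y - K x y) {f : X → ℝ} (hf : MemRKHS K f) : MemRKHS L f := by
  obtain ⟨D, -, hD⟩ := embeds_of_le hK hL hC h
  obtain ⟨r, hr⟩ := hf
  obtain ⟨r', hr', -⟩ := hD f r hr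
  exact ⟨r', hr'⟩

/-- Equal norms give kernel inequalities both ways with constant `1`, so the quadratic forms agree.
Polarization recovers the kernel. -/
lemma kernel_unique {K L : X → X → ℝ} (hK : IsPSD K) (hL : IsPSD L)
    (h : ∀ f r, InRKHS K f r ↔ InRKHS L f r) : K = L := by
  have h1 := le_of_norm_le (C := 1) hK hL fun f r hr => ⟨r, (h f r).1 hr, by simp⟩
  have h2 := le_of_norm_le (C := 1) hL hK fun f r hr => ⟨r, (h f r).2 hr, by simp⟩
  have hq : ∀ c, quad K c = quad L c := by
    intro c
    have a := h1.quad_nonneg c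
    have b := h2.quad_nonneg c
    rw [quad_sub, quad_const_mul] at a b
    linarith
  obtain ⟨H, _, _, _, Φ, rfl⟩ := exists_inner_eq hK
  obtain ⟨H', _, _, _, Ψ, rfl⟩ := exists_inner_eq hL
  have hn : ∀ c : X →₀ ℝ, ‖c.sum fun x a => a • Φ x‖ ^ 2 = ‖c.sum fun x a => a • Ψ x‖ ^ 2 := by
    intro c
    rw [← quad_inner, ← quad_inner, hq]
  have hn1 : ∀ x, ‖Φ x‖ ^ 2 = ‖Ψ x‖ ^ 2 := fun x => by
    simpa using hn (Finsupp.single x 1)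
  funext x y
  have h3 := hn (Finsupp.single x 1 + Finsupp.single y 1)
  rw [Finsupp.sum_add_index' (by simp) (by intros; rw [add_smul]),
    Finsupp.sum_add_index' (by simp) (by intros; rw [add_smul])] at h3
  simp only [Finsupp.sum_single_index, zero_smul, one_smul, norm_add_sq_real] at h3
  linarith [hn1 x, hn1 y]

/-- Functions and norms determine the kernel, so the choice made by `Classical.epsilon` is forced as
soon as one kernel of the subspace is known. -/
lemma subspaceKernel_eq {K : X → X → ℝ} {P : (X → ℝ) → Prop} {k : X → X → ℝ}
    (h : IsKernelOfSubspace K P k) : subspaceKernel K P = k := by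
  have h1 : IsKernelOfSubspace K P (subspaceKernel K P) :=
    Classical.epsilon_spec (p := IsKernelOfSubspace K P) ⟨k, h⟩
  refine kernel_unique (isReproducingKernel_iff.1 h1.1) (isReproducingKernel_iff.1 h.1) ?_
  intro f r
  rw [h1.2, h.2]

/-! ### Sums, closed subspaces and expansions -/

/-- The sum of kernels has the feature map `(Φ, Ψ)` into the Hilbert sum, and a vector of the
Hilbert sum is a pair of vectors. -/
lemma memRKHS_add_iff {K L : X → X → ℝ} (hK : IsPSD K) (hL : IsPSD L) {f : X → ℝ} :
    MemRKHS (fun x y => K x y + L x y) f ↔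
      ∃ g h, MemRKHS K g ∧ MemRKHS L h ∧ ∀ x, f x = g x + h x := by
  obtain ⟨H, _, _, _, Φ, rfl⟩ := exists_inner_eq hK
  obtain ⟨H', _, _, _, Ψ, rfl⟩ := exists_inner_eq hL
  have : (fun x y => ⟪Φ x, Φ y⟫_ℝ + ⟪Ψ x, Ψ y⟫_ℝ) =
      fun x y => ⟪WithLp.toLp 2 (Φ x, Ψ x), WithLp.toLp 2 (Φ y, Ψ y)⟫_ℝ := by
    funext x y
    rw [WithLp.prod_inner_apply]
  rw [this, memRKHS_inner]
  simp only [memRKHS_inner]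
  constructor
  · rintro ⟨v, hv⟩
    exact ⟨_, _, ⟨v.ofLp.1, fun x => rfl⟩, ⟨v.ofLp.2, fun x => rfl⟩, fun x => by
      rw [hv, WithLp.prod_inner_apply]⟩
  · rintro ⟨g, h, ⟨v, hv⟩, ⟨w, hw⟩, hf⟩
    exact ⟨WithLp.toLp 2 (v, w), fun x => by rw [hf, hv, hw, WithLp.prod_inner_apply]⟩

lemma MemRKHS.add {K : X → X → ℝ} (hK : IsPSD K) {f g : X → ℝ} (hf : MemRKHS K f)
    (hg : MemRKHS K g) : MemRKHS K fun x => f x + g x := by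
  obtain ⟨H, _, _, _, Φ, rfl⟩ := exists_inner_eq hK
  rw [memRKHS_inner] at *
  obtain ⟨v, hv⟩ := hf
  obtain ⟨w, hw⟩ := hg
  exact ⟨v + w, fun x => by rw [hv, hw, inner_add_left]⟩

lemma MemRKHS.const_mul {K : X → X → ℝ} (hK : IsPSD K) {f : X → ℝ} (hf : MemRKHS K f) (a : ℝ) :
    MemRKHS K fun x => a * f x := by
  obtain ⟨H, _, _, _, Φ, rfl⟩ := exists_inner_eq hK
  rw [memRKHS_inner] at *
  obtain ⟨v, hv⟩ := hf
  exact ⟨a • v, fun x => by rw [hv, real_inner_smul_left]⟩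

lemma MemRKHS.comp {K : X → X → ℝ} (hK : IsPSD K) {f : X → ℝ} (hf : MemRKHS K f) (p : Y → X) :
    MemRKHS (fun x y => K (p x) (p y)) fun x => f (p x) := by
  obtain ⟨H, _, _, _, Φ, rfl⟩ := exists_inner_eq hK
  rw [memRKHS_inner] at hf
  obtain ⟨v, hv⟩ := hf
  exact (memRKHS_inner fun x => Φ (p x)).2 ⟨v, fun x => hv _⟩

lemma memRKHS_const_mul_iff {K : X → X → ℝ} (hK : IsPSD K) {C : ℝ} (hC : 0 < C) {f : X → ℝ} :
    MemRKHS (fun x y => C * K x y) f ↔ MemRKHS K f := by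
  constructor
  · refine memRKHS_of_le (hK.const_mul hC.le) hK hC ?_
    simpa using isPSD_zero
  · refine memRKHS_of_le hK (hK.const_mul hC.le) (inv_pos.2 hC) ?_
    simpa [hC.ne'] using isPSD_zero

lemma memRKHS_one_iff {f : X → ℝ} : MemRKHS (fun _ _ => (1 : ℝ)) f ↔ ∃ a, ∀ x, f x = a := by
  have : (fun _ _ : X => (1 : ℝ)) = fun x y => ⟪(fun _ => (1 : ℝ)) x, (fun _ => (1 : ℝ)) y⟫_ℝ := by
    simp
  rw [this, memRKHS_inner]
  simp

section Expansion

variable {ι : Type} (φ : ι → X → ℝ) (hφ : ∀ x, Summable fun i => φ i x ^ 2)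
include hφ

lemma exists_lp_features : ∃ Φ : X → lp (fun _ : ι => ℝ) 2, (∀ x i, Φ x i = φ i x) ∧
    (fun x y => ∑' i, φ i x * φ i y) = fun x y => ⟪Φ x, Φ y⟫_ℝ := by
  have hm : ∀ x, Memℓp (fun i => φ i x) 2 := fun x => by
    refine memℓp_gen ?_
    simpa using hφ x
  refine ⟨fun x => ⟨fun i => φ i x, hm x⟩, fun x i => rfl, ?_⟩
  funext x y
  rw [lp.inner_eq_tsum]
  simp [mul_comm]

lemma isPSD_tsum : IsPSD fun x y => ∑' i, φ i x * φ i y := by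
  obtain ⟨Φ, -, hΦ⟩ := exists_lp_features φ hφ
  rw [hΦ]
  exact isPSD_inner Φ

lemma memRKHS_tsum_iff {f : X → ℝ} : MemRKHS (fun x y => ∑' i, φ i x * φ i y) f ↔
    ∃ v : ι → ℝ, (Summable fun i => v i ^ 2) ∧ ∀ x, f x = ∑' i, v i * φ i x := by
  obtain ⟨Φ, hΦ', hΦ⟩ := exists_lp_features φ hφ
  rw [hΦ, memRKHS_inner]
  constructor
  · rintro ⟨v, hv⟩
    refine ⟨fun i => v i, ?_, fun x => ?_⟩
    · have := (lp.memℓp v).summable (by norm_num)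
      simpa using this
    · rw [hv, lp.inner_eq_tsum]
      simp [hΦ', mul_comm]
  · rintro ⟨v, hv, hf⟩
    have hm : Memℓp v 2 := memℓp_gen (by simpa using hv)
    refine ⟨⟨v, hm⟩, fun x => ?_⟩
    rw [hf, lp.inner_eq_tsum]
    simp [hΦ', mul_comm]

end Expansion

lemma isPSD_mul_self (φ : X → ℝ) : IsPSD fun x y => φ x * φ y := by
  have := isPSD_inner φ
  simpa [mul_comm] using this

lemma memRKHS_mul_self (φ : X → ℝ) : MemRKHS (fun x y => φ x * φ y) φ := by
  have h := (memRKHS_inner (f := φ) φ).2 ⟨1, fun x => by simp⟩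
  simpa [mul_comm] using h

section Subspace

variable {H : Type} [NormedAddCommGroup H] [InnerProductSpace ℝ H]

/-- The constant and the weight are absorbed into a feature map with values in `ℝ × H`. -/
lemma one_add_inner_eq {γ : ℝ} (hγ : 0 ≤ γ) (Φ : X → H) :
    (fun x y => 1 + γ * ⟪Φ x, Φ y⟫_ℝ) = fun x y =>
      ⟪WithLp.toLp 2 ((1 : ℝ), √γ • Φ x), WithLp.toLp 2 ((1 : ℝ), √γ • Φ y)⟫_ℝ := by
  funext x y
  rw [WithLp.prod_inner_apply]
  simp only [real_inner_smul_left, real_inner_smul_right, ← mul_assoc, Real.mul_self_sqrt hγ]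
  simp

lemma boundedBy_one_add_inner [CompleteSpace H] {γ : ℝ} (hγ : 0 ≤ γ) (Φ : X → H) {f : X → ℝ} {M : ℝ}
    (hM : 0 ≤ M) : BoundedBy (fun x y => 1 + γ * ⟪Φ x, Φ y⟫_ℝ) f M ↔
      ∃ (a : ℝ) (v : H), ‖WithLp.toLp 2 (a, v)‖ ≤ M ∧ ∀ x, f x = a + √γ * ⟪v, Φ x⟫_ℝ := by
  rw [one_add_inner_eq hγ, boundedBy_inner _ hM]
  constructor
  · rintro ⟨v, hv, hf⟩
    refine ⟨v.ofLp.1, v.ofLp.2, hv, fun x => ?_⟩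
    rw [hf, WithLp.prod_inner_apply, real_inner_smul_right]
    simp
  · rintro ⟨a, v, hv, hf⟩
    refine ⟨_, hv, fun x => ?_⟩
    rw [hf, WithLp.prod_inner_apply, real_inner_smul_right]
    simp

lemma isPSD_one_add_inner {γ : ℝ} (hγ : 0 ≤ γ) (Φ : X → H) :
    IsPSD fun x y => 1 + γ * ⟪Φ x, Φ y⟫_ℝ := by
  rw [one_add_inner_eq hγ]
  exact isPSD_inner _

variable (Φ : X → H) (W : Submodule ℝ H) [W.HasOrthogonalProjection]

lemma inner_starProjection_eq (v : H) (x : X) :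
    ⟪v, W.starProjection (Φ x)⟫_ℝ = ⟪W.starProjection v, Φ x⟫_ℝ :=
  (W.inner_starProjection_left_eq_right _ _).symm

lemma inner_starProjection_starProjection (x y : X) :
    ⟪W.starProjection (Φ x), W.starProjection (Φ y)⟫_ℝ = ⟪W.starProjection (Φ x), Φ y⟫_ℝ := by
  rw [inner_starProjection_eq, Submodule.starProjection_eq_self_iff.2]
  exact W.starProjection_apply_mem _

lemma isKernelOfSubspace_one_add [CompleteSpace H] {γ : ℝ} (hγ : 0 < γ) {P : (X → ℝ) → Prop}
    (hP : ∀ a v, P (fun x => a + ⟪v, Φ x⟫_ℝ) ↔ v ∈ W) :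
    IsKernelOfSubspace (fun x y => 1 + γ * ⟪Φ x, Φ y⟫_ℝ) P
      (fun x y => 1 + γ * ⟪W.starProjection (Φ x), Φ y⟫_ℝ) := by
  have hs : (fun x y => 1 + γ * ⟪W.starProjection (Φ x), Φ y⟫_ℝ) =
      fun x y => 1 + γ * ⟪W.starProjection (Φ x), W.starProjection (Φ y)⟫_ℝ := by
    simp only [inner_starProjection_starProjection]
  rw [hs]
  have hsg : √γ ≠ 0 := (Real.sqrt_pos.2 hγ).ne'
  have h1 := isPSD_one_add_inner hγ.le Φ
  have h2 := isPSD_one_add_inner hγ.le fun x => W.starProjection (Φ x)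
  have key : ∀ f M, 0 ≤ M →
      (BoundedBy (fun x y => 1 + γ * ⟪W.starProjection (Φ x), W.starProjection (Φ y)⟫_ℝ) f M ↔
        BoundedBy (fun x y => 1 + γ * ⟪Φ x, Φ y⟫_ℝ) f M ∧ P f) := by
    intro f M hM
    rw [boundedBy_one_add_inner hγ.le (fun x => W.starProjection (Φ x)) hM,
      boundedBy_one_add_inner hγ.le Φ hM]
    constructor
    · rintro ⟨a, v, hv, hf⟩
      have hf' : ∀ x, f x = a + √γ * ⟪W.starProjection v, Φ x⟫_ℝ := fun x => by
        rw [hf, inner_starProjection_eq]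
      refine ⟨⟨a, W.starProjection v, le_trans ?_ hv, hf'⟩, ?_⟩
      · rw [← sq_le_sq₀ (norm_nonneg _) (norm_nonneg _), WithLp.prod_norm_sq_eq_of_L2,
          WithLp.prod_norm_sq_eq_of_L2]
        have := W.norm_starProjection_apply_le v
        simp only [WithLp.fst, WithLp.snd]
        gcongr
      · have : f = fun x => a + ⟪√γ • W.starProjection v, Φ x⟫_ℝ := by
          funext x
          rw [hf', real_inner_smul_left]
        rw [this, hP]
        exact W.smul_mem _ (W.starProjection_apply_mem _)
    · rintro ⟨⟨a, v, hv, hf⟩, hPf⟩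
      have : f = fun x => a + ⟪√γ • v, Φ x⟫_ℝ := by
        funext x
        rw [hf, real_inner_smul_left]
      -- Here the weight has to be positive: `√γ • v ∈ W` must give `v ∈ W`.
      rw [this, hP, W.smul_mem_iff hsg] at hPf
      refine ⟨a, v, hv, fun x => ?_⟩
      rw [hf, inner_starProjection_eq, Submodule.starProjection_eq_self_iff.2 hPf]
  refine ⟨isReproducingKernel_iff.2 h2, fun f r => ?_⟩
  rw [inRKHS_iff h2, inRKHS_iff h1]
  constructor
  · rintro ⟨hr, hb, hmin⟩
    obtain ⟨hb', hPf⟩ := (key f r hr).1 hb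
    exact ⟨⟨hr, hb', fun M hM hbM => hmin M hM ((key f M hM).2 ⟨hbM, hPf⟩)⟩, hPf⟩
  · rintro ⟨⟨hr, hb, hmin⟩, hPf⟩
    exact ⟨hr, (key f r hr).2 ⟨hb, hPf⟩, fun M hM hbM => hmin M hM ((key f M hM).1 hbM).1⟩

lemma memRKHS_starProjection_iff [CompleteSpace H] {P : (X → ℝ) → Prop}
    (hP : ∀ v, P (fun x => ⟪v, Φ x⟫_ℝ) ↔ v ∈ W) {f : X → ℝ} :
    MemRKHS (fun x y => ⟪W.starProjection (Φ x), Φ y⟫_ℝ) f ↔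
      MemRKHS (fun x y => ⟪Φ x, Φ y⟫_ℝ) f ∧ P f := by
  have hs : (fun x y => ⟪W.starProjection (Φ x), Φ y⟫_ℝ) =
      fun x y => ⟪W.starProjection (Φ x), W.starProjection (Φ y)⟫_ℝ := by
    simp only [inner_starProjection_starProjection]
  rw [hs, memRKHS_inner, memRKHS_inner]
  constructor
  · rintro ⟨v, hv⟩
    have hv' : f = fun x => ⟪W.starProjection v, Φ x⟫_ℝ := funext fun x => by
      rw [hv, inner_starProjection_eq]
    refine ⟨⟨_, congrFun hv'⟩, ?_⟩
    rw [hv', hP]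
    exact W.starProjection_apply_mem _
  · rintro ⟨⟨v, hv⟩, hPf⟩
    rw [funext hv, hP] at hPf
    exact ⟨v, fun x => by
      rw [hv, inner_starProjection_eq, Submodule.starProjection_eq_self_iff.2 hPf]⟩

lemma isPSD_starProjection : IsPSD fun x y => ⟪W.starProjection (Φ x), Φ y⟫_ℝ := by
  simp only [← inner_starProjection_starProjection]
  exact isPSD_inner _

end Subspace

end Kernels

/-! ### Weighted kernels -/

section Weighted

variable {s : ℕ} {γ : Finset (Fin s) → ℝ} {k l : I → I → ℝ}

lemma isPSD_weighted_term (hk : IsPSD fun x y => -1 + k x y) (u : Finset (Fin s)) :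
    IsPSD fun x y : Fin s → I => ∏ j ∈ u, (-1 + k (x j) (y j)) :=
  IsPSD.prod u fun j _ => hk.comp fun x : Fin s → I => x j

lemma isPSD_weightedKernel (hγ : ∀ u, 0 ≤ γ u) (hk : IsPSD fun x y => -1 + k x y) :
    IsPSD (weightedKernel γ k) :=
  isPSD_one.add (IsPSD.sum _ fun u _ => (isPSD_weighted_term hk u).const_mul (hγ u))

lemma exists_weightedKernel_le (hγ : ∀ u, 0 ≤ γ u) (hk : IsPSD fun x y => -1 + k x y)
    (hl : IsPSD fun x y => -1 + l x y)
    (h : ∃ C, 0 < C ∧ IsPSD fun x y => C * (-1 + l x y) - (-1 + k x y)) :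
    ∃ C, 0 < C ∧ IsPSD fun x y => C * weightedKernel γ l x y - weightedKernel γ k x y := by
  obtain ⟨C, hC, h⟩ := h
  have h1 : (1 : ℝ) ≤ C + 1 := by linarith
  -- Tensorizing over `u` costs `(C + 1) ^ |u|`. Since `C + 1 ≥ 1`, the exponent `s` serves all `u`
  -- at once, including the constant term.
  refine ⟨(C + 1) ^ s, by positivity, ?_⟩
  have hpow : (0 : ℝ) ≤ (C + 1) ^ s - 1 := by
    have := one_le_pow₀ h1 (n := s)
    linarith
  have hterm : ∀ u : Finset (Fin s), IsPSD fun x y : Fin s → I =>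
      (C + 1) ^ s * ∏ j ∈ u, (-1 + l (x j) (y j)) - ∏ j ∈ u, (-1 + k (x j) (y j)) := by
    intro u
    have ha : (0 : ℝ) ≤ (C + 1) ^ s - (C + 1) ^ u.card := by
      have : (C + 1) ^ u.card ≤ (C + 1) ^ s :=
        pow_le_pow_right₀ h1 (by simpa using Finset.card_le_univ u)
      linarith
    have hb : IsPSD fun x y => (C + 1) * (-1 + l x y) - (-1 + k x y) := by
      convert h.add hl using 3
      ring
    have hc := IsPSD.prod_sub_prod u
      (K := fun j (x y : Fin s → I) => -1 + k (x j) (y j))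
      (L := fun j (x y : Fin s → I) => (C + 1) * (-1 + l (x j) (y j)))
      (fun j _ => hk.comp fun x : Fin s → I => x j) (fun j _ => hb.comp fun x : Fin s → I => x j)
    simp only [Finset.prod_mul_distrib, Finset.prod_const] at hc
    convert ((isPSD_weighted_term hl u).const_mul ha).add hc using 3
    ring
  have hsum := ((isPSD_one (X := Fin s → I)).const_mul hpow).add
    (IsPSD.sum ({u | u.Nonempty} : Finset (Finset (Fin s)))
      fun u _ => (hterm u).const_mul (hγ u))
  convert hsum using 3
  simp only [weightedKernel, mul_sub, Finset.sum_sub_distrib, mul_add, Finset.mul_sum,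
    mul_left_comm (γ _)]
  ring

lemma embeds_weightedKernel (hγ : ∀ u, 0 ≤ γ u) (hk : IsPSD fun x y => -1 + k x y)
    (hl : IsPSD fun x y => -1 + l x y)
    (h : ∃ C, 0 < C ∧ IsPSD fun x y => C * (-1 + l x y) - (-1 + k x y)) :
    Embeds (weightedKernel γ k) (weightedKernel γ l) := by
  obtain ⟨C, hC, h⟩ := exists_weightedKernel_le hγ hk hl h
  exact embeds_of_le (isPSD_weightedKernel hγ hk) (isPSD_weightedKernel hγ hl) hC h

lemma Embeds.memRKHS {X : Type} {K L : X → X → ℝ} (h : Embeds K L) {f : X → ℝ}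
    (hf : MemRKHS K f) : MemRKHS L f := by
  obtain ⟨C, -, h⟩ := h
  obtain ⟨r, hr⟩ := hf
  obtain ⟨r', hr', -⟩ := h f r hr
  exact ⟨r', hr'⟩

/-- Membership of `φ` means that `C (-1 + k) - φ ⊗ φ` is positive semidefinite for some `C`.
Tensorizing over `u` bounds the rank-one kernel of the product by the single term `u` of the
weighted kernel; division by `γ u` gives the constant. -/
lemma memRKHS_weightedKernel_prod (hγ : ∀ u, 0 ≤ γ u) (hk : IsPSD fun x y => -1 + k x y)
    {u : Finset (Fin s)} (hu : u.Nonempty) (hγu : 0 < γ u) {φ : I → ℝ}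
    (hφ : MemRKHS (fun x y => -1 + k x y) φ) :
    MemRKHS (weightedKernel γ k) fun x => ∏ j ∈ u, φ (x j) := by
  have hφ' : ∃ C, 0 < C ∧ IsPSD fun x y => C * (-1 + k x y) - φ x * φ y := by
    refine exists_le_of_memRKHS (isPSD_mul_self φ) hk fun f hf => ?_
    have h1 : (fun x y => φ x * φ y) = fun x y => inner ℝ (φ x) (φ y) := by
      simp [mul_comm]
    rw [h1, memRKHS_inner] at hf
    obtain ⟨v, hv⟩ := hf
    convert hφ.const_mul hk v using 1
    funext x
    simp [hv, mul_comm]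
  obtain ⟨C, hC, h⟩ := hφ'
  have h1 := IsPSD.prod_sub_prod u
      (K := fun j (x y : Fin s → I) => φ (x j) * φ (y j))
      (L := fun j (x y : Fin s → I) => C * (-1 + k (x j) (y j)))
      (fun j _ => (isPSD_mul_self φ).comp fun x : Fin s → I => x j)
      (fun j _ => h.comp fun x : Fin s → I => x j)
  simp only [Finset.prod_mul_distrib, Finset.prod_const] at h1
  refine memRKHS_of_le (isPSD_mul_self fun x : Fin s → I => ∏ j ∈ u, φ (x j))
    (isPSD_weightedKernel hγ hk) (C := C ^ u.card / γ u) (by positivity) ?_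
    (memRKHS_mul_self fun x : Fin s → I => ∏ j ∈ u, φ (x j))
  have h2 : IsPSD fun x y : Fin s → I => 1 + ∑ v ∈ ({v | v.Nonempty} : Finset (Finset (Fin s))).erase u,
      γ v * ∏ j ∈ v, (-1 + k (x j) (y j)) :=
    isPSD_one.add (IsPSD.sum _ fun v _ => (isPSD_weighted_term hk v).const_mul (hγ v))
  convert (h2.const_mul (C := C ^ u.card / γ u) (by positivity)).add h1 using 3 with x y
  rw [weightedKernel, ← Finset.add_sum_erase _ _ (a := u) (by simpa using hu)]
  field_simp
  ring

/-- The frozen factors are diagonal values `-1 + k(a_i, a_i) ≥ 0`, so each term becomes either a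
nonnegative constant or a nonnegative multiple of `-1 + k`. -/
lemma weightedKernel_update (hγ : ∀ u, 0 ≤ γ u) (hk : IsPSD fun x y => -1 + k x y)
    (a : Fin s → I) (j : Fin s) : ∃ A B, 0 ≤ A ∧ 0 ≤ B ∧ ∀ t t',
      weightedKernel γ k (Function.update a j t) (Function.update a j t') =
        A + B * (-1 + k t t') := by
  have hd : ∀ x, 0 ≤ -1 + k x x := fun x => Matrix.PosSemidef.diag_nonneg hk (i := x)
  have hterm : ∀ u : Finset (Fin s), ∃ A B, 0 ≤ A ∧ 0 ≤ B ∧ ∀ t t',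
      ∏ i ∈ u, (-1 + k (Function.update a j t i) (Function.update a j t' i)) =
        A + B * (-1 + k t t') := by
    intro u
    by_cases hj : j ∈ u
    · refine ⟨0, ∏ i ∈ u.erase j, (-1 + k (a i) (a i)), le_rfl,
        Finset.prod_nonneg fun i _ => hd _, fun t t' => ?_⟩
      rw [← Finset.mul_prod_erase _ _ hj, zero_add, mul_comm]
      congr 1
      · refine Finset.prod_congr rfl fun i hi => ?_
        rw [Function.update_of_ne (Finset.ne_of_mem_erase hi),
          Function.update_of_ne (Finset.ne_of_mem_erase hi)]
      · simp
    · refine ⟨∏ i ∈ u, (-1 + k (a i) (a i)), 0, Finset.prod_nonneg fun i _ => hd _, le_rfl,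
        fun t t' => ?_⟩
      rw [zero_mul, add_zero]
      refine Finset.prod_congr rfl fun i hi => ?_
      have : i ≠ j := fun h => hj (h ▸ hi)
      rw [Function.update_of_ne this, Function.update_of_ne this]
  choose A B hA hB hAB using hterm
  refine ⟨1 + ∑ u : Finset (Fin s) with u.Nonempty, γ u * A u,
    ∑ u : Finset (Fin s) with u.Nonempty, γ u * B u,
    add_nonneg zero_le_one (Finset.sum_nonneg fun u _ => mul_nonneg (hγ u) (hA u)),
    Finset.sum_nonneg fun u _ => mul_nonneg (hγ u) (hB u), fun t t' => ?_⟩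
  simp only [weightedKernel, hAB, mul_add, Finset.sum_add_distrib, Finset.sum_mul, mul_assoc]
  ring

/-- Freezing all variables but one leads from the weighted space to the univariate space. -/
lemma MemRKHS.update (hγ : ∀ u, 0 ≤ γ u) (hk : IsPSD fun x y => -1 + k x y)
    {f : (Fin s → I) → ℝ} (hf : MemRKHS (weightedKernel γ k) f) (a : Fin s → I) (j : Fin s) :
    ∃ c g, MemRKHS (fun x y => -1 + k x y) g ∧ ∀ t, f (Function.update a j t) = c + g t := by
  obtain ⟨A, B, hA, hB, h⟩ := weightedKernel_update hγ hk a j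
  have h1 := hf.comp (isPSD_weightedKernel hγ hk) (Function.update a j)
  simp only [h] at h1
  have h2 : MemRKHS (fun x y => 1 + (-1 + k x y)) fun t => f (Function.update a j t) := by
    -- `A` and `B` may be zero; `A + B + 1` is positive and dominates both.
    refine memRKHS_of_le ?_ (isPSD_one.add hk) (C := A + B + 1) (by positivity) ?_ h1
    · simpa using (isPSD_one.const_mul hA).add (hk.const_mul hB)
    · convert (isPSD_one.const_mul (C := B + 1) (by positivity)).add
        (hk.const_mul (C := A + 1) (by positivity)) using 3
      ring
  obtain ⟨g, h', hg, hh, hf'⟩ := (memRKHS_add_iff isPSD_one hk).1 h2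
  obtain ⟨c, hc⟩ := memRKHS_one_iff.1 hg
  exact ⟨c, h', hh, fun t => by rw [hf', hc]⟩

end Weighted

/-! ### Finite products of absolutely convergent series. -/

lemma hasSum_mul_of_summable_norm {κ κ' : Type*} {f : κ → ℝ} {g : κ' → ℝ} {b : ℝ}
    (hf : Summable fun m => ‖f m‖) (hg : Summable fun m => ‖g m‖) (hb : HasSum g b) :
    HasSum (fun q : κ × κ' => f q.1 * g q.2) ((∑' m, f m) * b) :=
  hf.of_norm.hasSum.mul hb (summable_mul_of_summable_norm hf hg)

lemma hasSum_fin_prod {κ : Type*} {n : ℕ} (f : Fin n → κ → ℝ)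
    (hf : ∀ i, Summable fun m => ‖f i m‖) :
    HasSum (fun p : Fin n → κ => ∏ i, f i (p i)) (∏ i, ∑' m, f i m) ∧
      Summable fun p : Fin n → κ => ‖∏ i, f i (p i)‖ := by
  induction n with
  | zero => exact ⟨by simp, (hasSum_unique _).summable⟩
  | succ n ih =>
    have ih' := ih (fun i => f i.succ) fun i => hf _
    clear ih
    generalize hG : (fun p : Fin n → κ => ∏ i, f i.succ (p i)) = G at ih'
    have hG' : ∀ p, ∏ i, f i.succ (p i) = G p := congrFun hG
    obtain ⟨h1, h2⟩ := ih'
    simp only [hG'] at h2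
    have key : (fun p : Fin (n + 1) → κ => ∏ i, f i (p i)) ∘ Fin.consEquiv (fun _ => κ) =
        fun q : κ × (Fin n → κ) => f 0 q.1 * G q.2 := funext fun q => by
      simp [Fin.prod_univ_succ, Fin.consEquiv, hG']
    have key' : (fun p : Fin (n + 1) → κ => ‖∏ i, f i (p i)‖) ∘ Fin.consEquiv (fun _ => κ) =
        fun q : κ × (Fin n → κ) => ‖f 0 q.1 * G q.2‖ := funext fun q => by
      rw [← congrFun key q]
      rfl
    constructor
    · rw [Fin.prod_univ_succ, ← Equiv.hasSum_iff (Fin.consEquiv fun _ => κ), key]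
      exact hasSum_mul_of_summable_norm (hf 0) h2 h1
    · rw [← Equiv.summable_iff (Fin.consEquiv fun _ => κ), key']
      exact Summable.mul_norm (hf 0) h2

/-- A finite product of absolutely convergent series. -/
lemma hasSum_fintype_prod {ι κ : Type*} [Fintype ι] (f : ι → κ → ℝ)
    (hf : ∀ i, Summable fun m => ‖f i m‖) :
    HasSum (fun p : ι → κ => ∏ i, f i (p i)) (∏ i, ∑' m, f i m) := by
  let e := (Fintype.equivFin ι).symm
  have h := (hasSum_fin_prod (fun i => f (e i)) fun i => hf _).1
  rw [← Equiv.prod_comp e, ← Equiv.hasSum_iff (e.arrowCongr (Equiv.refl κ))]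
  convert h using 1
  funext p
  simp only [Function.comp_apply]
  rw [← Equiv.prod_comp e]
  simp

/-! ### Towers of derivatives of Sobolev functions on `[0,1]` -/

section Towers

open MeasureTheory Set

/-- `F 0` is a Sobolev function of order `α` on `[0,1]` with derivatives `F 1, …, F α`. -/
structure IsSobolevTower (α : ℕ) (F : ℕ → ℝ → ℝ) : Prop where
  ftc : ∀ τ < α, ∀ x ∈ Icc (0 : ℝ) 1, F τ x = F τ 0 + ∫ t in (0 : ℝ)..x, F (τ + 1) t
  continuousOn : ∀ τ < α, ContinuousOn (F τ) (Icc 0 1)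
  memLp : MemLp (F α) 2 (volume.restrict (Ioc 0 1))

namespace IsSobolevTower

variable {α : ℕ} {F G : ℕ → ℝ → ℝ}

lemma intervalIntegrable (h : IsSobolevTower α F) {τ : ℕ} (hτ : τ ≤ α) :
    IntervalIntegrable (F τ) volume 0 1 := by
  rcases hτ.lt_or_eq with hτ | rfl
  · refine ContinuousOn.intervalIntegrable ?_
    rw [uIcc_of_le zero_le_one]
    exact h.continuousOn τ hτ
  · rw [intervalIntegrable_iff_integrableOn_Ioc_of_le zero_le_one]
    exact h.memLp.integrable (by norm_num)

lemma intervalIntegrable_of_mem (h : IsSobolevTower α F) {τ : ℕ} (hτ : τ ≤ α) {x : ℝ}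
    (hx : x ∈ Icc (0 : ℝ) 1) : IntervalIntegrable (F τ) volume 0 x :=
  (h.intervalIntegrable hτ).mono_set (by
    rw [uIcc_of_le hx.1, uIcc_of_le zero_le_one]
    exact Icc_subset_Icc_right hx.2)

lemma add (hF : IsSobolevTower α F) (hG : IsSobolevTower α G) :
    IsSobolevTower α fun τ x => F τ x + G τ x where
  ftc τ hτ x hx := by
    rw [intervalIntegral.integral_add (hF.intervalIntegrable_of_mem hτ hx)
      (hG.intervalIntegrable_of_mem hτ hx), hF.ftc τ hτ x hx, hG.ftc τ hτ x hx]
    ring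
  continuousOn τ hτ := (hF.continuousOn τ hτ).add (hG.continuousOn τ hτ)
  memLp := hF.memLp.add hG.memLp

lemma const_mul (hF : IsSobolevTower α F) (c : ℝ) :
    IsSobolevTower α fun τ x => c * F τ x where
  ftc τ hτ x hx := by
    rw [intervalIntegral.integral_const_mul, hF.ftc τ hτ x hx]
    ring
  continuousOn τ hτ := continuousOn_const.mul (hF.continuousOn τ hτ)
  memLp := hF.memLp.const_mul c

lemma of_hasDerivAt (hF : ∀ τ x, HasDerivAt (F τ) (F (τ + 1) x) x) : IsSobolevTower α F := by
  have hc : ∀ τ, Continuous (F τ) := fun τ =>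
    continuous_iff_continuousAt.2 fun x => (hF τ x).continuousAt
  refine ⟨fun τ _ x _ => ?_, fun τ _ => (hc τ).continuousOn, ?_⟩
  · rw [intervalIntegral.integral_eq_sub_of_hasDerivAt (fun t _ => hF τ t)
      ((hc _).intervalIntegrable _ _)]
    ring
  · obtain ⟨C, hC⟩ := isCompact_Icc.exists_bound_of_continuousOn
      ((hc α).continuousOn (s := Icc (0 : ℝ) 1))
    refine MemLp.of_bound (hc α).aestronglyMeasurable C ?_
    refine (ae_restrict_iff' measurableSet_Ioc).2 (Filter.Eventually.of_forall fun x hx => ?_)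
    exact hC x (Ioc_subset_Icc_self hx)

lemma zero : IsSobolevTower α fun _ _ => 0 :=
  of_hasDerivAt fun _ x => hasDerivAt_const x _

lemma finset_sum {ι : Type*} (s : Finset ι) {F : ι → ℕ → ℝ → ℝ}
    (hF : ∀ i ∈ s, IsSobolevTower α (F i)) : IsSobolevTower α fun τ x => ∑ i ∈ s, F i τ x := by
  classical
  induction s using Finset.induction_on with
  | empty => simpa using zero
  | insert i s hi ih =>
    simp only [Finset.sum_insert hi]
    exact (hF i (by simp)).add (ih fun j hj => hF j (by simp [hj]))

lemma hasDerivWithinAt (h : IsSobolevTower α F) {τ : ℕ} (hτ : τ + 1 < α) {x : ℝ}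
    (hx : x ∈ Icc (0 : ℝ) 1) : HasDerivWithinAt (F τ) (F (τ + 1) x) (Icc 0 1) x := by
  -- As `τ + 1 < α`, the next derivative is continuous on `[0,1]`; a constant extension beyond the
  -- end points allows the fundamental theorem of calculus at the end points too.
  set G : ℝ → ℝ := IccExtend (zero_le_one' ℝ) ((Icc (0 : ℝ) 1).domRestrict (F (τ + 1))) with hG
  have hGc : Continuous G := (h.continuousOn _ hτ).domRestrict.Icc_extend'
  have hGF : ∀ t ∈ Icc (0 : ℝ) 1, G t = F (τ + 1) t := fun t ht => by
    rw [hG, IccExtend_of_mem _ _ ht]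
    rfl
  have h1 : HasDerivAt (fun y => F τ 0 + ∫ t in (0 : ℝ)..y, G t) (G x) x :=
    (hGc.integral_hasStrictDerivAt 0 x).hasDerivAt.const_add _
  rw [hGF x hx] at h1
  refine h1.hasDerivWithinAt.congr (fun y hy => ?_) ?_
  all_goals
    rw [h.ftc τ (by omega) _ (by assumption)]
    congr 1
    refine intervalIntegral.integral_congr fun t ht => (hGF t ?_).symm
  · rw [uIcc_of_le hy.1] at ht
    exact ⟨ht.1, ht.2.trans hy.2⟩
  · rw [uIcc_of_le hx.1] at ht
    exact ⟨ht.1, ht.2.trans hx.2⟩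

/-- Identifies the one-sided derivatives of `f` with the entries of a tower. It stops below order
`α`, since the top entry is only an `L²` function. -/
lemma derivI_eq (h : IsSobolevTower α F) {f : I → ℝ} (hf : ∀ x : I, f x = F 0 x) {τ : ℕ}
    (hτ : τ < α) (t : I) : derivI τ f t = F τ t := by
  have key : ∀ τ < α, EqOn (iteratedDerivWithin τ (IccExtend (zero_le_one' ℝ) f) (Icc 0 1))
      (F τ) (Icc 0 1) := by
    intro τ
    induction τ with
    | zero =>
      intro _ x hx
      rw [iteratedDerivWithin_zero, IccExtend_of_mem _ _ hx, hf]
    | succ τ ih =>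
      intro hτ x hx
      rw [iteratedDerivWithin_succ, derivWithin_congr (ih (by omega)) (ih (by omega) hx)]
      exact (h.hasDerivWithinAt hτ hx).derivWithin (uniqueDiffOn_Icc zero_lt_one x hx)
  exact key τ hτ t.2

/-- Integration by parts. -/
lemma integral_mul_deriv (h : IsSobolevTower α F) {τ : ℕ} (hτ : τ < α) {e e' : ℝ → ℝ}
    (he : ∀ x, HasDerivAt e (e' x) x) (he' : Continuous e') :
    ∫ x in (0 : ℝ)..1, F τ x * e' x =
      F τ 1 * e 1 - F τ 0 * e 0 - ∫ x in (0 : ℝ)..1, F (τ + 1) x * e x := by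
  -- `F τ` is controlled only on `[0,1]`; there it agrees with the primitive `U`, which is
  -- absolutely continuous with derivative `F (τ + 1)` almost everywhere.
  set U : ℝ → ℝ := fun x => F τ 0 + ∫ t in (0 : ℝ)..x, F (τ + 1) t with hU
  have hUF : ∀ x ∈ Icc (0 : ℝ) 1, F τ x = U x := h.ftc τ hτ
  have hint := h.intervalIntegrable (τ := τ + 1) hτ
  have hUac : AbsolutelyContinuousOnInterval U 0 1 :=
    (LipschitzWith.const (F τ 0)).lipschitzOnWith.absolutelyContinuousOnInterval.add
      (hint.absolutelyContinuousOnInterval_intervalIntegral (c := 0) (by simp))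
  have hde : deriv e = e' := funext fun x => (he x).deriv
  have heC : ContDiff ℝ 1 e := contDiff_one_iff_deriv.2
    ⟨fun x => (he x).differentiableAt, hde ▸ he'⟩
  have heac : AbsolutelyContinuousOnInterval e 0 1 :=
    heC.contDiffOn.absolutelyContinuousOnInterval
  have hibp := hUac.integral_mul_deriv_eq_deriv_mul heac
  rw [hde] at hibp
  rw [hUF 1 (by simp), hUF 0 (by simp)]
  have h1 : ∫ x in (0 : ℝ)..1, F τ x * e' x = ∫ x in (0 : ℝ)..1, U x * e' x := by
    refine intervalIntegral.integral_congr fun x hx => ?_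
    rw [uIcc_of_le zero_le_one] at hx
    simp only [hUF x hx]
  have h2 : ∫ x in (0 : ℝ)..1, F (τ + 1) x * e x = ∫ x in (0 : ℝ)..1, deriv U x * e x := by
    refine intervalIntegral.integral_congr_ae ?_
    filter_upwards [hint.ae_hasDerivAt_integral] with x hx hx'
    have := (hx (uIoc_subset_uIcc hx') 0 (by simp)).const_add (F τ 0)
    simp only [hU]
    rw [this.deriv]
  rw [h1, h2, hibp]

end IsSobolevTower

end Towers

/-! ### Trigonometric systems -/

section Trig

open MeasureTheory Set Real

/-- `√2 cos(π k x + j π / 2)`. -/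
noncomputable def cosPhase (j k : ℕ) (x : ℝ) : ℝ := √2 * cos (π * k * x + j * (π / 2))

lemma cosPhase_add_two (j k : ℕ) (x : ℝ) : cosPhase (j + 2) k x = -cosPhase j k x := by
  unfold cosPhase
  rw [show π * k * x + ((j + 2 : ℕ) : ℝ) * (π / 2) = (π * k * x + j * (π / 2)) + π by
    push_cast; ring, cos_add_pi]
  ring

/-- Differentiation shifts the phase by one and multiplies by the frequency. One family thus covers
sines, cosines and all their derivatives, without case distinctions on signs. -/
lemma hasDerivAt_cosPhase (j k : ℕ) (x : ℝ) :
    HasDerivAt (cosPhase j k) (π * k * cosPhase (j + 1) k x) x := by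
  have h1 : HasDerivAt (fun x : ℝ => π * k * x + j * (π / 2)) (π * k) x := by
    simpa using ((hasDerivAt_id x).const_mul (π * k)).add_const (j * (π / 2))
  have h2 := h1.cos.const_mul √2
  refine h2.congr_deriv ?_
  unfold cosPhase
  rw [show π * k * x + ((j + 1 : ℕ) : ℝ) * (π / 2) = (π * k * x + j * (π / 2)) + π / 2 by
    push_cast; ring, cos_add_pi_div_two]
  ring

lemma continuous_cosPhase (j k : ℕ) : Continuous (cosPhase j k) := by
  unfold cosPhase
  fun_prop

lemma abs_cosPhase_le (j k : ℕ) (x : ℝ) : |cosPhase j k x| ≤ 2 := by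
  unfold cosPhase
  rw [abs_mul, abs_of_nonneg (sqrt_nonneg 2)]
  have h1 := abs_cos_le_one (π * k * x + j * (π / 2))
  have h2 : √2 ≤ 2 := by
    rw [sqrt_le_left (by norm_num)]
    norm_num
  nlinarith [sqrt_nonneg 2, abs_nonneg (cos (π * k * x + j * (π / 2)))]

lemma cos_odd_mul_pi_div_two {j : ℕ} (hj : Odd j) : cos (j * (π / 2)) = 0 := by
  obtain ⟨i, rfl⟩ := hj
  rw [cos_eq_zero_iff]
  exact ⟨i, by push_cast; ring⟩

lemma cosPhase_one (j k : ℕ) : cosPhase j k 1 = (-1) ^ k * cosPhase j k 0 := by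
  unfold cosPhase
  rw [show π * (k : ℝ) * 1 + j * (π / 2) = j * (π / 2) + k * π by ring, cos_add_nat_mul_pi]
  simp only [mul_zero, zero_add]
  ring

/-- With an odd phase the function is a sine up to sign, so it vanishes at `0`, and at `1` as well
because the frequency is a multiple of `π`. -/
lemma cosPhase_odd_zero {j : ℕ} (hj : Odd j) (k : ℕ) : cosPhase j k 0 = 0 := by
  simp [cosPhase, cos_odd_mul_pi_div_two hj]

lemma cosPhase_odd_one {j : ℕ} (hj : Odd j) (k : ℕ) : cosPhase j k 1 = 0 := by
  rw [cosPhase_one, cosPhase_odd_zero hj, mul_zero]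

lemma cosPhase_even_one (j : ℕ) {k : ℕ} (hk : Even k) : cosPhase j k 1 = cosPhase j k 0 := by
  rw [cosPhase_one, hk.neg_one_pow, one_mul]

lemma integral_cos_phase_eq_zero {n : ℤ} (hn : n ≠ 0) (j : ℤ) :
    ∫ x in (0 : ℝ)..1, cos (π * n * x + j * π) = 0 := by
  have hne : π * (n : ℝ) ≠ 0 := by
    have : (n : ℝ) ≠ 0 := by exact_mod_cast hn
    positivity
  have h : ∀ x : ℝ, HasDerivAt (fun x : ℝ => sin (π * n * x + j * π) / (π * n))
      (cos (π * n * x + j * π)) x := fun x => by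
    have h1 : HasDerivAt (fun x : ℝ => π * n * x + j * π) (π * n) x := by
      simpa using ((hasDerivAt_id x).const_mul (π * n)).add_const (j * π)
    have h2 := h1.sin.div_const (π * n)
    rwa [mul_div_cancel_right₀ _ hne] at h2
  rw [intervalIntegral.integral_eq_sub_of_hasDerivAt (fun x _ => h x)
    (Continuous.intervalIntegrable (by fun_prop) _ _)]
  have h1 : sin (π * n * 1 + j * π) = 0 := by
    rw [show π * (n : ℝ) * 1 + j * π = ((n + j : ℤ) : ℝ) * π by push_cast; ring]
    exact sin_int_mul_pi _
  have h0 : sin (π * n * 0 + j * π) = 0 := by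
    rw [show π * (n : ℝ) * 0 + j * π = (j : ℝ) * π by ring]
    exact sin_int_mul_pi _
  rw [h1, h0]
  simp

lemma integral_cosPhase_mul (j : ℕ) {k l : ℕ} (hk : 0 < k) :
    ∫ x in (0 : ℝ)..1, cosPhase j k x * cosPhase j l x = if k = l then 1 else 0 := by
  have h : ∀ x, cosPhase j k x * cosPhase j l x =
      cos (π * ((k - l : ℤ) : ℝ) * x + ((0 : ℤ) : ℝ) * π) +
        cos (π * ((k + l : ℤ) : ℝ) * x + ((j : ℤ) : ℝ) * π) := fun x => by
    unfold cosPhase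
    set a := π * k * x + j * (π / 2) with ha
    set b := π * l * x + j * (π / 2) with hb
    have h1 : π * ((k - l : ℤ) : ℝ) * x + ((0 : ℤ) : ℝ) * π = a - b := by
      rw [ha, hb]; push_cast; ring
    have h2 : π * ((k + l : ℤ) : ℝ) * x + ((j : ℤ) : ℝ) * π = a + b := by
      rw [ha, hb]; push_cast; ring
    rw [h1, h2]
    clear_value a b
    rw [cos_sub, cos_add]
    have h3 : √2 * √2 = 2 := mul_self_sqrt (by norm_num)
    linear_combination (cos a * cos b) * h3
  simp only [h]
  rw [intervalIntegral.integral_add (Continuous.intervalIntegrable (by fun_prop) _ _)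
    (Continuous.intervalIntegrable (by fun_prop) _ _),
    integral_cos_phase_eq_zero (n := k + l) (by omega), add_zero]
  split_ifs with hkl
  · subst hkl
    simp
  · exact integral_cos_phase_eq_zero (by omega) _

lemma memLp_of_continuous {g : ℝ → ℝ} (hg : Continuous g) :
    MemLp g 2 (volume.restrict (Ioc 0 1)) := by
  obtain ⟨C, hC⟩ := isCompact_Icc.exists_bound_of_continuousOn
    (hg.continuousOn (s := Icc (0 : ℝ) 1))
  refine MemLp.of_bound hg.aestronglyMeasurable C ?_
  refine (ae_restrict_iff' measurableSet_Ioc).2 (Filter.Eventually.of_forall fun x hx => ?_)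
  exact hC x (Ioc_subset_Icc_self hx)

/-- The functions `cosPhase j (m h)`, `h ≥ 1`, in `L²(0,1)`. -/
noncomputable def cosPhaseLp (j m : ℕ) (h : ℕ+) : Lp ℝ 2 (volume.restrict (Ioc (0 : ℝ) 1)) :=
  (memLp_of_continuous (continuous_cosPhase j (m * h))).toLp

lemma inner_toLp {f g : ℝ → ℝ} (hf : MemLp f 2 (volume.restrict (Ioc 0 1)))
    (hg : MemLp g 2 (volume.restrict (Ioc 0 1))) :
    inner ℝ hf.toLp hg.toLp = ∫ x in (0 : ℝ)..1, f x * g x := by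
  rw [L2.inner_def, intervalIntegral.integral_of_le zero_le_one]
  refine integral_congr_ae ?_
  filter_upwards [hf.coeFn_toLp, hg.coeFn_toLp] with x h1 h2
  rw [h1, h2]
  simp [mul_comm]

lemma orthonormal_cosPhaseLp (j : ℕ) {m : ℕ} (hm : 0 < m) : Orthonormal ℝ (cosPhaseLp j m) := by
  rw [orthonormal_iff_ite]
  intro h l
  rw [cosPhaseLp, cosPhaseLp, inner_toLp, integral_cosPhase_mul j (by positivity)]
  simp [hm.ne']

/-- Bessel's inequality, qualitatively. -/
lemma summable_sq_integral_cosPhase {g : ℝ → ℝ} (hg : MemLp g 2 (volume.restrict (Ioc 0 1)))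
    (j : ℕ) {m : ℕ} (hm : 0 < m) :
    Summable fun h : ℕ+ => (∫ x in (0 : ℝ)..1, g x * cosPhase j (m * h) x) ^ 2 := by
  have := (orthonormal_cosPhaseLp j hm).inner_products_summable hg.toLp
  refine this.congr fun h => ?_
  rw [cosPhaseLp, inner_toLp, norm_eq_abs, sq_abs]
  simp only [mul_comm]

/-- An `ℓ²` combination of the functions `cosPhase j (m h)`. -/
lemma exists_memLp_integral_eq_tsum (j : ℕ) {m : ℕ} (hm : 0 < m) {v : ℕ+ → ℝ}
    (hv : Summable fun h => v h ^ 2) : ∃ g : ℝ → ℝ, MemLp g 2 (volume.restrict (Ioc 0 1)) ∧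
      ∀ x ∈ Icc (0 : ℝ) 1, HasSum (fun h : ℕ+ => v h * ∫ t in (0 : ℝ)..x, cosPhase j (m * h) t)
        (∫ t in (0 : ℝ)..x, g t) := by
  have hs : Summable fun h => v h • cosPhaseLp j m h := by
    have := ((orthonormal_cosPhaseLp j hm).orthogonalFamily.summable_iff_norm_sq_summable v).2
      (by simpa using hv)
    simpa using this
  obtain ⟨G, hG⟩ := hs
  refine ⟨G, Lp.memLp G, fun x hx => ?_⟩
  have hmeas : MeasurableSet (Ioc (0 : ℝ) x) := measurableSet_Ioc
  have hfin : volume.restrict (Ioc (0 : ℝ) 1) (Ioc 0 x) ≠ ⊤ := measure_ne_top _ _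
  -- Pairing with the indicator of `(0, x]` turns `L²` convergence into convergence of the
  -- primitives at `x`.
  have h1 := hG.mapL (innerSL ℝ (indicatorConstLp 2 hmeas hfin (1 : ℝ)))
  have hsub : Ioc (0 : ℝ) x ⊆ Ioc 0 1 := Ioc_subset_Ioc_right hx.2
  have hval : ∀ f : Lp ℝ 2 (volume.restrict (Ioc (0 : ℝ) 1)),
      innerSL ℝ (indicatorConstLp 2 hmeas hfin (1 : ℝ)) f = ∫ t in (0 : ℝ)..x, f t := fun f => by
    rw [innerSL_apply_apply, L2.inner_indicatorConstLp_one, Measure.restrict_restrict hmeas,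
      inter_eq_left.2 hsub, intervalIntegral.integral_of_le hx.1]
  rw [hval] at h1
  refine (funext fun h => ?_ : (fun h : ℕ+ => v h * ∫ t in (0 : ℝ)..x, cosPhase j (m * h) t) =
    fun h => innerSL ℝ (indicatorConstLp 2 hmeas hfin (1 : ℝ)) (v h • cosPhaseLp j m h)) ▸ h1
  rw [map_smul, hval, smul_eq_mul]
  congr 1
  rw [intervalIntegral.integral_of_le hx.1, intervalIntegral.integral_of_le hx.1]
  refine integral_congr_ae ?_
  have := (memLp_of_continuous (continuous_cosPhase j (m * h))).coeFn_toLp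
  exact (ae_restrict_of_ae_restrict_of_subset hsub this).mono fun _ ht => ht.symm

lemma summable_pnat_one_div_sq : Summable fun h : ℕ+ => (1 / (h : ℝ)) ^ 2 := by
  have h1 : Summable fun n : ℕ => 1 / (n : ℝ) ^ 2 := summable_one_div_nat_pow.2 (by norm_num)
  have h2 := h1.comp_injective PNat.coe_injective
  refine h2.congr fun h => ?_
  simp

lemma summable_abs_mul_one_div {v : ℕ+ → ℝ} (hv : Summable fun h => v h ^ 2) :
    Summable fun h : ℕ+ => |v h| * (1 / (h : ℝ)) := by
  refine Summable.of_nonneg_of_le (fun h => by positivity) (fun h => ?_)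
    (hv.add summable_pnat_one_div_sq)
  have := sq_nonneg (|v h| - 1 / (h : ℝ))
  rw [← sq_abs (v h)]
  nlinarith [sq_nonneg |v h|, sq_nonneg (1 / (h : ℝ))]

/-! ### Trigonometric series with weighted `ℓ²` coefficients. -/

/-- The frequency `π m h`. -/
noncomputable def freq (m : ℕ) (h : ℕ+) : ℝ := π * ((m * h : ℕ) : ℝ)

lemma freq_pos {m : ℕ} (hm : 0 < m) (h : ℕ+) : 0 < freq m h := by
  unfold freq
  have : 0 < m * (h : ℕ) := by positivity
  have : (0 : ℝ) < ((m * h : ℕ) : ℝ) := by exact_mod_cast this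
  positivity

lemma pnat_le_freq {m : ℕ} (hm : 0 < m) (h : ℕ+) : (h : ℝ) ≤ freq m h := by
  unfold freq
  have h1 : (1 : ℝ) ≤ m := by exact_mod_cast hm
  have h2 : (1 : ℝ) ≤ π := by linarith [pi_gt_three]
  have h3 : (0 : ℝ) < h := by exact_mod_cast h.pos
  push_cast
  have : (1 : ℝ) ≤ π * m := by nlinarith
  nlinarith

lemma freq_pow_div_le {m α τ : ℕ} (hm : 0 < m) (hτ : τ < α) (h : ℕ+) :
    freq m h ^ τ / freq m h ^ α ≤ 1 / (h : ℝ) := by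
  have h0 := freq_pos hm h
  have h1 := pnat_le_freq hm h
  have h3 : (0 : ℝ) < h := by exact_mod_cast h.pos
  have h4 : (1 : ℝ) ≤ freq m h := le_trans (by exact_mod_cast h.pos) h1
  rw [div_le_div_iff₀ (by positivity) h3, one_mul]
  calc freq m h ^ τ * h ≤ freq m h ^ τ * freq m h := by gcongr
    _ = freq m h ^ (τ + 1) := by ring
    _ ≤ freq m h ^ α := pow_le_pow_right₀ h4 hτ

/-- The `τ`-th derivative of the series `∑ v_h (π m h)^{-α} cosPhase j (m h)`. -/
noncomputable def phaseSeries (α m j : ℕ) (v : ℕ+ → ℝ) (τ : ℕ) (x : ℝ) : ℝ :=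
  ∑' h : ℕ+, v h * (freq m h ^ τ / freq m h ^ α) * cosPhase (j + τ) (m * h) x

section Series

variable {α m : ℕ} (j : ℕ) {v : ℕ+ → ℝ}

lemma summable_phaseSeries_bound (hm : 0 < m) (hv : Summable fun h => v h ^ 2) {τ : ℕ}
    (hτ : τ < α) : Summable fun h : ℕ+ => |v h| * (freq m h ^ τ / freq m h ^ α) * 2 := by
  refine Summable.mul_right _ (Summable.of_nonneg_of_le (fun h => ?_) (fun h => ?_)
    (summable_abs_mul_one_div hv))
  · have := freq_pos hm h
    positivity
  · exact mul_le_mul_of_nonneg_left (freq_pow_div_le hm hτ h) (abs_nonneg _)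

lemma norm_phaseSeries_term_le (hm : 0 < m) (τ : ℕ) (h : ℕ+) (x : ℝ) :
    ‖v h * (freq m h ^ τ / freq m h ^ α) * cosPhase (j + τ) (m * h) x‖ ≤
      |v h| * (freq m h ^ τ / freq m h ^ α) * 2 := by
  have := freq_pos hm h
  rw [norm_mul, norm_mul, norm_eq_abs, norm_eq_abs, norm_eq_abs,
    abs_of_nonneg (by positivity : 0 ≤ freq m h ^ τ / freq m h ^ α)]
  gcongr
  exact abs_cosPhase_le _ _ _

lemma summable_phaseSeries (hm : 0 < m) (hv : Summable fun h => v h ^ 2) {τ : ℕ}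
    (hτ : τ < α) (x : ℝ) : Summable fun h : ℕ+ =>
      v h * (freq m h ^ τ / freq m h ^ α) * cosPhase (j + τ) (m * h) x :=
  Summable.of_norm_bounded (summable_phaseSeries_bound hm hv hτ) fun h =>
    norm_phaseSeries_term_le j hm τ h x

lemma continuous_phaseSeries (hm : 0 < m) (hv : Summable fun h => v h ^ 2) {τ : ℕ}
    (hτ : τ < α) : Continuous (phaseSeries α m j v τ) :=
  continuous_tsum (fun _ => (continuous_cosPhase _ _).const_mul _)
    (summable_phaseSeries_bound hm hv hτ) fun h x => norm_phaseSeries_term_le j hm τ h x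

lemma hasDerivAt_phaseSeries_term (τ : ℕ) (h : ℕ+) (x : ℝ) :
    HasDerivAt (fun x => v h * (freq m h ^ τ / freq m h ^ α) * cosPhase (j + τ) (m * h) x)
      (v h * (freq m h ^ (τ + 1) / freq m h ^ α) * cosPhase (j + (τ + 1)) (m * h) x) x := by
  refine ((hasDerivAt_cosPhase (j + τ) (m * h) x).const_mul
    (v h * (freq m h ^ τ / freq m h ^ α))).congr_deriv ?_
  rw [show π * ((m * h : ℕ) : ℝ) = freq m h from rfl, pow_succ]
  ring_nf

lemma hasDerivAt_phaseSeries (hm : 0 < m) (hv : Summable fun h => v h ^ 2) {τ : ℕ}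
    (hτ : τ + 1 < α) (x : ℝ) :
    HasDerivAt (phaseSeries α m j v τ) (phaseSeries α m j v (τ + 1) x) x :=
  hasDerivAt_tsum (summable_phaseSeries_bound hm hv hτ)
    (fun h x => hasDerivAt_phaseSeries_term j τ h x)
    (fun h x => norm_phaseSeries_term_le j hm (τ + 1) h x)
    (summable_phaseSeries j hm hv (by omega) 0) x

/-- `ℓ²` series of trigonometric functions are Sobolev functions. -/
lemma exists_isSobolevTower_phaseSeries (hm : 0 < m) (hv : Summable fun h => v h ^ 2) :
    ∃ F, IsSobolevTower α F ∧ ∀ τ < α, F τ = phaseSeries α m j v τ := by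
  obtain ⟨g, hg, hgs⟩ := exists_memLp_integral_eq_tsum (j + α) hm hv
  -- Below order `α` the differentiated series converges uniformly; at order `α` only its `L²` limit
  -- `g` is available.
  refine ⟨fun τ => if τ < α then phaseSeries α m j v τ else g, ⟨?_, ?_, by simpa using hg⟩,
    fun τ hτ => by simp [hτ]⟩
  · intro τ hτ x hx
    simp only [hτ, if_true]
    split_ifs with h1
    · rw [intervalIntegral.integral_eq_sub_of_hasDerivAt
        (fun t _ => hasDerivAt_phaseSeries j hm hv h1 t)
        ((continuous_phaseSeries j hm hv h1).intervalIntegrable _ _)]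
      ring
    -- The last step below the top: the series of order `α - 1` is the termwise primitive of the
    -- `L²` series.
    · obtain rfl : α = τ + 1 := by omega
      have hd := (summable_phaseSeries j hm hv hτ x).hasSum.sub
        (summable_phaseSeries j hm hv hτ 0).hasSum
      have hs := hgs x hx
      have : (fun h : ℕ+ => v h * ∫ t in (0 : ℝ)..x, cosPhase (j + (τ + 1)) (m * h) t) =
          fun h : ℕ+ => v h * (freq m h ^ τ / freq m h ^ (τ + 1)) * cosPhase (j + τ) (m * h) x -
            v h * (freq m h ^ τ / freq m h ^ (τ + 1)) * cosPhase (j + τ) (m * h) 0 := by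
        funext h
        rw [← intervalIntegral.integral_const_mul]
        rw [← intervalIntegral.integral_eq_sub_of_hasDerivAt
          (fun t _ => hasDerivAt_phaseSeries_term (α := τ + 1) (m := m) (v := v) j τ h t)
          (Continuous.intervalIntegrable (by have := continuous_cosPhase; fun_prop) _ _)]
        have := freq_pos hm h
        rw [div_self (by positivity)]
        simp
      rw [this] at hs
      have := hs.unique hd
      rw [this]
      unfold phaseSeries
      ring
  · intro τ hτ
    simp only [hτ, if_true]
    exact (continuous_phaseSeries j hm hv hτ).continuousOn

lemma phaseSeries_zero_eq_one (hm : Even m) (τ : ℕ) :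
    phaseSeries α m j v τ 0 = phaseSeries α m j v τ 1 := by
  unfold phaseSeries
  refine tsum_congr fun h => ?_
  rw [cosPhase_even_one _ (hm.mul_right _)]

lemma phaseSeries_odd_zero {τ : ℕ} (hτ : Odd (j + τ)) : phaseSeries α m j v τ 0 = 0 := by
  simp [phaseSeries, cosPhase_odd_zero hτ]

lemma phaseSeries_odd_one {τ : ℕ} (hτ : Odd (j + τ)) : phaseSeries α m j v τ 1 = 0 := by
  simp [phaseSeries, cosPhase_odd_one hτ]

/-- A primitive is a multiple of `cosPhase (j + 1) k`, which vanishes at both ends if `j` is even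
and is 1-periodic if `k` is even. -/
lemma integral_cosPhase_eq_zero {k : ℕ} (hk : 0 < k) (h : Even j ∨ Even k) :
    ∫ x in (0 : ℝ)..1, cosPhase j k x = 0 := by
  have hk' : (k : ℝ) ≠ 0 := by exact_mod_cast hk.ne'
  have hd : ∀ x, HasDerivAt (fun x => -(cosPhase (j + 1) k x / (π * k))) (cosPhase j k x) x :=
    fun x => by
    refine ((hasDerivAt_cosPhase (j + 1) k x).div_const (π * k)).neg.congr_deriv ?_
    rw [cosPhase_add_two]
    have := pi_ne_zero
    field_simp
  rw [intervalIntegral.integral_eq_sub_of_hasDerivAt (fun x _ => hd x)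
    ((continuous_cosPhase _ _).intervalIntegrable _ _)]
  rcases h with h | h
  · rw [cosPhase_odd_one h.add_one, cosPhase_odd_zero h.add_one]
    simp
  · rw [cosPhase_even_one _ h]
    simp

lemma integral_phaseSeries_eq_zero (hα : 0 < α) (hm : 0 < m) (hv : Summable fun h => v h ^ 2)
    (h : Even j ∨ Even m) : ∫ x in (0 : ℝ)..1, phaseSeries α m j v 0 x = 0 := by
  have hs := intervalIntegral.hasSum_integral_of_dominated_convergence
    (μ := volume) (a := 0) (b := 1)
    (F := fun (h : ℕ+) (x : ℝ) =>
      v h * (freq m h ^ 0 / freq m h ^ α) * cosPhase (j + 0) (m * h) x)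
    (f := phaseSeries α m j v 0)
    (fun h _ => |v h| * (freq m h ^ 0 / freq m h ^ α) * 2)
    (fun h => (Continuous.aestronglyMeasurable
      (by have := continuous_cosPhase; fun_prop)))
    (fun h => Filter.Eventually.of_forall fun x _ => norm_phaseSeries_term_le j hm 0 h x)
    (Filter.Eventually.of_forall fun x _ => summable_phaseSeries_bound hm hv hα)
    (by simp)
    (Filter.Eventually.of_forall fun x _ => (summable_phaseSeries j hm hv hα x).hasSum)
  refine hs.unique ?_
  convert hasSum_zero using 1
  funext l
  rw [intervalIntegral.integral_const_mul, add_zero, integral_cosPhase_eq_zero, mul_zero]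
  · positivity
  · exact h.imp id fun h => h.mul_right _

end Series

end Trig

/-! ### Fourier expansions on `[0,1]` -/

section Fourier

open MeasureTheory Set Real

lemma fourier_natCast_eq (k : ℕ) (x : ℝ) : (fourier (k : ℤ) (x : AddCircle (1 : ℝ)) : ℂ) =
    (cosPhase 0 (2 * k) x - Complex.I * cosPhase 1 (2 * k) x) / (√2 : ℂ) := by
  rw [fourier_coe_apply]
  have h2 : (√2 : ℂ) ≠ 0 := by
    exact_mod_cast (sqrt_pos.2 (by norm_num : (0 : ℝ) < 2)).ne'
  rw [show 2 * (π : ℂ) * Complex.I * ((k : ℤ) : ℂ) * x / ((1 : ℝ) : ℂ) =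
    ((π * (2 * k : ℕ) * x : ℝ) : ℂ) * Complex.I by push_cast; ring, Complex.exp_mul_I,
    ← Complex.ofReal_cos, ← Complex.ofReal_sin]
  have h0 : cosPhase 0 (2 * k) x = √2 * cos (π * (2 * k : ℕ) * x) := by simp [cosPhase]
  have h1 : cosPhase 1 (2 * k) x = -(√2 * sin (π * (2 * k : ℕ) * x)) := by
    simp [cosPhase, cos_add_pi_div_two]
  rw [h0, h1, eq_div_iff h2]
  push_cast
  ring

lemma fourier_neg_natCast_eq (k : ℕ) (x : ℝ) :
    (fourier (-(k : ℤ)) (x : AddCircle (1 : ℝ)) : ℂ) =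
      (cosPhase 0 (2 * k) x + Complex.I * cosPhase 1 (2 * k) x) / (√2 : ℂ) := by
  rw [fourier_neg, fourier_natCast_eq]
  simp

/-- Pointwise convergence of a Fourier series with summable coefficients. -/
lemma eq_fourierSeries_of_summable {h : ℝ → ℝ} (hc : ContinuousOn h (Icc 0 1)) (h01 : h 0 = h 1)
    (hA : Summable fun k : ℕ+ => ∫ x in (0 : ℝ)..1, h x * cosPhase 0 (2 * k) x)
    (hB : Summable fun k : ℕ+ => ∫ x in (0 : ℝ)..1, h x * cosPhase 1 (2 * k) x)
    {x : ℝ} (hx : x ∈ Icc (0 : ℝ) 1) :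
    h x = (∫ t in (0 : ℝ)..1, h t) +
      (∑' k : ℕ+, (∫ t in (0 : ℝ)..1, h t * cosPhase 0 (2 * k) t) * cosPhase 0 (2 * k) x) +
      ∑' k : ℕ+, (∫ t in (0 : ℝ)..1, h t * cosPhase 1 (2 * k) t) * cosPhase 1 (2 * k) x := by
  -- The function on the circle is lifted from `[0, 1)`; the point `1` is reached by periodicity.
  wlog hx1 : x < 1 generalizing x
  · obtain rfl : x = 1 := le_antisymm hx.2 (not_lt.1 hx1)
    have := this (x := 0) (by simp) (by norm_num)
    rw [← h01, this]
    congr 1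
    · congr 1
      exact tsum_congr fun k => by rw [cosPhase_even_one _ (even_two_mul _)]
    · exact tsum_congr fun k => by rw [cosPhase_even_one _ (even_two_mul _)]
  set A : ℕ → ℝ := fun k => ∫ t in (0 : ℝ)..1, h t * cosPhase 0 (2 * k) t with hAdef
  set B : ℕ → ℝ := fun k => ∫ t in (0 : ℝ)..1, h t * cosPhase 1 (2 * k) t with hBdef
  have hs2 : (√2 : ℂ) ≠ 0 := by
    exact_mod_cast (sqrt_pos.2 (by norm_num : (0 : ℝ) < 2)).ne'
  have hs22 : (√2 : ℂ) * √2 = 2 := by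
    exact_mod_cast mul_self_sqrt (by norm_num : (0 : ℝ) ≤ 2)
  have : Fact ((0 : ℝ) < 1) := ⟨zero_lt_one⟩
  let f : C(AddCircle (1 : ℝ), ℂ) := ⟨AddCircle.liftIco 1 0 fun x => (h x : ℂ),
    AddCircle.liftIco_continuous (by simp [h01]) (by
      rw [zero_add]
      exact Complex.continuous_ofReal.comp_continuousOn hc)⟩
  have hfx : ∀ x ∈ Ico (0 : ℝ) 1, f (x : AddCircle (1 : ℝ)) = h x := fun x hx =>
    AddCircle.liftIco_coe_apply (p := (1 : ℝ)) (a := 0) (f := fun x => (h x : ℂ)) (x := x)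
      (by rwa [zero_add])
  have hcoef : ∀ n : ℤ, fourierCoeff f n =
      ∫ t in (0 : ℝ)..1, (fourier (-n) (t : AddCircle (1 : ℝ)) : ℂ) * h t := by
    intro n
    rw [fourierCoeff_eq_intervalIntegral _ _ 0, zero_add, div_one, one_smul]
    refine intervalIntegral.integral_congr_Ioo_of_le zero_le_one fun t ht => ?_
    simp only [smul_eq_mul]
    rw [hfx t ⟨ht.1.le, ht.2⟩]
  have hint : ∀ j k, IntervalIntegrable (fun t => h t * cosPhase j k t) volume 0 1 := by
    intro j k
    refine ContinuousOn.intervalIntegrable ?_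
    rw [uIcc_of_le zero_le_one]
    exact hc.mul (continuous_cosPhase j k).continuousOn
  have hintC : ∀ j k, IntervalIntegrable (fun t => ((h t * cosPhase j k t : ℝ) : ℂ)) volume 0 1 :=
    fun j k => ⟨Integrable.ofReal (hint j k).1, Integrable.ofReal (hint j k).2⟩
  have hpos : ∀ k : ℕ, fourierCoeff f k = (A k + Complex.I * B k) / (√2 : ℂ) := by
    intro k
    rw [hcoef]
    have : ∀ t : ℝ, (fourier (-(k : ℤ)) (t : AddCircle (1 : ℝ)) : ℂ) * h t =
        (((h t * cosPhase 0 (2 * k) t : ℝ) : ℂ) +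
          Complex.I * ((h t * cosPhase 1 (2 * k) t : ℝ) : ℂ)) / (√2 : ℂ) := fun t => by
      rw [fourier_neg_natCast_eq]
      push_cast
      ring
    simp only [this]
    rw [intervalIntegral.integral_div, intervalIntegral.integral_add (hintC _ _)
      ((hintC _ _).const_mul _), intervalIntegral.integral_const_mul,
      intervalIntegral.integral_ofReal, intervalIntegral.integral_ofReal]
  have hneg : ∀ k : ℕ, fourierCoeff f (-(k : ℤ)) = (A k - Complex.I * B k) / (√2 : ℂ) := by
    intro k
    rw [hcoef, neg_neg]
    have : ∀ t : ℝ, (fourier (k : ℤ) (t : AddCircle (1 : ℝ)) : ℂ) * h t =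
        (((h t * cosPhase 0 (2 * k) t : ℝ) : ℂ) -
          Complex.I * ((h t * cosPhase 1 (2 * k) t : ℝ) : ℂ)) / (√2 : ℂ) := fun t => by
      rw [fourier_natCast_eq]
      push_cast
      ring
    simp only [this]
    rw [intervalIntegral.integral_div, intervalIntegral.integral_sub (hintC _ _)
      ((hintC _ _).const_mul _), intervalIntegral.integral_const_mul,
      intervalIntegral.integral_ofReal, intervalIntegral.integral_ofReal]
  have hAs : Summable A := (summable_nat_add_iff 1).1 (summable_pnat_iff_summable_succ.1 hA)
  have hBs : Summable B := (summable_nat_add_iff 1).1 (summable_pnat_iff_summable_succ.1 hB)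
  have hAc : Summable fun k => (A k : ℂ) := Complex.ofRealCLM.summable hAs
  have hBc : Summable fun k => (B k : ℂ) := Complex.ofRealCLM.summable hBs
  have hsum : Summable (fourierCoeff f) := by
    refine Summable.of_nat_of_neg ?_ ?_
    · simp only [hpos]
      exact (hAc.add (hBc.mul_left _)).div_const _
    · simp only [hneg]
      exact (hAc.sub (hBc.mul_left _)).div_const _
  have hser := has_pointwise_sum_fourier_series_of_summable hsum (x : AddCircle (1 : ℝ))
  rw [hfx x ⟨hx.1, hx1⟩] at hser
  simp only [smul_eq_mul] at hser
  have hs := hser.summable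
  have hs' := summable_int_iff_summable_nat_and_neg.1 hs
  have e1 : Summable fun k : ℕ+ => fourierCoeff f ((k : ℕ) : ℤ) *
      fourier ((k : ℕ) : ℤ) (x : AddCircle (1 : ℝ)) := hs'.1.comp_injective PNat.coe_injective
  have e2 : Summable fun k : ℕ+ => fourierCoeff f (-((k : ℕ) : ℤ)) *
      fourier (-((k : ℕ) : ℤ)) (x : AddCircle (1 : ℝ)) := hs'.2.comp_injective PNat.coe_injective
  have e3 := tsum_int_eq_zero_add_tsum_pnat hs
  rw [hser.tsum_eq, add_assoc] at e3
  rw [← Summable.tsum_add e1 e2] at e3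
  have e4 : ∀ k : ℕ+, fourierCoeff f ((k : ℕ) : ℤ) *
      fourier ((k : ℕ) : ℤ) (x : AddCircle (1 : ℝ)) + fourierCoeff f (-((k : ℕ) : ℤ)) *
      fourier (-((k : ℕ) : ℤ)) (x : AddCircle (1 : ℝ)) =
      ((A k * cosPhase 0 (2 * k) x + B k * cosPhase 1 (2 * k) x : ℝ) : ℂ) := fun k => by
    rw [hpos, hneg, fourier_natCast_eq, fourier_neg_natCast_eq]
    field_simp
    push_cast
    rw [pow_two, hs22]
    ring_nf
    rw [Complex.I_sq]
    ring
  simp only [e4] at e3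
  rw [← Complex.ofReal_tsum] at e3
  have e5 : fourierCoeff f 0 = ((∫ t in (0 : ℝ)..1, h t : ℝ) : ℂ) := by
    rw [hcoef]
    simp [intervalIntegral.integral_ofReal]
  rw [e5, fourier_zero, mul_one, ← Complex.ofReal_add] at e3
  have e6 := Complex.ofReal_injective e3
  have hbd : ∀ (j : ℕ) (C : ℕ → ℝ), Summable C →
      Summable fun k : ℕ+ => C k * cosPhase j (2 * k) x := fun j C hC => by
    have h1 : Summable fun k : ℕ+ => |C k| * 2 := (hC.abs.comp_injective PNat.coe_injective).mul_right 2
    refine Summable.of_norm_bounded h1 fun k => ?_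
    rw [norm_mul, norm_eq_abs, norm_eq_abs]
    gcongr
    exact abs_cosPhase_le _ _ _
  rw [Summable.tsum_add (hbd 0 A hAs) (hbd 1 B hBs), ← add_assoc] at e6
  exact e6

/-- Integral against a function of the even extension of a function on `[0,1]`. -/
lemma integral_evenExtension_mul {f q : ℝ → ℝ} (hf : ContinuousOn f (Icc 0 1))
    (hq : Continuous q) :
    ∫ x in (0 : ℝ)..1, f (1 - |1 - 2 * x|) * q x =
      2⁻¹ * ∫ u in (0 : ℝ)..1, f u * (q (u / 2) + q (1 - u / 2)) := by
  have hcont : ContinuousOn (fun x : ℝ => f (1 - |1 - 2 * x|) * q x) (Icc 0 1) := by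
    refine ContinuousOn.mul (hf.comp (by fun_prop) fun x hx => ?_) hq.continuousOn
    constructor
    · have : |1 - 2 * x| ≤ 1 := abs_le.2 ⟨by linarith [hx.2], by linarith [hx.1]⟩
      linarith
    · linarith [abs_nonneg (1 - 2 * x)]
  have hint : ∀ a b : ℝ, a ∈ Icc (0 : ℝ) 1 → b ∈ Icc (0 : ℝ) 1 →
      IntervalIntegrable (fun x : ℝ => f (1 - |1 - 2 * x|) * q x) volume a b := fun a b ha hb =>
    (hcont.mono (uIcc_subset_Icc ha hb)).intervalIntegrable
  rw [← intervalIntegral.integral_add_adjacent_intervals (b := (1 / 2 : ℝ))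
    (hint _ _ (by simp) (by constructor <;> norm_num))
    (hint _ _ (by constructor <;> norm_num) (by simp))]
  have h1 : ∫ x in (0 : ℝ)..(1 / 2), f (1 - |1 - 2 * x|) * q x =
      2⁻¹ * ∫ u in (0 : ℝ)..1, f u * q (u / 2) := by
    have := intervalIntegral.integral_comp_mul_left (a := 0) (b := 1 / 2) (c := 2)
      (fun u : ℝ => f u * q (u / 2)) two_ne_zero
    rw [mul_zero, show (2 : ℝ) * (1 / 2) = 1 by norm_num, smul_eq_mul] at this
    rw [← this]
    refine intervalIntegral.integral_congr fun x hx => ?_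
    rw [uIcc_of_le (by norm_num)] at hx
    rw [abs_of_nonneg (by linarith [hx.2]), show 1 - (1 - 2 * x) = 2 * x by ring,
      show 2 * x / 2 = x by ring]
  have h2 : ∫ x in (1 / 2 : ℝ)..1, f (1 - |1 - 2 * x|) * q x =
      2⁻¹ * ∫ u in (0 : ℝ)..1, f u * q (1 - u / 2) := by
    have := intervalIntegral.integral_comp_sub_mul (a := 1 / 2) (b := 1) (c := 2)
      (fun u : ℝ => f u * q (1 - u / 2)) two_ne_zero 2
    rw [show (2 : ℝ) - 2 * 1 = 0 by norm_num, show (2 : ℝ) - 2 * (1 / 2) = 1 by norm_num,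
      smul_eq_mul] at this
    rw [← this]
    refine intervalIntegral.integral_congr fun x hx => ?_
    rw [uIcc_of_le (by norm_num)] at hx
    rw [abs_of_nonpos (by linarith [hx.1]), show 1 - -(1 - 2 * x) = 2 - 2 * x by ring,
      show 1 - (2 - 2 * x) / 2 = x by ring]
  have hint' : ∀ q' : ℝ → ℝ, Continuous q' →
      IntervalIntegrable (fun x : ℝ => f x * q' x) volume 0 1 := fun q' hq' => by
    refine ContinuousOn.intervalIntegrable ?_
    rw [uIcc_of_le zero_le_one]
    exact hf.mul hq'.continuousOn
  simp only [mul_add]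
  rw [h1, h2, intervalIntegral.integral_add (hint' _ (by fun_prop)) (hint' _ (by fun_prop)),
    mul_add]

lemma cosPhase_zero_half (k : ℕ) (u : ℝ) : cosPhase 0 (2 * k) (u / 2) = cosPhase 0 k u := by
  unfold cosPhase
  push_cast
  ring_nf

lemma cosPhase_zero_reflect (k : ℕ) (x : ℝ) :
    cosPhase 0 (2 * k) (1 - x) = cosPhase 0 (2 * k) x := by
  unfold cosPhase
  rw [show π * ((2 * k : ℕ) : ℝ) * (1 - x) + ((0 : ℕ) : ℝ) * (π / 2) =
    k * (2 * π) - (π * ((2 * k : ℕ) : ℝ) * x + ((0 : ℕ) : ℝ) * (π / 2)) by push_cast; ring,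
    cos_nat_mul_two_pi_sub]

lemma cosPhase_one_reflect (k : ℕ) (x : ℝ) :
    cosPhase 1 (2 * k) (1 - x) = -cosPhase 1 (2 * k) x := by
  unfold cosPhase
  rw [show π * ((2 * k : ℕ) : ℝ) * (1 - x) + ((1 : ℕ) : ℝ) * (π / 2) =
    k * (2 * π) - (π * ((2 * k : ℕ) : ℝ) * x - π / 2) by push_cast; ring,
    cos_nat_mul_two_pi_sub,
    show π * ((2 * k : ℕ) : ℝ) * x + ((1 : ℕ) : ℝ) * (π / 2) =
      (π * ((2 * k : ℕ) : ℝ) * x - π / 2) + π by push_cast; ring, cos_add_pi]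
  ring

/-- Pointwise convergence of a cosine series with summable coefficients. -/
lemma eq_cosSeries_of_summable {f : ℝ → ℝ} (hc : ContinuousOn f (Icc 0 1))
    (hA : Summable fun k : ℕ+ => ∫ x in (0 : ℝ)..1, f x * cosPhase 0 k x)
    {x : ℝ} (hx : x ∈ Icc (0 : ℝ) 1) :
    f x = (∫ t in (0 : ℝ)..1, f t) +
      ∑' k : ℕ+, (∫ t in (0 : ℝ)..1, f t * cosPhase 0 k t) * cosPhase 0 k x := by
  -- Run through `f` forwards on `[0, 1/2]` and backwards on `[1/2, 1]`. The result is automatically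
  -- periodic, its sine coefficients vanish by symmetry, and its cosine coefficients of frequency
  -- `2k` are those of `f` of frequency `k`.
  set h : ℝ → ℝ := fun x => f (1 - |1 - 2 * x|) with hh
  have hcont : ContinuousOn h (Icc 0 1) := by
    refine hc.comp (by fun_prop) fun x hx => ?_
    constructor
    · have : |1 - 2 * x| ≤ 1 := abs_le.2 ⟨by linarith [hx.2], by linarith [hx.1]⟩
      linarith
    · linarith [abs_nonneg (1 - 2 * x)]
  have c0 : ∀ k : ℕ, ∫ x in (0 : ℝ)..1, h x * cosPhase 0 (2 * k) x =
      ∫ x in (0 : ℝ)..1, f x * cosPhase 0 k x := fun k => by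
    rw [hh, integral_evenExtension_mul hc (continuous_cosPhase _ _)]
    simp only [cosPhase_zero_reflect, cosPhase_zero_half, ← two_mul]
    rw [← intervalIntegral.integral_const_mul]
    congr 1
    funext u
    ring
  have c1 : ∀ k : ℕ, ∫ x in (0 : ℝ)..1, h x * cosPhase 1 (2 * k) x = 0 := fun k => by
    rw [hh, integral_evenExtension_mul hc (continuous_cosPhase _ _)]
    simp [cosPhase_one_reflect]
  have cm : ∫ x in (0 : ℝ)..1, h x = ∫ x in (0 : ℝ)..1, f x := by
    have := integral_evenExtension_mul hc (continuous_const (y := (1 : ℝ)))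
    simp only [mul_one] at this
    rw [hh, this, intervalIntegral.integral_mul_const]
    ring
  have := eq_fourierSeries_of_summable (h := h) hcont (by norm_num [hh])
    (by simpa only [c0] using hA) (by simpa only [c1] using summable_zero)
    (x := x / 2) ⟨by linarith [hx.1], by linarith [hx.2]⟩
  simp only [c0, c1, cm, cosPhase_zero_half, zero_mul, tsum_zero, add_zero] at this
  rw [← this, hh]
  simp only
  rw [abs_of_nonneg (by linarith [hx.2])]
  congr 1
  ring

namespace IsSobolevTower

variable {α : ℕ} {F : ℕ → ℝ → ℝ}

/-- Each integration by parts advances both the derivative and the phase and gains a factor `1 / (π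
k)`; its minus sign cancels against `cosPhase_add_two`. The hypothesis `hb` makes the boundary terms
cancel. -/
lemma integral_mul_cosPhase (h : IsSobolevTower α F) {j k : ℕ} (hk : 0 < k)
    (hb : ∀ τ < α, F τ 1 * cosPhase (j + τ + 1) k 1 = F τ 0 * cosPhase (j + τ + 1) k 0)
    {τ : ℕ} (hτ : τ ≤ α) : ∫ x in (0 : ℝ)..1, F 0 x * cosPhase j k x =
      (∫ x in (0 : ℝ)..1, F τ x * cosPhase (j + τ) k x) / (π * k) ^ τ := by
  have hk' : π * (k : ℝ) ≠ 0 := by positivity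
  induction τ with
  | zero => simp
  | succ τ ih =>
    rw [ih (by omega)]
    have h1 := h.integral_mul_deriv (τ := τ) hτ (hasDerivAt_cosPhase (j + τ + 1) k)
      ((continuous_cosPhase _ _).const_mul _)
    rw [hb τ hτ, sub_self, zero_sub] at h1
    have h2 : ∀ x, F τ x * (π * k * cosPhase (j + τ + 1 + 1) k x) =
        -(π * k) * (F τ x * cosPhase (j + τ) k x) := fun x => by
      rw [show j + τ + 1 + 1 = j + τ + 2 by ring, cosPhase_add_two]
      ring
    simp only [h2] at h1
    rw [intervalIntegral.integral_const_mul] at h1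
    have h3 : π * k * ∫ x in (0 : ℝ)..1, F τ x * cosPhase (j + τ) k x =
        ∫ x in (0 : ℝ)..1, F (τ + 1) x * cosPhase (j + (τ + 1)) k x := by
      rw [← add_assoc]
      linarith
    rw [← h3, pow_succ]
    field_simp

/-- The coefficients of a Sobolev function decay like `k ^ (-α)` times an `ℓ²` sequence. -/
lemma exists_coeff (h : IsSobolevTower α F) (j : ℕ) {m : ℕ} (hm : 0 < m)
    (hb : ∀ τ < α, ∀ k : ℕ+, F τ 1 * cosPhase (j + τ + 1) (m * k) 1 =
      F τ 0 * cosPhase (j + τ + 1) (m * k) 0) :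
    ∃ v : ℕ+ → ℝ, (Summable fun k => v k ^ 2) ∧ ∀ k : ℕ+,
      ∫ x in (0 : ℝ)..1, F 0 x * cosPhase j (m * k) x =
        v k * (freq m k ^ 0 / freq m k ^ α) := by
  refine ⟨_, summable_sq_integral_cosPhase h.memLp (j + α) hm, fun k => ?_⟩
  rw [h.integral_mul_cosPhase (by positivity) (fun τ hτ => hb τ hτ k) le_rfl, freq]
  ring

lemma summable_coeff (hα : 0 < α) {m : ℕ} (hm : 0 < m) {v : ℕ+ → ℝ}
    (hv : Summable fun k => v k ^ 2) :
    Summable fun k : ℕ+ => v k * (freq m k ^ 0 / freq m k ^ α) := by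
  refine Summable.of_norm_bounded (summable_phaseSeries_bound hm hv hα) fun k => ?_
  have := freq_pos hm k
  rw [norm_mul, norm_eq_abs, norm_eq_abs,
    abs_of_nonneg (by positivity : 0 ≤ freq m k ^ 0 / freq m k ^ α)]
  have h1 : 0 ≤ |v k| * (freq m k ^ 0 / freq m k ^ α) := by positivity
  linarith

/-- A Sobolev function whose odd derivatives vanish at the end points is a cosine series. -/
lemma exists_cosSeries (h : IsSobolevTower α F) (hα : 0 < α)
    (h0 : ∀ τ < α, Odd τ → F τ 0 = 0 ∧ F τ 1 = 0) :
    ∃ v : ℕ+ → ℝ, (Summable fun k => v k ^ 2) ∧ ∀ x ∈ Icc (0 : ℝ) 1,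
      F 0 x = (∫ t in (0 : ℝ)..1, F 0 t) + phaseSeries α 1 0 v 0 x := by
  obtain ⟨v, hv, hvF⟩ := h.exists_coeff 0 one_pos fun τ hτ k => by
    -- In each boundary term one factor is zero: the sine when `τ` is even, the derivative of the
    -- function when `τ` is odd.
    rcases Nat.even_or_odd τ with he | ho
    · have : Odd (0 + τ + 1) := by simpa using he.add_one
      rw [cosPhase_odd_one this, cosPhase_odd_zero this]
      simp
    · simp [h0 τ hτ ho]
  simp only [one_mul] at hvF
  refine ⟨v, hv, fun x hx => ?_⟩
  have hs := summable_coeff hα one_pos hv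
  rw [eq_cosSeries_of_summable (h.continuousOn 0 hα) (hs.congr fun k => (hvF k).symm) hx]
  simp only [hvF, phaseSeries, one_mul, add_zero]

/-- A Sobolev function with periodic derivatives is a trigonometric series. -/
lemma exists_fourierSeries (h : IsSobolevTower α F) (hα : 0 < α)
    (h0 : ∀ τ < α, F τ 0 = F τ 1) :
    ∃ v w : ℕ+ → ℝ, (Summable fun k => v k ^ 2) ∧ (Summable fun k => w k ^ 2) ∧
      ∀ x ∈ Icc (0 : ℝ) 1, F 0 x =
        (∫ t in (0 : ℝ)..1, F 0 t) + phaseSeries α 2 0 v 0 x + phaseSeries α 2 1 w 0 x := by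
  have hb : ∀ j, ∀ τ < α, ∀ k : ℕ+, F τ 1 * cosPhase (j + τ + 1) (2 * k) 1 =
      F τ 0 * cosPhase (j + τ + 1) (2 * k) 0 := fun j τ hτ k => by
    rw [cosPhase_even_one _ (even_two_mul _), h0 τ hτ]
  obtain ⟨v, hv, hvF⟩ := h.exists_coeff 0 two_pos (hb 0)
  obtain ⟨w, hw, hwF⟩ := h.exists_coeff 1 two_pos (hb 1)
  refine ⟨v, w, hv, hw, fun x hx => ?_⟩
  have hs := summable_coeff hα two_pos hv
  have hs' := summable_coeff hα two_pos hw
  rw [eq_fourierSeries_of_summable (h.continuousOn 0 hα) (h0 0 hα)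
    (hs.congr fun k => (hvF k).symm) (hs'.congr fun k => (hwF k).symm) hx]
  simp only [hvF, hwF, phaseSeries, add_zero]

end IsSobolevTower

/-! ### Bernoulli polynomials and removal of jumps. -/

/-- The derivatives of `B_n / n!`. -/
noncomputable def bernoulliTower (n τ : ℕ) (x : ℝ) : ℝ :=
  if τ ≤ n then bernoulliFun (n - τ) x / ((n - τ).factorial : ℝ) else 0

lemma hasDerivAt_bernoulliTower (n τ : ℕ) (x : ℝ) :
    HasDerivAt (bernoulliTower n τ) (bernoulliTower n (τ + 1) x) x := by
  rcases lt_trichotomy τ n with h | rfl | h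
  · have e1 : bernoulliTower n τ = fun x => bernoulliFun (n - τ) x / ((n - τ).factorial : ℝ) := by
      funext x
      simp [bernoulliTower, h.le]
    have e2 : bernoulliTower n (τ + 1) x =
        bernoulliFun (n - (τ + 1)) x / ((n - (τ + 1)).factorial : ℝ) := by
      simp [bernoulliTower, h]
    rw [e1, e2]
    refine ((hasDerivAt_bernoulliFun (n - τ) x).div_const _).congr_deriv ?_
    obtain ⟨d, rfl⟩ := Nat.exists_eq_add_of_lt h
    rw [show τ + d + 1 - τ = d + 1 by omega, show τ + d + 1 - (τ + 1) = d by omega,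
      Nat.factorial_succ, Nat.add_sub_cancel]
    push_cast
    have : (d.factorial : ℝ) ≠ 0 := by positivity
    have : (d : ℝ) + 1 ≠ 0 := by positivity
    field_simp
  · have e1 : bernoulliTower τ τ = fun _ => 1 := by
      funext x
      simp [bernoulliTower, bernoulliFun_zero]
    have e2 : bernoulliTower τ (τ + 1) x = 0 := by simp [bernoulliTower]
    rw [e1, e2]
    exact hasDerivAt_const x 1
  · have e1 : bernoulliTower n τ = fun _ => 0 := by
      funext x
      simp [bernoulliTower, h.not_ge]
    have e2 : bernoulliTower n (τ + 1) x = 0 := by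
      simp [bernoulliTower, (h.trans (Nat.lt_succ_self τ)).not_ge]
    rw [e1, e2]
    exact hasDerivAt_const x 0

/-- Among the Bernoulli polynomials only `B₁` differs at `0` and `1`. So the `B_n / n!` form a dual
system to the jumps of the derivatives. -/
lemma bernoulliTower_one_sub (n τ : ℕ) :
    bernoulliTower n τ 1 - bernoulliTower n τ 0 = if n = τ + 1 then 1 else 0 := by
  unfold bernoulliTower
  split_ifs with h1 h2 h2
  · subst h2
    rw [bernoulliFun_eval_one, show τ + 1 - τ = 1 by omega]
    simp
  · rw [bernoulliFun_eval_one, if_neg (by omega)]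
    simp
  · omega
  · simp

lemma isSobolevTower_bernoulliTower (α n : ℕ) : IsSobolevTower α (bernoulliTower n) :=
  IsSobolevTower.of_hasDerivAt (hasDerivAt_bernoulliTower n)

lemma integral_bernoulliTower {n : ℕ} (hn : n ≠ 0) :
    ∫ x in (0 : ℝ)..1, bernoulliTower n 0 x = 0 := by
  simp only [bernoulliTower, Nat.zero_le, if_true, Nat.sub_zero]
  rw [intervalIntegral.integral_div, integral_bernoulliFun_eq_zero hn, zero_div]

/-- Every Sobolev function is a sum of Bernoulli polynomials and a trigonometric series. -/
lemma IsSobolevTower.exists_expansion {α : ℕ} {F : ℕ → ℝ → ℝ} (h : IsSobolevTower α F)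
    (hα : 0 < α) : ∃ (c : ℕ → ℝ) (v w : ℕ+ → ℝ), (Summable fun k => v k ^ 2) ∧
      (Summable fun k => w k ^ 2) ∧ ∀ x ∈ Icc (0 : ℝ) 1, F 0 x =
        (∫ t in (0 : ℝ)..1, F 0 t) + (∑ n ∈ Finset.Icc 1 α, c n * bernoulliTower n 0 x) +
          phaseSeries α 2 0 v 0 x + phaseSeries α 2 1 w 0 x := by
  -- `c n` is the jump of the derivative of order `n - 1`; subtracting `∑ c n B_n / n!` makes every
  -- derivative of order below `α` periodic.
  set c : ℕ → ℝ := fun n => F (n - 1) 1 - F (n - 1) 0 with hc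
  have hP : IsSobolevTower α fun τ x => ∑ n ∈ Finset.Icc 1 α, c n * bernoulliTower n τ x :=
    IsSobolevTower.finset_sum _ fun n _ => (isSobolevTower_bernoulliTower α n).const_mul (c n)
  have hG := h.add (hP.const_mul (-1))
  obtain ⟨v, w, hv, hw, hvw⟩ := hG.exists_fourierSeries hα fun τ hτ => by
    have h1 : ∑ n ∈ Finset.Icc 1 α, c n * bernoulliTower n τ 1 -
        ∑ n ∈ Finset.Icc 1 α, c n * bernoulliTower n τ 0 = c (τ + 1) := by
      rw [← Finset.sum_sub_distrib]
      simp only [← mul_sub, bernoulliTower_one_sub, mul_ite, mul_one, mul_zero,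
        Finset.sum_ite_eq']
      rw [if_pos (Finset.mem_Icc.2 ⟨by omega, by omega⟩)]
    simp only [hc, Nat.add_sub_cancel] at h1
    linarith
  refine ⟨c, v, w, hv, hw, fun x hx => ?_⟩
  have h2 := hvw x hx
  have h3 : ∫ t in (0 : ℝ)..1, (F 0 t + -1 * ∑ n ∈ Finset.Icc 1 α, c n * bernoulliTower n 0 t) =
      ∫ t in (0 : ℝ)..1, F 0 t := by
    rw [intervalIntegral.integral_add (h.intervalIntegrable hα.le)
      ((hP.intervalIntegrable hα.le).const_mul _), intervalIntegral.integral_const_mul,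
      intervalIntegral.integral_finsetSum fun n _ =>
        ((isSobolevTower_bernoulliTower α n).intervalIntegrable hα.le).const_mul _,
      Finset.sum_eq_zero, mul_zero, add_zero]
    intro n hn
    rw [intervalIntegral.integral_const_mul, integral_bernoulliTower, mul_zero]
    have := (Finset.mem_Icc.1 hn).1
    omega
  rw [h3] at h2
  linarith

end Fourier

/-! ### The univariate kernels -/

section UnivariateKernels

open MeasureTheory Set Real

/-- The trigonometric function `(π m h)^{-α} cosPhase j (m h)` on `[0,1]`. -/
noncomputable def phaseFun (α m j : ℕ) (h : ℕ+) (x : I) : ℝ :=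
  freq m h ^ 0 / freq m h ^ α * cosPhase (j + 0) (m * h) x

/-- The kernel with features `phaseFun`. -/
noncomputable def phaseKernel (α m j : ℕ) (x y : I) : ℝ :=
  ∑' h : ℕ+, phaseFun α m j h x * phaseFun α m j h y

lemma abs_phaseFun_le {α m : ℕ} (hα : 0 < α) (hm : 0 < m) (j : ℕ) (h : ℕ+) (x : I) :
    |phaseFun α m j h x| ≤ 2 * (1 / (h : ℝ)) := by
  unfold phaseFun
  have := freq_pos hm h
  rw [abs_mul, abs_of_nonneg (by positivity : 0 ≤ freq m h ^ 0 / freq m h ^ α), mul_comm]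
  exact mul_le_mul (abs_cosPhase_le _ _ _) (freq_pow_div_le hm hα h) (by positivity) zero_le_two

lemma summable_phaseFun_sq {α m : ℕ} (hα : 0 < α) (hm : 0 < m) (j : ℕ) (x : I) :
    Summable fun h => phaseFun α m j h x ^ 2 := by
  refine Summable.of_nonneg_of_le (fun h => sq_nonneg _) (fun h => ?_)
    (summable_pnat_one_div_sq.mul_left 4)
  rw [← sq_abs]
  have := pow_le_pow_left₀ (abs_nonneg _) (abs_phaseFun_le hα hm j h x) 2
  rwa [mul_pow, show (2 : ℝ) ^ 2 = 4 by norm_num] at this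

lemma summable_phaseFun_mul {α m : ℕ} (hα : 0 < α) (hm : 0 < m) (j : ℕ) (x y : I) :
    Summable fun h => phaseFun α m j h x * phaseFun α m j h y := by
  refine Summable.of_norm_bounded (summable_pnat_one_div_sq.mul_left 4) fun h => ?_
  rw [norm_mul, norm_eq_abs, norm_eq_abs]
  calc _ ≤ (2 * (1 / (h : ℝ))) * (2 * (1 / (h : ℝ))) := by
        gcongr <;> exact abs_phaseFun_le hα hm j h _
    _ = _ := by ring

lemma isPSD_phaseKernel {α m : ℕ} (hα : 0 < α) (hm : 0 < m) (j : ℕ) :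
    IsPSD (phaseKernel α m j) :=
  isPSD_tsum _ (summable_phaseFun_sq hα hm j)

lemma memRKHS_phaseKernel_iff {α m : ℕ} (hα : 0 < α) (hm : 0 < m) (j : ℕ) {f : I → ℝ} :
    MemRKHS (phaseKernel α m j) f ↔ ∃ v : ℕ+ → ℝ, (Summable fun h => v h ^ 2) ∧
      ∀ x : I, f x = phaseSeries α m j v 0 x := by
  have := memRKHS_tsum_iff _ (summable_phaseFun_sq hα hm j) (f := f)
  rw [show phaseKernel α m j = fun x y => ∑' h : ℕ+, phaseFun α m j h x * phaseFun α m j h y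
    from rfl, this]
  simp only [phaseSeries, phaseFun, mul_assoc]

lemma memRKHS_finset_sum_iff {X ι : Type} (s : Finset ι) (φ : ι → X → ℝ) {f : X → ℝ} :
    MemRKHS (fun x y => ∑ i ∈ s, φ i x * φ i y) f ↔
      ∃ c : ι → ℝ, ∀ x, f x = ∑ i ∈ s, c i * φ i x := by
  have h := memRKHS_tsum_iff (fun (i : s) x => φ i x) (fun x => (hasSum_fintype _).summable)
    (f := f)
  have e : (fun x y => ∑ i ∈ s, φ i x * φ i y) = fun x y => ∑ i : s, φ i x * φ i y := by
    funext x y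
    exact (Finset.sum_coe_sort s fun i => φ i x * φ i y).symm
  simp only [tsum_fintype] at h
  rw [e, h]
  constructor
  · rintro ⟨v, -, hv⟩
    classical
    refine ⟨fun i => if hi : i ∈ s then v ⟨i, hi⟩ else 0, fun x => ?_⟩
    rw [hv, ← Finset.sum_coe_sort s]
    exact Finset.sum_congr rfl fun i _ => by simp
  · rintro ⟨c, hc⟩
    refine ⟨fun i => c i, (hasSum_fintype _).summable, fun x => ?_⟩
    rw [hc, ← Finset.sum_coe_sort s]

lemma phaseFun_mul_phaseFun (α m j : ℕ) (h : ℕ+) (x y : I) :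
    phaseFun α m j h x * phaseFun α m j h y =
      1 / freq m h ^ (2 * α) * (cosPhase j (m * h) x * cosPhase j (m * h) y) := by
  unfold phaseFun
  rw [add_zero, pow_zero, two_mul, pow_add, ← one_div_mul_one_div]
  ring

lemma neg_one_add_cosKernel₁ (α : ℕ) (x y : I) :
    -1 + cosKernel₁ α x y = π ^ (2 * α) * phaseKernel α 1 0 x y := by
  unfold cosKernel₁ phaseKernel
  rw [neg_add_cancel_left, ← tsum_mul_left]
  refine tsum_congr fun k => ?_
  rw [phaseFun_mul_phaseFun]
  have h2 : √2 * √2 = 2 := mul_self_sqrt (by norm_num)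
  have hk : ((k : ℕ) : ℝ) ≠ 0 := by positivity
  have hpi := pi_ne_zero
  simp only [cosPhase, freq, one_mul, CharP.cast_eq_zero, zero_mul, add_zero, mul_pow]
  field_simp
  linear_combination (-(cos (π * k * x) * cos (π * k * y))) * h2

lemma two_mul_cos_eq (k : ℕ) (x y : ℝ) : 2 * cos (2 * π * k * (x - y)) =
    cosPhase 0 (2 * k) x * cosPhase 0 (2 * k) y + cosPhase 1 (2 * k) x * cosPhase 1 (2 * k) y := by
  have h2 : √2 * √2 = 2 := mul_self_sqrt (by norm_num)
  have h0 : ∀ x, cosPhase 0 (2 * k) x = √2 * cos (π * (2 * k : ℕ) * x) := by simp [cosPhase]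
  have h1 : ∀ x, cosPhase 1 (2 * k) x = -(√2 * sin (π * (2 * k : ℕ) * x)) := by
    simp [cosPhase, cos_add_pi_div_two]
  rw [h0, h0, h1, h1, show 2 * π * k * (x - y) = π * (2 * k : ℕ) * x - π * (2 * k : ℕ) * y by
    push_cast; ring, cos_sub]
  linear_combination (-(cos (π * (2 * k : ℕ) * x) * cos (π * (2 * k : ℕ) * y) +
    sin (π * (2 * k : ℕ) * x) * sin (π * (2 * k : ℕ) * y))) * h2

lemma phaseKernel_two_add {α : ℕ} (hα : 0 < α) (x y : I) :
    phaseKernel α 2 0 x y + phaseKernel α 2 1 x y =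
      ∑' k : ℕ+, 1 / (2 * π * (k : ℝ)) ^ (2 * α) * (2 * cos (2 * π * (k : ℕ) * ((x : ℝ) - y))) := by
  unfold phaseKernel
  rw [← Summable.tsum_add (summable_phaseFun_mul hα two_pos _ _ _)
    (summable_phaseFun_mul hα two_pos _ _ _)]
  refine tsum_congr fun k => ?_
  rw [phaseFun_mul_phaseFun, phaseFun_mul_phaseFun, two_mul_cos_eq, freq]
  push_cast
  ring

lemma neg_one_add_korKernel₁ {α : ℕ} (hα : 0 < α) (x y : I) :
    -1 + korKernel₁ α x y =
      (2 * π) ^ (2 * α) * (phaseKernel α 2 0 x y + phaseKernel α 2 1 x y) := by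
  have hs : Summable fun n : ℕ => 1 / (n : ℝ) ^ (2 * α) := summable_one_div_nat_pow.2 (by omega)
  have key : ∀ h : ℤ, |(if h = 0 then (1 : ℝ) else 1 / |(h : ℝ)| ^ (2 * α)) *
      cos (2 * π * h * ((x : ℝ) - y))| ≤ if h = 0 then (1 : ℝ) else 1 / |(h : ℝ)| ^ (2 * α) :=
    fun h => by
    have h0 : 0 ≤ if h = 0 then (1 : ℝ) else 1 / |(h : ℝ)| ^ (2 * α) := by
      split_ifs <;> positivity
    rw [abs_mul, abs_of_nonneg h0]
    exact mul_le_of_le_one_right h0 (abs_cos_le_one _)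
  have hsn : Summable fun n : ℕ => if n = 0 then (1 : ℝ) else 1 / (n : ℝ) ^ (2 * α) := by
    rw [← summable_nat_add_iff 1] at hs ⊢
    exact hs.congr fun n => by simp
  have hsum : Summable fun h : ℤ => (if h = 0 then (1 : ℝ) else 1 / |(h : ℝ)| ^ (2 * α)) *
      cos (2 * π * h * ((x : ℝ) - y)) := by
    refine Summable.of_norm_bounded (g := fun h : ℤ =>
      if h = 0 then (1 : ℝ) else 1 / |(h : ℝ)| ^ (2 * α)) ?_ key
    refine Summable.of_nat_of_neg ?_ ?_
    · exact hsn.congr fun n => by simp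
    · exact hsn.congr fun n => by simp
  unfold korKernel₁
  rw [tsum_int_eq_zero_add_tsum_pnat hsum, phaseKernel_two_add hα, ← tsum_mul_left]
  have h1 : ∀ k : ℕ+, (if ((k : ℕ) : ℤ) = 0 then (1 : ℝ) else 1 / |(((k : ℕ) : ℤ) : ℝ)| ^ (2 * α)) *
      cos (2 * π * (((k : ℕ) : ℤ) : ℝ) * ((x : ℝ) - y)) =
      1 / (k : ℝ) ^ (2 * α) * cos (2 * π * (k : ℕ) * ((x : ℝ) - y)) := fun k => by simp
  have h2 : ∀ k : ℕ+, (if -((k : ℕ) : ℤ) = 0 then (1 : ℝ) else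
      1 / |((-((k : ℕ) : ℤ) : ℤ) : ℝ)| ^ (2 * α)) *
      cos (2 * π * ((-((k : ℕ) : ℤ) : ℤ) : ℝ) * ((x : ℝ) - y)) =
      1 / (k : ℝ) ^ (2 * α) * cos (2 * π * (k : ℕ) * ((x : ℝ) - y)) := fun k => by
    rw [← cos_neg]
    simp
  simp only [h1, h2]
  have h3 : ∀ k : ℕ+, (2 * π) ^ (2 * α) * (1 / (2 * π * (k : ℝ)) ^ (2 * α) *
      (2 * cos (2 * π * (k : ℕ) * ((x : ℝ) - y)))) =
      2 * (1 / (k : ℝ) ^ (2 * α) * cos (2 * π * (k : ℕ) * ((x : ℝ) - y))) := fun k => by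
    rw [mul_pow (2 * π)]
    have := pi_ne_zero
    field_simp
  simp only [h3, tsum_mul_left]
  simp
  ring

/-- The term with `B_{2α}(|x - y|)` is replaced by its Fourier series, which is the Korobov sum up
to the factor `(2π)^{-2α}`. The Sobolev space thus differs from the Korobov space by the span of
finitely many Bernoulli polynomials. -/
lemma neg_one_add_sobKernel₁ {α : ℕ} (hα : 0 < α) (x y : I) :
    -1 + sobKernel₁ α x y =
      (∑ n ∈ Finset.Icc 1 α, bernoulliTower n 0 x * bernoulliTower n 0 y) +
        (phaseKernel α 2 0 x y + phaseKernel α 2 1 x y) := by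
  have hxy : |(x : ℝ) - y| ∈ Icc (0 : ℝ) 1 :=
    ⟨abs_nonneg _, abs_le.2 ⟨by linarith [x.2.1, y.2.2], by linarith [x.2.2, y.2.1]⟩⟩
  have h1 := hasSum_one_div_nat_pow_mul_cos hα.ne' hxy
  have h2 : ∀ n : ℕ, cos (2 * π * n * |(x : ℝ) - y|) = cos (2 * π * n * ((x : ℝ) - y)) := by
    intro n
    rcases abs_choice ((x : ℝ) - y) with h | h <;> rw [h]
    rw [mul_neg, cos_neg]
  simp only [h2] at h1
  have h3 : ∑' k : ℕ+, 1 / (k : ℝ) ^ (2 * α) * cos (2 * π * (k : ℕ) * ((x : ℝ) - y)) =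
      (-1 : ℝ) ^ (α + 1) * (2 * π) ^ (2 * α) / 2 / (2 * α).factorial *
        bernoulliFun (2 * α) |(x : ℝ) - y| := by
    have := tsum_zero_pnat_eq_tsum_nat h1.summable
    rw [h1.tsum_eq] at this
    rw [bernoulliFun, ← this]
    simp [hα.ne']
  have h4 : ∀ k : ℕ+, 1 / (2 * π * (k : ℝ)) ^ (2 * α) *
      (2 * cos (2 * π * (k : ℕ) * ((x : ℝ) - y))) = 2 / (2 * π) ^ (2 * α) *
      (1 / (k : ℝ) ^ (2 * α) * cos (2 * π * (k : ℕ) * ((x : ℝ) - y))) := fun k => by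
    rw [mul_pow (2 * π)]
    have := pi_ne_zero
    field_simp
  have h5 : ∀ n ∈ Finset.Icc 1 α, bernoulliTower n 0 x * bernoulliTower n 0 y =
      bernoulliFun n x * bernoulliFun n y / (n.factorial : ℝ) ^ 2 := fun n _ => by
    simp only [bernoulliTower, Nat.zero_le, if_true, Nat.sub_zero]
    ring
  rw [Finset.sum_congr rfl h5, phaseKernel_two_add hα]
  simp only [h4, tsum_mul_left]
  rw [h3, sobKernel₁]
  have hpi : (2 * π) ^ (2 * α) ≠ 0 := by positivity
  field_simp
  ring

/-! ### Membership in the univariate spaces, by series and by boundary conditions. -/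

section

variable {α : ℕ} (hα : 0 < α)
include hα

lemma isPSD_cos : IsPSD fun x y => -1 + cosKernel₁ α x y := by
  simp only [neg_one_add_cosKernel₁]
  exact (isPSD_phaseKernel hα one_pos 0).const_mul (by positivity)

lemma isPSD_phase_two : IsPSD fun x y => phaseKernel α 2 0 x y + phaseKernel α 2 1 x y :=
  (isPSD_phaseKernel hα two_pos 0).add (isPSD_phaseKernel hα two_pos 1)

lemma isPSD_kor : IsPSD fun x y => -1 + korKernel₁ α x y := by
  simp only [neg_one_add_korKernel₁ hα]
  exact (isPSD_phase_two hα).const_mul (by positivity)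

omit hα in
lemma neg_one_add_korCosKernel₁ (x y : I) : -1 + korCosKernel₁ α x y =
    1 / 2 * ((-1 + korKernel₁ α x y) + (-1 + cosKernel₁ α x y)) := by
  unfold korCosKernel₁
  ring

lemma isPSD_korCos : IsPSD fun x y => -1 + korCosKernel₁ α x y := by
  simp only [neg_one_add_korCosKernel₁]
  exact ((isPSD_kor hα).add (isPSD_cos hα)).const_mul (by positivity)

omit hα in
lemma isPSD_bernoulli : IsPSD fun x y : I =>
    ∑ n ∈ Finset.Icc 1 α, bernoulliTower n 0 x * bernoulliTower n 0 y :=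
  IsPSD.sum _ fun n _ => isPSD_mul_self fun x : I => bernoulliTower n 0 x

lemma isPSD_sob : IsPSD fun x y => -1 + sobKernel₁ α x y := by
  simp only [neg_one_add_sobKernel₁ hα]
  exact (isPSD_bernoulli).add (isPSD_phase_two hα)

lemma memRKHS_cos_iff {f : I → ℝ} : MemRKHS (fun x y => -1 + cosKernel₁ α x y) f ↔
    ∃ v : ℕ+ → ℝ, (Summable fun h => v h ^ 2) ∧ ∀ x : I, f x = phaseSeries α 1 0 v 0 x := by
  simp only [neg_one_add_cosKernel₁]
  rw [memRKHS_const_mul_iff (isPSD_phaseKernel hα one_pos 0) (by positivity),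
    memRKHS_phaseKernel_iff hα one_pos]

lemma memRKHS_phase_two_iff {f : I → ℝ} :
    MemRKHS (fun x y => phaseKernel α 2 0 x y + phaseKernel α 2 1 x y) f ↔
    ∃ v w : ℕ+ → ℝ, (Summable fun h => v h ^ 2) ∧ (Summable fun h => w h ^ 2) ∧
      ∀ x : I, f x = phaseSeries α 2 0 v 0 x + phaseSeries α 2 1 w 0 x := by
  rw [memRKHS_add_iff (isPSD_phaseKernel hα two_pos 0) (isPSD_phaseKernel hα two_pos 1)]
  simp only [memRKHS_phaseKernel_iff hα two_pos]
  constructor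
  · rintro ⟨g, h, ⟨v, hv, hg⟩, ⟨w, hw, hh⟩, hf⟩
    exact ⟨v, w, hv, hw, fun x => by rw [hf, hg, hh]⟩
  · rintro ⟨v, w, hv, hw, hf⟩
    exact ⟨_, _, ⟨v, hv, fun x => rfl⟩, ⟨w, hw, fun x => rfl⟩, hf⟩

lemma memRKHS_kor_iff {f : I → ℝ} : MemRKHS (fun x y => -1 + korKernel₁ α x y) f ↔
    ∃ v w : ℕ+ → ℝ, (Summable fun h => v h ^ 2) ∧ (Summable fun h => w h ^ 2) ∧
      ∀ x : I, f x = phaseSeries α 2 0 v 0 x + phaseSeries α 2 1 w 0 x := by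
  simp only [neg_one_add_korKernel₁ hα]
  rw [memRKHS_const_mul_iff (isPSD_phase_two hα) (by positivity), memRKHS_phase_two_iff hα]

lemma memRKHS_korCos_iff {f : I → ℝ} : MemRKHS (fun x y => -1 + korCosKernel₁ α x y) f ↔
    ∃ g h, MemRKHS (fun x y => -1 + korKernel₁ α x y) g ∧
      MemRKHS (fun x y => -1 + cosKernel₁ α x y) h ∧ ∀ x, f x = g x + h x := by
  simp only [neg_one_add_korCosKernel₁]
  rw [memRKHS_const_mul_iff ((isPSD_kor hα).add (isPSD_cos hα)) (by norm_num),
    memRKHS_add_iff (isPSD_kor hα) (isPSD_cos hα)]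

lemma memRKHS_sob_iff {f : I → ℝ} : MemRKHS (fun x y => -1 + sobKernel₁ α x y) f ↔
    ∃ (c : ℕ → ℝ) (v w : ℕ+ → ℝ), (Summable fun h => v h ^ 2) ∧ (Summable fun h => w h ^ 2) ∧
      ∀ x : I, f x = (∑ n ∈ Finset.Icc 1 α, c n * bernoulliTower n 0 x) +
        phaseSeries α 2 0 v 0 x + phaseSeries α 2 1 w 0 x := by
  simp only [neg_one_add_sobKernel₁ hα]
  rw [memRKHS_add_iff (isPSD_bernoulli) (isPSD_phase_two hα)]
  simp only [memRKHS_phase_two_iff hα,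
    memRKHS_finset_sum_iff (Finset.Icc 1 α) fun n (x : I) => bernoulliTower n 0 x]
  constructor
  · rintro ⟨g, h, ⟨c, hc⟩, ⟨v, w, hv, hw, hh⟩, hf⟩
    exact ⟨c, v, w, hv, hw, fun x => by rw [hf, hc, hh, add_assoc]⟩
  · rintro ⟨c, v, w, hv, hw, hf⟩
    exact ⟨_, _, ⟨c, fun x => rfl⟩, ⟨v, w, hv, hw, fun x => rfl⟩, fun x => by
      rw [hf, add_assoc]⟩

/-- `ℓ²` series of periodic trigonometric functions are periodic Sobolev functions. -/
lemma exists_isSobolevTower_phase_two {v w : ℕ+ → ℝ} (hv : Summable fun h => v h ^ 2)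
    (hw : Summable fun h => w h ^ 2) : ∃ F, IsSobolevTower α F ∧ (∀ τ < α, F τ 0 = F τ 1) ∧
      (∀ x, F 0 x = phaseSeries α 2 0 v 0 x + phaseSeries α 2 1 w 0 x) ∧
      ∫ x in (0 : ℝ)..1, F 0 x = 0 := by
  obtain ⟨F, hF, hFv⟩ := exists_isSobolevTower_phaseSeries (α := α) 0 two_pos hv
  obtain ⟨G, hG, hGw⟩ := exists_isSobolevTower_phaseSeries (α := α) 1 two_pos hw
  refine ⟨_, hF.add hG, fun τ hτ => ?_, fun x => ?_, ?_⟩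
  · simp only [hFv τ hτ, hGw τ hτ]
    rw [phaseSeries_zero_eq_one _ even_two, phaseSeries_zero_eq_one _ even_two]
  · simp only [hFv 0 hα, hGw 0 hα]
  · simp only [hFv 0 hα, hGw 0 hα]
    rw [intervalIntegral.integral_add
      ((continuous_phaseSeries _ two_pos hv hα).intervalIntegrable _ _)
      ((continuous_phaseSeries _ two_pos hw hα).intervalIntegrable _ _),
      integral_phaseSeries_eq_zero _ hα two_pos hv (Or.inr even_two),
      integral_phaseSeries_eq_zero _ hα two_pos hw (Or.inr even_two), add_zero]

/-- All features, Bernoulli polynomials of positive degree and trigonometric functions, have mean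
zero. Conversely, the expansion of a Sobolev function contains no other constant than its mean. -/
lemma memRKHS_sob_iff_tower {f : I → ℝ} : MemRKHS (fun x y => -1 + sobKernel₁ α x y) f ↔
    ∃ F, IsSobolevTower α F ∧ (∀ x : I, f x = F 0 x) ∧ ∫ x in (0 : ℝ)..1, F 0 x = 0 := by
  rw [memRKHS_sob_iff hα]
  constructor
  · rintro ⟨c, v, w, hv, hw, hf⟩
    obtain ⟨F, hF, -, hF0, hFi⟩ := exists_isSobolevTower_phase_two hα hv hw
    have hP : IsSobolevTower α fun τ x => ∑ n ∈ Finset.Icc 1 α, c n * bernoulliTower n τ x :=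
      IsSobolevTower.finset_sum _ fun n _ => (isSobolevTower_bernoulliTower α n).const_mul (c n)
    refine ⟨_, hP.add hF, fun x => by rw [hf, hF0, add_assoc], ?_⟩
    rw [intervalIntegral.integral_add (hP.intervalIntegrable hα.le)
      (hF.intervalIntegrable hα.le), hFi, add_zero,
      intervalIntegral.integral_finsetSum fun n _ =>
        ((isSobolevTower_bernoulliTower α n).intervalIntegrable hα.le).const_mul _]
    refine Finset.sum_eq_zero fun n hn => ?_
    rw [intervalIntegral.integral_const_mul, integral_bernoulliTower, mul_zero]
    have := (Finset.mem_Icc.1 hn).1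
    omega
  · rintro ⟨F, hF, hf, hi⟩
    obtain ⟨c, v, w, hv, hw, h⟩ := hF.exists_expansion hα
    refine ⟨c, v, w, hv, hw, fun x => ?_⟩
    rw [hf, h x x.2, hi, zero_add]

lemma memRKHS_cos_iff_tower {f : I → ℝ} : MemRKHS (fun x y => -1 + cosKernel₁ α x y) f ↔
    ∃ F, IsSobolevTower α F ∧ (∀ x : I, f x = F 0 x) ∧ (∫ x in (0 : ℝ)..1, F 0 x = 0) ∧
      ∀ τ < α, Odd τ → F τ 0 = 0 ∧ F τ 1 = 0 := by
  rw [memRKHS_cos_iff hα]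
  constructor
  · rintro ⟨v, hv, hf⟩
    obtain ⟨F, hF, hFv⟩ := exists_isSobolevTower_phaseSeries (α := α) 0 one_pos hv
    refine ⟨F, hF, fun x => by rw [hf, hFv 0 hα], ?_, fun τ hτ ho => ?_⟩
    · rw [hFv 0 hα, integral_phaseSeries_eq_zero _ hα one_pos hv (Or.inl (by simp))]
    · rw [hFv τ hτ, phaseSeries_odd_zero _ (by simpa), phaseSeries_odd_one _ (by simpa)]
      simp
  · rintro ⟨F, hF, hf, hi, h0⟩
    obtain ⟨v, hv, h⟩ := hF.exists_cosSeries hα h0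
    exact ⟨v, hv, fun x => by rw [hf, h x x.2, hi, zero_add]⟩

/-- The half-period cosine space consists of the Sobolev functions with vanishing odd
derivatives at the end points. -/
lemma memRKHS_cos_iff_oddVanishing {f : I → ℝ} :
    MemRKHS (fun x y => -1 + cosKernel₁ α x y) f ↔
      MemRKHS (fun x y => -1 + sobKernel₁ α x y) f ∧ OddVanishing α f := by
  rw [memRKHS_cos_iff_tower hα, memRKHS_sob_iff_tower hα]
  constructor
  · rintro ⟨F, hF, hf, hi, h0⟩
    refine ⟨⟨F, hF, hf, hi⟩, fun τ ho hτ => ?_⟩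
    rw [hF.derivI_eq hf hτ, hF.derivI_eq hf hτ]
    exact h0 τ hτ ho
  · rintro ⟨⟨F, hF, hf, hi⟩, hP⟩
    refine ⟨F, hF, hf, hi, fun τ hτ ho => ?_⟩
    have := hP τ ho hτ
    rwa [hF.derivI_eq hf hτ, hF.derivI_eq hf hτ] at this

lemma memRKHS_sob_of_kor {f : I → ℝ} (hf : MemRKHS (fun x y => -1 + korKernel₁ α x y) f) :
    MemRKHS (fun x y => -1 + sobKernel₁ α x y) f ∧ OddPeriodic α f := by
  rw [memRKHS_kor_iff hα] at hf
  obtain ⟨v, w, hv, hw, hf⟩ := hf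
  obtain ⟨F, hF, hp, hF0, hi⟩ := exists_isSobolevTower_phase_two hα hv hw
  have hf' : ∀ x : I, f x = F 0 x := fun x => by rw [hf, hF0]
  refine ⟨(memRKHS_sob_iff_tower hα).2 ⟨F, hF, hf', hi⟩, fun τ _ hτ => ?_⟩
  rw [hF.derivI_eq hf' hτ, hF.derivI_eq hf' hτ]
  exact hp τ hτ

lemma memRKHS_kor_sin (h : ℕ+) :
    MemRKHS (fun x y => -1 + korKernel₁ α x y) fun x => cosPhase 1 (2 * h) x := by
  rw [memRKHS_kor_iff hα]
  refine ⟨0, Pi.single h (freq 2 h ^ α), by simp, ?_, fun x => ?_⟩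
  · refine summable_of_ne_finset_zero (s := {h}) fun b hb => ?_
    rw [Pi.single_eq_of_ne (by simpa using hb)]
    simp
  · unfold phaseSeries
    rw [tsum_eq_single (f := fun k : ℕ+ => (Pi.single h (freq 2 h ^ α) : ℕ+ → ℝ) k *
      (freq 2 k ^ 0 / freq 2 k ^ α) * cosPhase (1 + 0) (2 * k) x) h fun b hb => by
        simp [Pi.single_eq_of_ne hb]]
    have := freq_pos two_pos h
    rw [Pi.single_eq_same]
    simp only [Pi.zero_apply, zero_mul, tsum_zero, zero_add, pow_zero, add_zero]
    field_simp

omit hα in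
/-- Interpolation of odd derivatives at `0` by sine polynomials. -/
lemma exists_sinPolynomial (J : ℕ) (t : ℕ → ℝ) : ∃ u : Fin J → ℝ, ∀ i < J,
    ∑ l, u l * ((π * (2 * (l + 1) : ℕ)) ^ (2 * i + 1) *
      cosPhase (1 + (2 * i + 1)) (2 * (l + 1)) 0) = t i := by
  -- With frequencies `ω_l = 2π(l + 1)`, the system for `u_l` has matrix `ω_l^(2i+1)` up to the
  -- factor `√2 (-1)^(i+1)`. Putting `u_l = y_l / ω_l` makes it a Vandermonde system in the distinct
  -- squares `ω_l²`.
  set x : Fin J → ℝ := fun l => (π * (2 * (l + 1) : ℕ)) ^ 2 with hx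
  have hinj : Function.Injective x := by
    intro a b hab
    have h1 : π * (2 * (a + 1) : ℕ) = π * (2 * (b + 1) : ℕ) :=
      (pow_left_inj₀ (by positivity) (by positivity) two_ne_zero).1 hab
    have h2 := mul_left_cancel₀ pi_ne_zero h1
    have h3 : 2 * ((a : ℕ) + 1) = 2 * (b + 1) := by exact_mod_cast h2
    exact Fin.ext (by omega)
  have hdet : IsUnit (Matrix.vandermonde x).det :=
    (Matrix.det_vandermonde_ne_zero_iff.2 hinj).isUnit
  set r : Fin J → ℝ := fun i => (-1) ^ ((i : ℕ) + 1) * t i / √2 with hr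
  set y : Fin J → ℝ := Matrix.vecMul r (Matrix.vandermonde x)⁻¹ with hy
  have hy' : Matrix.vecMul y (Matrix.vandermonde x) = r := by
    rw [hy, Matrix.vecMul_vecMul, Matrix.nonsing_inv_mul _ hdet, Matrix.vecMul_one]
  refine ⟨fun l => y l / (π * (2 * (l + 1) : ℕ)), fun i hi => ?_⟩
  have hi' := congrFun hy' ⟨i, hi⟩
  simp only [Matrix.vecMul, dotProduct, Matrix.vandermonde_apply, hr, hx] at hi'
  have hcos : ∀ k : ℕ, cosPhase (1 + (2 * i + 1)) k 0 = √2 * (-1) ^ (i + 1) := fun k => by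
    unfold cosPhase
    rw [show π * k * 0 + ((1 + (2 * i + 1) : ℕ) : ℝ) * (π / 2) = ((i + 1 : ℕ) : ℝ) * π by
      push_cast; ring, cos_nat_mul_pi]
  have hterm : ∀ l : Fin J, y l / (π * (2 * (l + 1) : ℕ)) *
      ((π * (2 * (l + 1) : ℕ)) ^ (2 * i + 1) * cosPhase (1 + (2 * i + 1)) (2 * (l + 1)) 0) =
      (√2 * (-1) ^ (i + 1)) * (y l * ((π * (2 * (l + 1) : ℕ)) ^ 2) ^ i) := fun l => by
    have : π * ((2 * (l + 1) : ℕ) : ℝ) ≠ 0 := by positivity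
    rw [hcos, pow_succ, pow_mul]
    generalize π * ((2 * (l + 1) : ℕ) : ℝ) = z at *
    field_simp
  rw [Finset.sum_congr rfl fun l _ => hterm l, ← Finset.mul_sum, hi']
  have h2 : √2 ≠ 0 := (sqrt_pos.2 (by norm_num)).ne'
  have h3 : ((-1 : ℝ) ^ (i + 1)) * (-1) ^ (i + 1) = 1 := by
    rw [← mul_pow]
    simp
  field_simp
  linear_combination t i * h3

omit hα in
lemma MemRKHS.zero {X : Type} {K : X → X → ℝ} (hK : IsPSD K) : MemRKHS K fun _ => 0 := by
  obtain ⟨H, _, _, _, Φ, rfl⟩ := exists_inner_eq hK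
  exact (memRKHS_inner Φ).2 ⟨0, fun x => by simp⟩

omit hα in
lemma MemRKHS.finset_sum {X ι : Type} {K : X → X → ℝ} (hK : IsPSD K) (s : Finset ι)
    {f : ι → X → ℝ} (hf : ∀ i ∈ s, MemRKHS K (f i)) : MemRKHS K fun x => ∑ i ∈ s, f i x := by
  classical
  induction s using Finset.induction_on with
  | empty => simpa using MemRKHS.zero hK
  | insert i s hi ih =>
    simp only [Finset.sum_insert hi]
    exact (hf i (by simp)).add hK (ih fun j hj => hf j (by simp [hj]))

/-- The sum of the Korobov and the half-period cosine space consists of the Sobolev functions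
with periodic odd derivatives. -/
lemma memRKHS_korCos_iff_oddPeriodic {f : I → ℝ} :
    MemRKHS (fun x y => -1 + korCosKernel₁ α x y) f ↔
      MemRKHS (fun x y => -1 + sobKernel₁ α x y) f ∧ OddPeriodic α f := by
  rw [memRKHS_korCos_iff hα]
  constructor
  · rintro ⟨g, h, hg, hh, hf⟩
    obtain ⟨hgs, hgp⟩ := memRKHS_sob_of_kor hα hg
    obtain ⟨hhs, hhp⟩ := (memRKHS_cos_iff_oddVanishing hα).1 hh
    refine ⟨by rw [show f = fun x => g x + h x from funext hf]; exact hgs.add (isPSD_sob hα) hhs,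
      fun τ ho hτ => ?_⟩
    obtain ⟨F, hF, hgF, -⟩ := (memRKHS_sob_iff_tower hα).1 hgs
    obtain ⟨G, hG, hhG, -⟩ := (memRKHS_sob_iff_tower hα).1 hhs
    have hfFG : ∀ x : I, f x = F 0 x + G 0 x := fun x => by rw [hf, hgF, hhG]
    rw [(hF.add hG).derivI_eq hfFG hτ, (hF.add hG).derivI_eq hfFG hτ]
    have h1 := hgp τ ho hτ
    have h2 := hhp τ ho hτ
    rw [hF.derivI_eq hgF hτ, hF.derivI_eq hgF hτ] at h1
    rw [hG.derivI_eq hhG hτ, hG.derivI_eq hhG hτ] at h2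
    rw [h1, h2.1, h2.2]
  · rintro ⟨hfs, hfp⟩
    obtain ⟨F, hF, hfF, hi⟩ := (memRKHS_sob_iff_tower hα).1 hfs
    -- Match the odd derivatives of `F` at `0`; `α` sines are more than enough. Since the polynomial
    -- is 1-periodic and those of `F` are periodic, they match at `1` too, so the difference lies in
    -- the cosine space.
    obtain ⟨u, hu⟩ := exists_sinPolynomial α fun i => F (2 * i + 1) 0
    set G : ℕ → ℝ → ℝ := fun τ x => ∑ l, u l * ((π * (2 * ((l : ℕ) + 1) : ℕ)) ^ τ *
      cosPhase (1 + τ) (2 * (l + 1)) x) with hGdef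
    have hG : IsSobolevTower α G := by
      refine IsSobolevTower.finset_sum _ fun l _ => IsSobolevTower.const_mul ?_ _
      refine IsSobolevTower.of_hasDerivAt fun τ x => ?_
      refine ((hasDerivAt_cosPhase (1 + τ) (2 * (l + 1)) x).const_mul _).congr_deriv ?_
      rw [pow_succ, ← add_assoc]
      ring
    have hGp : ∀ τ, G τ 0 = G τ 1 := fun τ => by
      simp only [hGdef, cosPhase_even_one _ (even_two_mul _)]
    have hG0 : ∀ i, 2 * i + 1 < α → G (2 * i + 1) 0 = F (2 * i + 1) 0 := fun i hi =>
      hu i (by omega)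
    have hGi : ∫ x in (0 : ℝ)..1, G 0 x = 0 := by
      simp only [hGdef]
      rw [intervalIntegral.integral_finsetSum fun l _ => Continuous.intervalIntegrable
        (by have := continuous_cosPhase; fun_prop) _ _]
      refine Finset.sum_eq_zero fun l _ => ?_
      rw [intervalIntegral.integral_const_mul, intervalIntegral.integral_const_mul,
        integral_cosPhase_eq_zero _ (by omega) (Or.inr (even_two_mul _))]
      simp
    have hD := hF.add (hG.const_mul (-1))
    refine ⟨fun x => G 0 x, fun x => f x - G 0 x, ?_, ?_, fun x => by ring⟩
    · simp only [hGdef, pow_zero, one_mul, add_zero]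
      refine MemRKHS.finset_sum (isPSD_kor hα) _ fun l _ => ?_
      exact (memRKHS_kor_sin hα ⟨l + 1, by omega⟩).const_mul (isPSD_kor hα) _
    · rw [memRKHS_cos_iff_tower hα]
      refine ⟨_, hD, fun x => by rw [hfF]; ring, ?_, fun τ hτ ho => ?_⟩
      · rw [intervalIntegral.integral_add (hF.intervalIntegrable hα.le)
          ((hG.intervalIntegrable hα.le).const_mul _), intervalIntegral.integral_const_mul, hi,
          hGi]
        simp
      · obtain ⟨i, rfl⟩ := ho
        have h1 := hfp _ ⟨i, rfl⟩ hτ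
        rw [hF.derivI_eq hfF hτ, hF.derivI_eq hfF hτ] at h1
        have h2 := hG0 i hτ
        have h3 := hGp (2 * i + 1)
        have h4 : F (2 * i + 1) 0 = F (2 * i + 1) 1 := h1
        constructor <;> linarith

end

end UnivariateKernels

/-! ### Subspaces given by conditions on derivatives at the end points -/

section Conditions

open Set Filter Topology
open scoped InnerProductSpace

/-- `a f^{(τ)}(0) + b f^{(τ)}(1) = 0` for all `(τ, a, b)` in `T`. -/
def DerivCondition (T : Set (ℕ × ℝ × ℝ)) (f : I → ℝ) : Prop :=
  ∀ i ∈ T, i.2.1 * derivI i.1 f 0 + i.2.2 * derivI i.1 f 1 = 0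

/-- `P` is a family of linear conditions on the odd derivatives of order less than `α` at the end
points. -/
def IsOddCondition (α : ℕ) (P : (I → ℝ) → Prop) : Prop :=
  ∃ T, (∀ i ∈ T, Odd i.1 ∧ i.1 < α) ∧ P = DerivCondition T

lemma isOddCondition_periodic {α : ℕ} {p : ℕ → Prop} (hp : ∀ τ, p τ → τ < α) :
    IsOddCondition α fun f => ∀ τ, Odd τ → p τ → derivI τ f 0 = derivI τ f 1 := by
  refine ⟨{i | (Odd i.1 ∧ p i.1) ∧ i.2 = (1, -1)}, fun i hi => ⟨hi.1.1, hp _ hi.1.2⟩, ?_⟩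
  funext f
  refine propext ⟨fun h i hi => ?_, fun h τ ho hτ => ?_⟩
  · rw [hi.2, h _ hi.1.1 hi.1.2]
    ring
  · have := h (τ, 1, -1) ⟨⟨ho, hτ⟩, rfl⟩
    simp only at this
    linarith

lemma isOddCondition_oddPeriodic (α : ℕ) : IsOddCondition α (OddPeriodic α) :=
  isOddCondition_periodic fun _ h => h

lemma isOddCondition_oddPeriodicLower (α : ℕ) : IsOddCondition α (OddPeriodicLower α) :=
  isOddCondition_periodic fun τ (h : τ + 2 ≤ α) => by omega

lemma isOddCondition_oddVanishing (α : ℕ) : IsOddCondition α (OddVanishing α) := by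
  refine ⟨{i | Odd i.1 ∧ i.1 + 1 ≤ α}, fun i hi => hi, ?_⟩
  funext f
  refine propext ⟨fun h i hi => ?_, fun h τ ho hτ => ⟨?_, ?_⟩⟩
  · rw [(h _ hi.1 hi.2).1, (h _ hi.1 hi.2).2]
    ring
  · simpa using h (τ, 1, 0) ⟨ho, hτ⟩
  · simpa using h (τ, 0, 1) ⟨ho, hτ⟩

section Functionals

variable {α : ℕ} {H : Type} [NormedAddCommGroup H] [InnerProductSpace ℝ H] [CompleteSpace H]
  {Φ : I → H} (hα : 0 < α) (hΦ : (fun x y => -1 + sobKernel₁ α x y) = fun x y => ⟪Φ x, Φ y⟫_ℝ)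
include hα hΦ

lemma exists_tower_inner (v : H) :
    ∃ F, IsSobolevTower α F ∧ ∀ x : I, ⟪v, Φ x⟫_ℝ = F 0 x := by
  have h : MemRKHS (fun x y => -1 + sobKernel₁ α x y) fun x => ⟪v, Φ x⟫_ℝ := by
    rw [hΦ, memRKHS_inner]
    exact ⟨v, fun _ => rfl⟩
  obtain ⟨F, hF, hf, -⟩ := (memRKHS_sob_iff_tower hα).1 h
  exact ⟨F, hF, hf⟩

lemma derivI_const_add_inner {τ : ℕ} (h0 : τ ≠ 0) (hτ : τ < α) (a : ℝ) (v : H) (t : I) :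
    derivI τ (fun x => a + ⟪v, Φ x⟫_ℝ) t = derivI τ (fun x => ⟪v, Φ x⟫_ℝ) t := by
  obtain ⟨F, hF, hf⟩ := exists_tower_inner hα hΦ v
  have hA : IsSobolevTower α fun τ _ => if τ = 0 then a else 0 :=
    IsSobolevTower.of_hasDerivAt fun τ x => by simpa using hasDerivAt_const x _
  rw [hF.derivI_eq hf hτ, (hA.add hF).derivI_eq (fun x => by simp [hf]) hτ]
  simp [h0]

/-- Derivatives of order less than `α` are continuous functionals. -/
lemma exists_clm_derivI {τ : ℕ} (hτ : τ < α) (t : I) :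
    ∃ L : H →L[ℝ] ℝ, ∀ v, L v = derivI τ (fun x => ⟪v, Φ x⟫_ℝ) t := by
  induction τ generalizing t with
  | zero =>
    refine ⟨innerSL ℝ (Φ t), fun v => ?_⟩
    obtain ⟨F, hF, hf⟩ := exists_tower_inner hα hΦ v
    rw [hF.derivI_eq hf hτ, ← hf, innerSL_apply_apply, real_inner_comm]
  | succ τ ih =>
    choose L hL using ih (by omega)
    -- The limit of difference quotients needs a nontrivial filter: no point of `[0,1]` is isolated.
    have : (𝓝[Icc (0 : ℝ) 1 \ {(t : ℝ)}] (t : ℝ)).NeBot :=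
      accPt_principal_iff_nhdsWithin.1 (uniqueDiffOn_Icc (zero_lt_one' ℝ) _ t.2).accPt
    -- Difference quotients of the functionals of order `τ`. `projIcc` only makes them defined for
    -- all real `x`.
    let g : ℝ → H →L[ℝ] ℝ := fun x => (x - t)⁻¹ • (L (projIcc 0 1 zero_le_one x) - L t)
    have hg : Tendsto (fun x v => g x v) (𝓝[Icc (0 : ℝ) 1 \ {(t : ℝ)}] (t : ℝ))
        (𝓝 fun v => derivI (τ + 1) (fun x => ⟪v, Φ x⟫_ℝ) t) := by
      refine tendsto_pi_nhds.2 fun v => ?_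
      obtain ⟨F, hF, hf⟩ := exists_tower_inner hα hΦ v
      rw [hF.derivI_eq hf hτ]
      refine ((hasDerivWithinAt_iff_tendsto_slope.1
        (hF.hasDerivWithinAt hτ t.2))).congr' ?_
      filter_upwards [self_mem_nhdsWithin] with x hx
      simp only [g, slope, vsub_eq_sub, smul_apply, sub_apply, hL,
        hF.derivI_eq hf (show τ < α by omega),
        projIcc_of_mem _ hx.1]
    -- Banach–Steinhaus: a pointwise limit of continuous functionals on a Banach space is
    -- continuous.
    exact ⟨continuousLinearMapOfTendsto _ hg, fun v => rfl⟩

lemma IsOddCondition.exists_submodule {P : (I → ℝ) → Prop} (hP : IsOddCondition α P) :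
    ∃ W : Submodule ℝ H, IsClosed (W : Set H) ∧ ∀ a v, P (fun x => a + ⟪v, Φ x⟫_ℝ) ↔ v ∈ W := by
  obtain ⟨T, hT, rfl⟩ := hP
  choose L hL using fun (i : T) (t : I) => exists_clm_derivI hα hΦ (hT i i.2).2 t
  refine ⟨⨅ i : T, (i.1.2.1 • L i 0 + i.1.2.2 • L i 1 : H →L[ℝ] ℝ).toLinearMap.ker, ?_,
    fun a v => ?_⟩
  · rw [Submodule.coe_iInf]
    exact isClosed_iInter fun i => ContinuousLinearMap.isClosed_ker _
  · simp only [Submodule.mem_iInf, LinearMap.mem_ker, DerivCondition, Subtype.forall]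
    refine forall₂_congr fun i hi => ?_
    have h0 : i.1 ≠ 0 := fun h => by simpa [h] using (hT i hi).1
    rw [derivI_const_add_inner hα hΦ h0 (hT i hi).2, derivI_const_add_inner hα hΦ h0 (hT i hi).2,
      ← hL ⟨i, hi⟩, ← hL ⟨i, hi⟩]
    simp

end Functionals

lemma weightedKernel_fin_one (γ : Finset (Fin 1) → ℝ) (k : I → I → ℝ) :
    weightedKernel γ k = fun x y => 1 + γ Finset.univ * (-1 + k (x 0) (y 0)) := by
  funext x y
  rw [weightedKernel, show ({u : Finset (Fin 1) | u.Nonempty} : Finset _) = {Finset.univ} by decide,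
    Finset.sum_singleton]
  simp

/-- One closed subspace `W` of the space of `-1 + sobKernel₁ α` serves every clause: projecting the
features onto `W` gives the unit-weight kernel, its part without constants, and the weighted kernel
for `s = 1`. -/
lemma IsOddCondition.subspaceKernel_spec {α : ℕ} (hα : 0 < α) {P : (I → ℝ) → Prop}
    (hP : IsOddCondition α P) :
    IsKernelOfSubspace (sobKernel₁ α) P (subspaceKernel (sobKernel₁ α) P) ∧
      (IsPSD fun x y => -1 + subspaceKernel (sobKernel₁ α) P x y) ∧
      (∀ f, MemRKHS (fun x y => -1 + subspaceKernel (sobKernel₁ α) P x y) f ↔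
        MemRKHS (fun x y => -1 + sobKernel₁ α x y) f ∧ P f) ∧
      ∀ γ : Finset (Fin 1) → ℝ, 0 < γ Finset.univ →
        IsKernelOfSubspace (sobKernel α γ) (fun f => P (toUnivariate f))
          (weightedKernel γ (subspaceKernel (sobKernel₁ α) P)) := by
  obtain ⟨H, _, _, _, Φ, hΦ⟩ := exists_inner_eq (isPSD_sob hα)
  obtain ⟨W, hW, hPW⟩ := hP.exists_submodule hα hΦ
  have : CompleteSpace W := hW.completeSpace_coe
  have hs : sobKernel₁ α = fun x y => 1 + 1 * ⟪Φ x, Φ y⟫_ℝ := by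
    funext x y
    have := congrFun₂ hΦ x y
    linarith
  have h1 := isKernelOfSubspace_one_add Φ W one_pos hPW
  rw [← hs] at h1
  have hk := subspaceKernel_eq h1
  have hk' : (fun x y => -1 + subspaceKernel (sobKernel₁ α) P x y) =
      fun x y => ⟪W.starProjection (Φ x), Φ y⟫_ℝ := by
    funext x y
    rw [hk]
    ring
  refine ⟨hk ▸ h1, hk' ▸ isPSD_starProjection Φ W, fun f => ?_, fun γ hγ => ?_⟩
  · rw [hk', hΦ]
    exact memRKHS_starProjection_iff Φ W fun v => by simpa using hPW 0 v
  · have h2 := isKernelOfSubspace_one_add (P := fun f => P (toUnivariate f))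
      (fun x : Fin 1 → I => Φ (x 0)) W hγ hPW
    rw [sobKernel, weightedKernel_fin_one, weightedKernel_fin_one, hk, hs]
    simpa using h2

lemma subspaceKernel_eq_sobKernel₁ {α : ℕ} (hα : 0 < α) {P : (I → ℝ) → Prop} (hP : ∀ f, P f) :
    subspaceKernel (sobKernel₁ α) P = sobKernel₁ α := by
  refine subspaceKernel_eq ⟨isReproducingKernel_iff.2 ?_, fun f r => by simp [hP]⟩
  have := isPSD_one.add (isPSD_sob hα)
  simpa using this

/-- A finite product of absolutely convergent series is a series over multi-indices, so the cosine
kernel has the same product form as the other five. -/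
lemma cosKernel_eq {α : ℕ} (hα : 0 < α) {s : ℕ} (γ : Finset (Fin s) → ℝ) :
    cosKernel α γ = weightedKernel γ (cosKernel₁ α) := by
  funext x y
  rw [cosKernel, weightedKernel]
  congr 1
  refine Finset.sum_congr rfl fun u _ => ?_
  have hs : ∀ j : u, Summable fun k : ℕ+ => ‖1 / (k : ℝ) ^ (2 * α) *
      (2 * Real.cos (Real.pi * k * x j) * Real.cos (Real.pi * k * y j))‖ := fun j => by
    refine Summable.of_norm_bounded (summable_pnat_one_div_sq.mul_left 2) fun k => ?_
    rw [norm_norm, norm_mul, norm_mul, norm_mul, mul_comm]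
    have h1 : ‖1 / (k : ℝ) ^ (2 * α)‖ ≤ 1 / (k : ℝ) ^ 2 := by
      rw [Real.norm_of_nonneg (by positivity)]
      have : (1 : ℝ) ≤ k := by exact_mod_cast k.2
      gcongr
      omega
    have h2 : ‖(2 : ℝ)‖ * ‖Real.cos (Real.pi * k * x j)‖ * ‖Real.cos (Real.pi * k * y j)‖ ≤
        2 * 1 * 1 := by
      rw [Real.norm_of_nonneg zero_le_two]
      gcongr <;> exact Real.abs_cos_le_one _
    calc _ ≤ 2 * 1 * 1 * (1 / (k : ℝ) ^ 2) := by gcongr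
      _ = _ := by ring
  have := (hasSum_fintype_prod _ hs).mul_left (γ u)
  simp only [Finset.prod_mul_distrib, ← mul_assoc] at this
  rw [← Finset.prod_coe_sort]
  simp only [cosKernel₁, neg_add_cancel_left, Finset.prod_mul_distrib, ← mul_assoc]
  exact this.tsum_eq

end Conditions

/-! ### Embeddings of the weighted spaces -/

section Embeddings

open Real
open scoped InnerProductSpace

variable {s : ℕ} {γ : Finset (Fin s) → ℝ} {k l : I → I → ℝ}

/-- The bridge from one variable to `s`: a univariate inclusion of sets, without any norm estimate,
suffices. -/
lemma embeds_weightedKernel_of_memRKHS (hγ : ∀ u, 0 ≤ γ u) (hk : IsPSD fun x y => -1 + k x y)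
    (hl : IsPSD fun x y => -1 + l x y)
    (h : ∀ f, MemRKHS (fun x y => -1 + k x y) f → MemRKHS (fun x y => -1 + l x y) f) :
    Embeds (weightedKernel γ k) (weightedKernel γ l) :=
  embeds_weightedKernel hγ hk hl (exists_le_of_memRKHS hk hl h)

lemma normEquivalent_weightedKernel_of_memRKHS (hγ : ∀ u, 0 ≤ γ u)
    (hk : IsPSD fun x y => -1 + k x y) (hl : IsPSD fun x y => -1 + l x y)
    (h : ∀ f, MemRKHS (fun x y => -1 + k x y) f ↔ MemRKHS (fun x y => -1 + l x y) f) :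
    NormEquivalent (weightedKernel γ k) (weightedKernel γ l) :=
  ⟨embeds_weightedKernel_of_memRKHS hγ hk hl fun f => (h f).1,
    embeds_weightedKernel_of_memRKHS hγ hl hk fun f => (h f).2⟩

lemma memRKHS_sob_bernoulliTower_two {α : ℕ} (hα : 0 < α) :
    MemRKHS (fun x y => -1 + sobKernel₁ α x y) fun x => bernoulliTower 2 0 x :=
  (memRKHS_sob_iff_tower hα).2 ⟨_, isSobolevTower_bernoulliTower α 2, fun _ => rfl,
    integral_bernoulliTower two_ne_zero⟩

lemma exists_memRKHS_sob_not_memRKHS_korCos {α : ℕ} (hα : 2 ≤ α) (hγ : ∀ u, 0 ≤ γ u)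
    {u : Finset (Fin s)} (hu : u.Nonempty) (hγu : 0 < γ u) :
    ∃ f, MemRKHS (sobKernel α γ) f ∧ ¬ MemRKHS (korCosKernel α γ) f := by
  have hα0 : 0 < α := by omega
  -- `B₂ / 2` has derivative `B₁`, which jumps by `1` and so violates the periodicity condition of
  -- order `1`.
  refine ⟨fun x => ∏ j ∈ u, bernoulliTower 2 0 (x j), memRKHS_weightedKernel_prod hγ
    (isPSD_sob hα0) hu hγu (memRKHS_sob_bernoulliTower_two hα0), fun h => ?_⟩
  obtain ⟨j, hj⟩ := hu
  -- The other variables are frozen at `0`, where `B₂ / 2` equals `1/12`; hence the remaining factor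
  -- `κ` is nonzero.
  obtain ⟨c, g, hg, hcg⟩ := MemRKHS.update hγ (isPSD_korCos hα0) h 0 j
  obtain ⟨hgs, hgp⟩ := (memRKHS_korCos_iff_oddPeriodic hα0).1 hg
  obtain ⟨G, hG, hgG, -⟩ := (memRKHS_sob_iff_tower hα0).1 hgs
  set κ : ℝ := ∏ i ∈ u.erase j, bernoulliTower 2 0 (0 : I) with hκ
  have hκ0 : κ ≠ 0 := Finset.prod_ne_zero_iff.2 fun i _ => by
    rw [bernoulliTower, if_pos (Nat.zero_le _), Set.Icc.coe_zero, Nat.sub_zero,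
      bernoulliFun_eval_zero, bernoulli_two]
    norm_num [Nat.factorial]
  have hfg : ∀ t : I, κ * bernoulliTower 2 0 t = c + g t := fun t => by
    rw [← hcg, ← Finset.mul_prod_erase _ _ hj, Function.update_self, mul_comm]
    congr 1
    refine Finset.prod_congr rfl fun i hi => ?_
    rw [Function.update_of_ne (Finset.ne_of_mem_erase hi)]
    rfl
  have hA : IsSobolevTower α fun τ _ => if τ = 0 then -c else 0 :=
    IsSobolevTower.of_hasDerivAt fun τ x => by simpa using hasDerivAt_const x _
  have hT := hA.add ((isSobolevTower_bernoulliTower α 2).const_mul κ)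
  have hd := hgp 1 odd_one hα
  have hgT : ∀ x : I, g x = (if 0 = 0 then -c else 0) + κ * bernoulliTower 2 0 x := fun t => by
    rw [hfg]
    simp
  rw [hT.derivI_eq hgT hα, hT.derivI_eq hgT hα] at hd
  have h1 := bernoulliTower_one_sub 2 1
  simp at hd h1
  rcases hd with hd | hd
  · rw [hd] at h1
    simp at h1
  · exact hκ0 hd

/-- For odd `τ` the number `τ + 1` is even, so it cannot equal the odd `α`. -/
lemma oddPeriodic_eq_lower_of_odd {α : ℕ} (hα : Odd α) : OddPeriodic α = OddPeriodicLower α := by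
  funext f
  refine propext (forall₂_congr fun τ hτ => ?_)
  have : τ + 1 ≤ α ↔ τ + 2 ≤ α := by
    obtain ⟨a, rfl⟩ := hα
    obtain ⟨b, rfl⟩ := hτ
    omega
  rw [this]

end Embeddings

theorem theorem1 (α : ℕ) (hα : 1 ≤ α) :
    -- the three univariate subspaces of the Sobolev space with unit weight are RKHSs
    (IsKernelOfSubspace (sobKernel₁ α) (OddPeriodic α) (sobOddKernel₁ α) ∧
      IsKernelOfSubspace (sobKernel₁ α) (OddPeriodicLower α) (sobOddAlphaKernel₁ α) ∧
      IsKernelOfSubspace (sobKernel₁ α) (OddVanishing α) (sobOddBdryKernel₁ α)) ∧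
    -- any dimension, general weights
    (∀ (s : ℕ) (γ : Finset (Fin s) → ℝ), (∀ u, 0 ≤ γ u) →
      -- all six spaces exist
      (IsReproducingKernel (cosKernel α γ) ∧
        IsReproducingKernel (korCosKernel α γ) ∧
        IsReproducingKernel (sobKernel α γ) ∧
        IsReproducingKernel (sobOddKernel α γ) ∧
        IsReproducingKernel (sobOddAlphaKernel α γ) ∧
        IsReproducingKernel (sobOddBdryKernel α γ)) ∧
      (α = 1 →
        NormEquivalent (cosKernel α γ) (korCosKernel α γ) ∧
        NormEquivalent (korCosKernel α γ) (sobKernel α γ) ∧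
        SameRKHS (sobKernel α γ) (sobOddKernel α γ) ∧
        SameRKHS (sobOddKernel α γ) (sobOddAlphaKernel α γ) ∧
        SameRKHS (sobOddAlphaKernel α γ) (sobOddBdryKernel α γ)) ∧
      (Odd α → 1 < α →
        NormEquivalent (cosKernel α γ) (sobOddBdryKernel α γ) ∧
        Embeds (sobOddBdryKernel α γ) (korCosKernel α γ) ∧
        NormEquivalent (korCosKernel α γ) (sobOddKernel α γ) ∧
        SameRKHS (sobOddKernel α γ) (sobOddAlphaKernel α γ) ∧
        Embeds (sobOddAlphaKernel α γ) (sobKernel α γ)) ∧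
      (Even α →
        NormEquivalent (cosKernel α γ) (sobOddBdryKernel α γ) ∧
        Embeds (sobOddBdryKernel α γ) (korCosKernel α γ) ∧
        NormEquivalent (korCosKernel α γ) (sobOddKernel α γ) ∧
        Embeds (sobOddKernel α γ) (sobOddAlphaKernel α γ) ∧
        Embeds (sobOddAlphaKernel α γ) (sobKernel α γ) ∧
        (α = 2 → SameRKHS (sobOddAlphaKernel α γ) (sobKernel α γ))) ∧
      -- `H(kor+cos)` is strictly smaller than `H(sob)`, unless all weights vanish
      (2 ≤ α → (∃ u : Finset (Fin s), u.Nonempty ∧ 0 < γ u) →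
        (∀ f, MemRKHS (korCosKernel α γ) f → MemRKHS (sobKernel α γ) f) ∧
        ∃ f, MemRKHS (sobKernel α γ) f ∧ ¬ MemRKHS (korCosKernel α γ) f)) ∧
    -- for `s = 1` and a positive weight, the three weighted kernels are those of the subspaces
    -- of the weighted Sobolev space given by the conditions on the odd derivatives
    (∀ γ : Finset (Fin 1) → ℝ, 0 < γ Finset.univ →
      IsKernelOfSubspace (sobKernel α γ) (fun f => OddPeriodic α (toUnivariate f))
        (sobOddKernel α γ) ∧
      IsKernelOfSubspace (sobKernel α γ) (fun f => OddPeriodicLower α (toUnivariate f))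
        (sobOddAlphaKernel α γ) ∧
      IsKernelOfSubspace (sobKernel α γ) (fun f => OddVanishing α (toUnivariate f))
        (sobOddBdryKernel α γ)) := by
  have hα0 : 0 < α := hα
  obtain ⟨hp1, hp2, hp3, hp4⟩ := (isOddCondition_oddPeriodic α).subspaceKernel_spec hα0
  obtain ⟨hl1, hl2, hl3, hl4⟩ := (isOddCondition_oddPeriodicLower α).subspaceKernel_spec hα0
  obtain ⟨hv1, hv2, hv3, hv4⟩ := (isOddCondition_oddVanishing α).subspaceKernel_spec hα0
  refine ⟨⟨hp1, hl1, hv1⟩, fun s γ hγ => ?_, fun γ hγ => ⟨hp4 γ hγ, hl4 γ hγ, hv4 γ hγ⟩⟩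
  have hc := isPSD_cos hα0
  have hkc := isPSD_korCos hα0
  have hs := isPSD_sob hα0
  have e1 : NormEquivalent (cosKernel α γ) (sobOddBdryKernel α γ) := by
    rw [cosKernel_eq hα0]
    exact normEquivalent_weightedKernel_of_memRKHS hγ hc hv2 fun f =>
      (memRKHS_cos_iff_oddVanishing hα0).trans (hv3 f).symm
  have e2 : Embeds (sobOddBdryKernel α γ) (korCosKernel α γ) :=
    embeds_weightedKernel_of_memRKHS hγ hv2 hkc fun f hf =>
      (memRKHS_korCos_iff_oddPeriodic hα0).2 (((hv3 f).1 hf).imp_right fun h τ ho hτ =>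
        (h τ ho hτ).1.trans (h τ ho hτ).2.symm)
  have e3 : NormEquivalent (korCosKernel α γ) (sobOddKernel α γ) :=
    normEquivalent_weightedKernel_of_memRKHS hγ hkc hp2 fun f =>
      (memRKHS_korCos_iff_oddPeriodic hα0).trans (hp3 f).symm
  have e4 : Embeds (sobOddKernel α γ) (sobOddAlphaKernel α γ) :=
    embeds_weightedKernel_of_memRKHS hγ hp2 hl2 fun f hf =>
      (hl3 f).2 (((hp3 f).1 hf).imp_right fun h τ ho hτ => h τ ho (by omega))
  have e5 : Embeds (sobOddAlphaKernel α γ) (sobKernel α γ) :=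
    embeds_weightedKernel_of_memRKHS hγ hl2 hs fun f hf => ((hl3 f).1 hf).1
  have e6 : Embeds (korCosKernel α γ) (sobKernel α γ) :=
    embeds_weightedKernel_of_memRKHS hγ hkc hs fun f hf =>
      ((memRKHS_korCos_iff_oddPeriodic hα0).1 hf).1
  refine ⟨⟨?_, ?_, ?_, ?_, ?_, ?_⟩, ?_, ?_, ?_, ?_⟩
  · rw [cosKernel_eq hα0]
    exact isReproducingKernel_iff.2 (isPSD_weightedKernel hγ hc)
  · exact isReproducingKernel_iff.2 (isPSD_weightedKernel hγ hkc)
  · exact isReproducingKernel_iff.2 (isPSD_weightedKernel hγ hs)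
  · exact isReproducingKernel_iff.2 (isPSD_weightedKernel hγ hp2)
  · exact isReproducingKernel_iff.2 (isPSD_weightedKernel hγ hl2)
  · exact isReproducingKernel_iff.2 (isPSD_weightedKernel hγ hv2)
  · rintro rfl
    -- For `α = 1` all three conditions are empty, so the three subspace kernels coincide with the
    -- Sobolev kernel.
    have no_odd : ∀ τ : ℕ, Odd τ → ¬ τ + 1 ≤ 1 := fun τ ho h => by
      obtain ⟨a, rfl⟩ := ho
      omega
    have hp : ∀ f, OddPeriodic 1 f := fun f τ ho h => absurd h (no_odd τ ho)
    have hl : ∀ f, OddPeriodicLower 1 f := fun f τ ho h => absurd h (by omega)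
    have hv : ∀ f, OddVanishing 1 f := fun f τ ho h => absurd h (no_odd τ ho)
    have kp := subspaceKernel_eq_sobKernel₁ one_pos hp
    have kl := subspaceKernel_eq_sobKernel₁ one_pos hl
    have kv := subspaceKernel_eq_sobKernel₁ one_pos hv
    simp only [sobKernel, sobOddKernel, sobOddAlphaKernel, sobOddBdryKernel, sobOddKernel₁,
      sobOddAlphaKernel₁, sobOddBdryKernel₁, kp, kl, kv] at e1 e2 e3 ⊢
    refine ⟨?_, e3, fun _ _ => Iff.rfl, fun _ _ => Iff.rfl, fun _ _ => Iff.rfl⟩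
    rw [cosKernel_eq one_pos]
    exact normEquivalent_weightedKernel_of_memRKHS hγ hc hkc fun f => by
      rw [memRKHS_cos_iff_oddVanishing one_pos, memRKHS_korCos_iff_oddPeriodic one_pos,
        iff_true_intro (hv f), iff_true_intro (hp f)]
  · intro ho _
    refine ⟨e1, e2, e3, ?_, e5⟩
    rw [sobOddKernel, sobOddAlphaKernel, sobOddKernel₁, sobOddAlphaKernel₁,
      oddPeriodic_eq_lower_of_odd ho]
    exact fun _ _ => Iff.rfl
  · intro _
    refine ⟨e1, e2, e3, e4, e5, ?_⟩
    rintro rfl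
    -- For `α = 2` the condition would concern odd `τ ≤ 0`, so it is empty.
    have hl : ∀ f, OddPeriodicLower 2 f := fun f τ ho h => by
      obtain ⟨a, rfl⟩ := ho
      omega
    rw [sobOddAlphaKernel, sobKernel, sobOddAlphaKernel₁, subspaceKernel_eq_sobKernel₁ two_pos hl]
    exact fun _ _ => Iff.rfl
  · rintro h2 ⟨u, hu, hγu⟩
    exact ⟨fun f => e6.memRKHS, exists_memRKHS_sob_not_memRKHS_korCos h2 hγ hu hγu⟩
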